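/- Let $M_r$ be the algebra of complex $r\times r$ matrices with the operator norm induced by the Euclidean norm of $\mathbb C^r$, and let $\Omega=\{(x,t): 0\le t\le x\le 1\}$. A function $H\in L_2((-1,1),M_r)$ is called an accelerant if it is even, $H(-x)=H(x)$ for almost all $x$, and if for every $a\in[0,1]$ the equation $$f(x)+\int_0^a H(x-t)f(t)\,dt=0,\qquad x\in(0,1),$$ has only the trivial solution $f=0$ in $L_2((0,1),\mathbb C^r)$. Let $\mathfrak H_2$ be the set of all accelerants, endowed with the metric of $L_2((-1,1),M_r)$. **Theorem 1.7.** (a) For every $H\in\mathfrak H_2$ the Krein equation $$R(x,t)+H(x-t)+\int_0^x R(x,\xi)H(\xi-t)\,d\xi=0,\qquad (x,t)\in\Omega,$$ has a unique solution $R_H$ in $L_2(\Omega,M_r)$, so that $$[\Theta(H)](x):=H(x)+\int_0^x R_H(x,\xi)H(\xi)\,d\xi,\qquad x\in(0,1),$$ defines a map $\Theta:\mathfrak H_2\to L_2((0,1),M_r)$. Moreover $\Theta(H)=-R_H(\cdot,0)$, in the following sense: if $R_H$ is extended by zero to $0\le x<t\le1$, then $t\mapsto R_H(\cdot,t)$ agrees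 for almost every $t$ with a continuous map from $[0,1]$ to $L_2((0,1),M_r)$, and the value of this map at $t=0$ is $-\Theta(H)$. (b) The map $\Theta$ is a homeomorphism from $\mathfrak H_2$ onto $L_2((0,1),M_r)$. (c) If $H\in\mathfrak H_2$, then the pointwise adjoint $H^*$ belongs to $\mathfrak H_2$ and $\Theta(H^*)=\Theta(H)^*$. -/

import Mathlib

open MeasureTheory
open scoped Matrix.Norms.L2Operator

/-- The space `ℂ^r` with its Euclidean norm. -/
abbrev CVec (r : ℕ) : Type := EuclideanSpace ℂ (Fin r)

/-- `M_r`: the `r × r` complex matrices.  The norm in force is the operator norm with respect to the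
Euclidean norm of `ℂ^r` (this is what the scope opened above provides), and `star` is the conjugate
transpose. -/
abbrev Mr (r : ℕ) : Type := Matrix (Fin r) (Fin r) ℂ

/-- Lebesgue measure on `(0,1)`. -/
noncomputable abbrev volUnit : Measure ℝ := volume.restrict (Set.Ioo (0 : ℝ) 1)

/-- Lebesgue measure on `(-1,1)`. -/
noncomputable abbrev volSym : Measure ℝ := volume.restrict (Set.Ioo (-1 : ℝ) 1)

/-- The closed triangle `Ω = {(x,t) | 0 ≤ t ≤ x ≤ 1}`. -/
def triangle : Set (ℝ × ℝ) := {p | 0 ≤ p.2 ∧ p.2 ≤ p.1 ∧ p.1 ≤ 1}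

/-- `L_2((0,1), M_r)`. -/
noncomputable abbrev L2Unit (r : ℕ) : Type := Lp (Mr r) 2 volUnit

/-- `L_2((-1,1), M_r)`. -/
noncomputable abbrev L2Sym (r : ℕ) : Type := Lp (Mr r) 2 volSym

/-- `L_2(Ω, M_r)`. -/
noncomputable abbrev L2Tri (r : ℕ) : Type := Lp (Mr r) 2 (volume.restrict triangle)

/-- The set of accelerants: the even `H ∈ L_2((-1,1), M_r)` such that, for every `a ∈ [0,1]`, the
equation `f(x) + ∫_0^a H(x-t) f(t) dt = 0` on `(0,1)` has only the trivial solution in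
`L_2((0,1), ℂ^r)`.  As a subset of `L2Sym r` it carries the metric of that space. -/
def accelerants (r : ℕ) : Set (L2Sym r) :=
  {H | (∀ᵐ x ∂volSym, H (-x) = H x) ∧
    ∀ a ∈ Set.Icc (0 : ℝ) 1, ∀ f : Lp (CVec r) 2 volUnit,
      (∀ᵐ x ∂volUnit,
        f x + ∫ t in (0 : ℝ)..a, Matrix.toEuclideanCLM (𝕜 := ℂ) (H (x - t)) (f t) = 0) →
      f = 0}

/-- `R ∈ L_2(Ω, M_r)` solves the Krein equation
`R(x,t) + H(x-t) + ∫_0^x R(x,ξ) H(ξ-t) dξ = 0` for almost all `(x,t) ∈ Ω`. -/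
def IsKreinSolution {r : ℕ} (H : L2Sym r) (R : L2Tri r) : Prop :=
  ∀ᵐ p ∂(volume.restrict triangle),
    R p + H (p.1 - p.2) + ∫ ξ in (0 : ℝ)..p.1, R (p.1, ξ) * H (ξ - p.2) = 0

/-- The solution `R_H` of the Krein equation (an arbitrary element if there is no solution; it is
part of the theorem that for an accelerant there is exactly one). -/
noncomputable def kreinSolution {r : ℕ} (H : L2Sym r) : L2Tri r :=
  Classical.epsilon fun R => IsKreinSolution H R

/-- `ρ = R(·,0)`.  An element `R` of `L_2(Ω, M_r)`, extended by zero to the unit square, has a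
section at `t = 0` if the sections `t ↦ R(·,t)` agree for almost every `t` with a continuous map
from `[0,1]` to `L_2((0,1), M_r)`; the section is then the value of that map at `0`, which is
uniquely determined. -/
def IsSectionAtZero {r : ℕ} (R : L2Tri r) (ρ : L2Unit r) : Prop :=
  ∃ K : ℝ → L2Unit r, ContinuousOn K (Set.Icc 0 1) ∧
    (∀ᵐ t ∂volUnit, ∀ᵐ x ∂volUnit, K t x = triangle.indicator R (x, t)) ∧
    K 0 = ρ

theorem measurableSet_triangle : MeasurableSet triangle := by
  have h1 : IsClosed {p : ℝ × ℝ | 0 ≤ p.2} := isClosed_le continuous_const continuous_snd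
  have h2 : IsClosed {p : ℝ × ℝ | p.2 ≤ p.1} := isClosed_le continuous_snd continuous_fst
  have h3 : IsClosed {p : ℝ × ℝ | p.1 ≤ 1} := isClosed_le continuous_fst continuous_const
  exact (h1.inter (h2.inter h3)).measurableSet

theorem memLp_kernel_mul {A : Type*} [NormedRing A] [NormedSpace ℝ A]
    (S : ℝ × ℝ → A) (h : ℝ → A) (μ : Measure ℝ) [SFinite μ]
    (hSm : StronglyMeasurable S) (hhm : StronglyMeasurable h)
    (hS : ∫⁻ x, ∫⁻ ξ, ‖S (x, ξ)‖ₑ ^ (2 : ℝ) ∂μ ∂μ < ⊤)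
    (hh : ∫⁻ ξ, ‖h ξ‖ₑ ^ (2 : ℝ) ∂μ < ⊤) :
    MemLp (fun x => ∫ ξ, S (x, ξ) * h ξ ∂μ) 2 μ := by
  have hFm : StronglyMeasurable fun x => ∫ ξ, S (x, ξ) * h ξ ∂μ :=
    StronglyMeasurable.integral_prod_right'
      (f := fun p : ℝ × ℝ => S p * h p.2) (hSm.mul (hhm.comp_measurable measurable_snd))
  refine ⟨hFm.aestronglyMeasurable, ?_⟩
  rw [eLpNorm_lt_top_iff_lintegral_rpow_enorm_lt_top (by norm_num) (by norm_num)]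
  have hb : ∀ x, ‖∫ ξ, S (x, ξ) * h ξ ∂μ‖ₑ ^ (2 : ℝ) ≤
      (∫⁻ ξ, ‖S (x, ξ)‖ₑ ^ (2 : ℝ) ∂μ) * ∫⁻ ξ, ‖h ξ‖ₑ ^ (2 : ℝ) ∂μ := by
    intro x
    have h1 : ‖∫ ξ, S (x, ξ) * h ξ ∂μ‖ₑ ≤ ∫⁻ ξ, ‖S (x, ξ)‖ₑ * ‖h ξ‖ₑ ∂μ := by
      refine (enorm_integral_le_lintegral_enorm _).trans (lintegral_mono fun ξ => ?_)
      simp only [← ofReal_norm]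
      rw [← ENNReal.ofReal_mul (norm_nonneg _)]
      exact ENNReal.ofReal_le_ofReal (norm_mul_le _ _)
    have h2 := ENNReal.lintegral_mul_le_Lp_mul_Lq μ Real.HolderConjugate.two_two
      (f := fun ξ => ‖S (x, ξ)‖ₑ) (g := fun ξ => ‖h ξ‖ₑ)
      (hSm.comp_measurable measurable_prodMk_left).enorm.aemeasurable hhm.enorm.aemeasurable
    have h3 := ENNReal.rpow_le_rpow (h1.trans h2) (by norm_num : (0 : ℝ) ≤ 2)
    rw [ENNReal.mul_rpow_of_nonneg _ _ (by norm_num), ← ENNReal.rpow_mul,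
      ← ENNReal.rpow_mul] at h3
    simpa using h3
  have : ∫⁻ x, ‖∫ ξ, S (x, ξ) * h ξ ∂μ‖ₑ ^ (2 : ℝ) ∂μ < ⊤ := by
    refine (lintegral_mono hb).trans_lt ?_
    rw [lintegral_mul_const' _ _ hh.ne]
    exact ENNReal.mul_lt_top hS hh
  simpa using this

theorem lintegral_rpow_two_lt_top {α A : Type*} [MeasurableSpace α] [NormedAddCommGroup A]
    {μ : Measure α} {f : α → A} (hf : MemLp f 2 μ) : ∫⁻ x, ‖f x‖ₑ ^ (2 : ℝ) ∂μ < ⊤ := by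
  have := lintegral_rpow_enorm_lt_top_of_eLpNorm_lt_top (by norm_num) (by norm_num) hf.2
  simpa using this

theorem memLp_volterra_mul {A : Type*} [NormedRing A] [NormedSpace ℝ A]
    (R : ℝ × ℝ → A) (h : ℝ → A)
    (hRm : StronglyMeasurable R) (hhm : StronglyMeasurable h)
    (hR : MemLp R 2 (volume.restrict triangle)) (hh : MemLp h 2 volUnit) :
    MemLp (fun x : ℝ => ∫ ξ in (0 : ℝ)..x, R (x, ξ) * h ξ) 2 volUnit := by
  have key : (fun x : ℝ => ∫ ξ in (0 : ℝ)..x, R (x, ξ) * h ξ) =ᵐ[volUnit]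
      fun x => ∫ ξ, triangle.indicator R (x, ξ) * h ξ ∂volUnit := by
    filter_upwards [ae_restrict_mem measurableSet_Ioo] with x hx
    rw [intervalIntegral.integral_of_le hx.1.le, ← integral_indicator measurableSet_Ioc,
      ← integral_indicator measurableSet_Ioo]
    congr 1
    funext ξ
    by_cases h0 : ξ ∈ Set.Ioc 0 x
    · have h1 : ξ ∈ Set.Ioo (0 : ℝ) 1 := ⟨h0.1, h0.2.trans_lt hx.2⟩
      have h2 : (x, ξ) ∈ triangle := ⟨h0.1.le, h0.2, hx.2.le⟩
      rw [Set.indicator_of_mem h0, Set.indicator_of_mem h1, Set.indicator_of_mem h2]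
    · rw [Set.indicator_of_notMem h0]
      by_cases h1 : ξ ∈ Set.Ioo (0 : ℝ) 1
      · have h2 : (x, ξ) ∉ triangle := fun h3 => h0 ⟨h1.1, h3.2.1⟩
        rw [Set.indicator_of_mem h1, Set.indicator_of_notMem h2, zero_mul]
      · rw [Set.indicator_of_notMem h1]
  refine (memLp_congr_ae key).2 ?_
  have hSm := hRm.indicator measurableSet_triangle
  refine memLp_kernel_mul _ _ _ hSm hhm ?_ (lintegral_rpow_two_lt_top hh)
  have h2 : ∫⁻ p, ‖triangle.indicator R p‖ₑ ^ (2 : ℝ) =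
      ∫⁻ p in triangle, ‖R p‖ₑ ^ (2 : ℝ) := by
    rw [← lintegral_indicator measurableSet_triangle]
    congr 1
    funext p
    by_cases h : p ∈ triangle <;> simp [h]
  rw [← lintegral_prod (μ := volUnit) (ν := volUnit)
    (fun p => ‖triangle.indicator R p‖ₑ ^ (2 : ℝ)) (hSm.enorm.pow_const _).aemeasurable,
    Measure.prod_restrict]
  refine (lintegral_mono' Measure.restrict_le_self le_rfl).trans_lt ?_
  rw [← Measure.volume_eq_prod, h2]
  exact lintegral_rpow_two_lt_top hR

theorem memLp_thetaFun {r : ℕ} (H : L2Sym r) (R : L2Tri r) :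
    MemLp (fun x : ℝ => H x + ∫ ξ in (0 : ℝ)..x, R (x, ξ) * H ξ) 2 volUnit := by
  have hsub : volUnit ≤ volSym :=
    Measure.restrict_mono (Set.Ioo_subset_Ioo (by norm_num) le_rfl) le_rfl
  have hH : MemLp H 2 volUnit := (Lp.memLp H).mono_measure hsub
  exact hH.add (memLp_volterra_mul _ _ (Lp.stronglyMeasurable R) (Lp.stronglyMeasurable H)
    (Lp.memLp R) hH)

/-- The map `Θ` from the accelerants to `L_2((0,1), M_r)`,
`[Θ(H)](x) = H(x) + ∫_0^x R_H(x,ξ) H(ξ) dξ`. -/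
noncomputable def Theta (r : ℕ) (H : accelerants r) : L2Unit r :=
  (memLp_thetaFun H.1 (kreinSolution H.1)).toLp
    (fun x : ℝ => H.1 x + ∫ ξ in (0 : ℝ)..x, kreinSolution H.1 (x, ξ) * H.1 ξ)

/-! Extend `H` by zero to the line. Translation is continuous in L_2, so ∫ f(ξ) H(ξ-t) dξ is
continuous in t for every f in L_2. All equations can therefore be solved in C([0,1]), with integral
operators whose kernels are continuous families of L_2 functions. Such an operator is compact on
C([0,1]), and if it is of Volterra type, 1 plus it is invertible outright
(`isUnit_one_sub_kernelOp`).

Krein equation. The accelerant condition says that 1 + 𝓗_a, with `H` acting from the left, is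
injective. By the Fredholm alternative it is onto, and since left and right convolution with an even
`H` are transposes of each other, the right-hand version is injective too
(`ConvInjective.right_of_left`). For fixed x the Krein equation is such a right-hand equation for
the row R(x,·), with a = x. Its solution is R(x,t) = c(x,t) - H(x-t), where c is continuous and
depends continuously on `H`. The integral term at t = 0 is -c(x,0), so Θ(H) = H - c(·,0) = -R(·,0);
continuity of Θ and the section at t = 0 follow.

Injectivity. The row at x sees only the values of `H` on (-x,x). Hence c_H(x,0) - c_K(x,0) is
bounded by a constant times the L_2 norm of H - K on (-x,x) (`exists_norm_kreinC_sub_le`). If Θ(H) =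
Θ(K), this difference equals (H - K)(x), and Grönwall's lemma gives H = K.

Surjectivity. If ρ = Θ(H), then β(x,y) = R(x,x-y) + ρ(y) should satisfy β(x,y) = -∫_y^x ρ(s) R(s,y)
ds, the integrated form of ∂_x R(x,x-y) = R(x,0) R(x,y). For an arbitrary ρ this is a Volterra
equation for β alone. Its solution defines R, and a second Volterra equation gives the h for which
the even extension `H` of ρ + h satisfies the Krein equation at t = 0. The defect of the Krein
equation solves the homogeneous version of the first Volterra equation, so it vanishes on all of Ω
(`invDefect_add_windowOp`). A resolvent kernel for every x turns (1 + 𝓗_a)F = 0 into a Volterra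
equation on [x,a], so `H` is an accelerant (`convInjective_of_isKreinRow`). Everything depends
continuously on ρ, which makes this right inverse of the injective map Θ a continuous inverse.

Adjoints. The reflected adjoint of a row for `H*` solves the left-hand equation for `H`; pairing it
with the row for `H` gives c_{H*}(x,0) = c_H(x,0)* (`kreinC_star_apply_zero`). -/

section KreinAccelerants

open Set Filter Topology

set_option linter.unusedSectionVars false

/-- `L_2(ℝ, E)`. -/
abbrev L2Line (E : Type*) [NormedAddCommGroup E] : Type _ := Lp E 2 (volume : Measure ℝ)

/-- The closed unit interval as a compact space. -/
abbrev UnitI : Type := Set.Icc (0 : ℝ) 1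

/-! ### Truncation, translation and extension by zero on L_2(ℝ) -/

section Basic

variable {E : Type*} [NormedAddCommGroup E] [NormedSpace ℂ E]

/-- A continuous linear map into `L_2(ℝ, E)` given by representatives. -/
noncomputable def toL2Line {V : Type*} [NormedAddCommGroup V] [NormedSpace ℂ V] (Φ : V → ℝ → E)
    (hmem : ∀ f, MemLp (Φ f) 2 (volume : Measure ℝ))
    (hadd : ∀ f g, Φ (f + g) =ᵐ[volume] Φ f + Φ g)
    (hsmul : ∀ (c : ℂ) f, Φ (c • f) =ᵐ[volume] c • Φ f)
    (hle : ∀ f, eLpNorm (Φ f) 2 volume ≤ ENNReal.ofReal ‖f‖) : V →L[ℂ] L2Line E :=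
  LinearMap.mkContinuous
    { toFun := fun f => (hmem f).toLp (Φ f)
      map_add' := fun f g => by
        rw [← MemLp.toLp_add]
        exact MemLp.toLp_congr _ _ (hadd f g)
      map_smul' := fun c f => by
        rw [RingHom.id_apply, ← MemLp.toLp_const_smul]
        exact MemLp.toLp_congr _ _ (hsmul c f) } 1 (fun f => by
    rw [one_mul]
    change ‖(hmem f).toLp (Φ f)‖ ≤ _
    rw [Lp.norm_toLp]
    exact ENNReal.toReal_le_of_le_ofReal (norm_nonneg _) (hle f))

section toL2Line

variable {V : Type*} [NormedAddCommGroup V] [NormedSpace ℂ V] {Φ : V → ℝ → E}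
    {hmem : ∀ f, MemLp (Φ f) 2 (volume : Measure ℝ)}
    {hadd : ∀ f g, Φ (f + g) =ᵐ[volume] Φ f + Φ g}
    {hsmul : ∀ (c : ℂ) f, Φ (c • f) =ᵐ[volume] c • Φ f}
    {hle : ∀ f, eLpNorm (Φ f) 2 volume ≤ ENNReal.ofReal ‖f‖}

theorem coeFn_toL2Line (f : V) : toL2Line Φ hmem hadd hsmul hle f =ᵐ[volume] Φ f :=
  (hmem f).coeFn_toLp

theorem norm_toL2Line_le (f : V) : ‖toL2Line Φ hmem hadd hsmul hle f‖ ≤ ‖f‖ := by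
  change ‖(hmem f).toLp (Φ f)‖ ≤ _
  rw [Lp.norm_toLp]
  exact ENNReal.toReal_le_of_le_ofReal (norm_nonneg _) (hle f)

end toL2Line

theorem eLpNorm_coeFn_eq {E : Type*} [NormedAddCommGroup E] {μ : Measure ℝ} (f : Lp E 2 μ) :
    eLpNorm f 2 μ = ENNReal.ofReal ‖f‖ := by
  rw [Lp.norm_def, ENNReal.ofReal_toReal (Lp.eLpNorm_ne_top f)]

theorem indicator_const_smul_fun (s : Set ℝ) (c : ℂ) (f : ℝ → E) :
    s.indicator (c • f) = c • s.indicator f :=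
  indicator_const_smul s c f

/-- Multiplication by the indicator of `(a, b]` on `L_2(ℝ, E)`. -/
noncomputable def cut (a b : ℝ) : L2Line E →L[ℂ] L2Line E :=
  toL2Line (fun f => (Ioc a b).indicator f)
    (fun f => (Lp.memLp f).indicator measurableSet_Ioc)
    (fun f g => by
      rw [← indicator_add']
      exact (Lp.coeFn_add f g).mono fun x hx => by simp only [indicator_apply, hx])
    (fun c f => by
      rw [← indicator_const_smul_fun]
      exact (Lp.coeFn_smul c f).mono fun x hx => by simp only [indicator_apply, hx, Pi.smul_apply])
    (fun f => (eLpNorm_indicator_le _).trans_eq (eLpNorm_coeFn_eq f))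

theorem coeFn_cut (a b : ℝ) (f : L2Line E) : cut a b f =ᵐ[volume] (Ioc a b).indicator f :=
  coeFn_toL2Line f

theorem norm_cut_le (a b : ℝ) (f : L2Line E) : ‖cut a b f‖ ≤ ‖f‖ :=
  norm_toL2Line_le f

/-- Truncations are contractions, so it suffices to vary the endpoints for f in the dense set of
simple functions. For an indicator of finite measure the error is controlled by the measure of a
symmetric difference, at most the total displacement of the endpoints. -/
theorem continuous_cut :
    Continuous fun p : L2Line E × (ℝ × ℝ) => cut p.2.1 p.2.2 p.1 := by
  refine continuous_prod_of_dense_continuous_lipschitzWith _ 1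
    (MeasureTheory.Lp.simpleFunc.dense ENNReal.ofNat_ne_top) ?_ fun q => ?_
  · intro f hf
    lift f to Lp.simpleFunc E 2 (volume : Measure ℝ) using hf
    induction f using Lp.simpleFunc.induction two_ne_zero ENNReal.ofNat_ne_top with
    | add hfp hgp _ ihf ihg =>
      simp only [AddSubgroup.coe_add, map_add]
      exact ihf.add ihg
    | @indicatorConst c s hs hμs =>
      have key : ∀ q : ℝ × ℝ, cut q.1 q.2 ((Lp.simpleFunc.indicatorConst 2 hs hμs.ne c : _) :
          L2Line E) = indicatorConstLp 2 (measurableSet_Ioc.inter hs)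
            (measure_ne_top_of_subset inter_subset_right hμs.ne : volume (Ioc q.1 q.2 ∩ s) ≠ ⊤)
              c := by
        intro q
        rw [Lp.simpleFunc.coe_indicatorConst]
        ext1
        refine (coeFn_cut _ _ _).trans ?_
        filter_upwards [indicatorConstLp_coeFn (p := 2) (hs := hs) (hμs := hμs.ne) (c := c),
          indicatorConstLp_coeFn (p := 2) (hs := measurableSet_Ioc.inter hs) (hμs :=
            (measure_ne_top_of_subset inter_subset_right hμs.ne :
              volume (Ioc q.1 q.2 ∩ s) ≠ ⊤)) (c := c)] with x h1 h2
        rw [h2, ← indicator_indicator]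
        by_cases h : x ∈ Ioc q.1 q.2 <;> simp [h, h1]
      simp only [key]
      refine continuous_indicatorConstLp_set (by norm_num) fun q0 => ?_
      have hsub : ∀ q : ℝ × ℝ, symmDiff (Ioc q.1 q.2 ∩ s) (Ioc q0.1 q0.2 ∩ s) ⊆
          uIcc q.1 q0.1 ∪ uIcc q.2 q0.2 := by
        intro q x hx
        simp only [mem_symmDiff, mem_inter_iff, mem_Ioc, mem_union, mem_uIcc] at hx ⊢
        grind
      have hlim : Tendsto (fun q : ℝ × ℝ => ENNReal.ofReal (|q0.1 - q.1|) +
          ENNReal.ofReal |q0.2 - q.2|) (𝓝 q0) (𝓝 0) := by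
        have : Continuous fun q : ℝ × ℝ => ENNReal.ofReal (|q0.1 - q.1|) +
            ENNReal.ofReal |q0.2 - q.2| :=
          (ENNReal.continuous_ofReal.comp (by fun_prop)).add
            (ENNReal.continuous_ofReal.comp (by fun_prop))
        simpa using this.tendsto q0
      refine tendsto_of_tendsto_of_tendsto_of_le_of_le tendsto_const_nhds hlim
        (fun _ => zero_le) fun q => ?_
      refine (measure_mono (hsub q)).trans ((measure_union_le _ _).trans ?_)
      rw [Real.volume_interval, Real.volume_interval]
  · refine LipschitzWith.of_dist_le_mul fun f g => ?_
    rw [dist_eq_norm, dist_eq_norm, ← map_sub, NNReal.coe_one, one_mul]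
    exact norm_cut_le _ _ _

/-- The translation `f ↦ f (· - t)` on `L_2(ℝ, E)`. -/
noncomputable def shift (t : ℝ) : L2Line E →ₗᵢ[ℂ] L2Line E :=
  Lp.compMeasurePreservingₗᵢ ℂ (fun x : ℝ => x - t) (measurePreserving_sub_right volume t)

theorem coeFn_shift (t : ℝ) (f : L2Line E) : shift t f =ᵐ[volume] fun x => f (x - t) :=
  Lp.coeFn_compMeasurePreserving _ _

/-- This continuity is what makes convolutions of L_2 functions continuous, and hence gives point
values to the integral terms. -/
theorem continuous_shift : Continuous fun p : L2Line E × ℝ => shift p.2 p.1 :=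
  Continuous.compMeasurePreservingLp continuous_fst
    (g := fun p : L2Line E × ℝ => (⟨fun x : ℝ => x - p.2, by fun_prop⟩ : C(ℝ, ℝ)))
    (ContinuousMap.continuous_of_continuous_uncurry _ (by
      change Continuous fun q : (L2Line E × ℝ) × ℝ => q.2 - q.1.2
      fun_prop))
    (fun p => measurePreserving_sub_right volume p.2) (by norm_num)

/-- Extension by zero `L_2(s, E) → L_2(ℝ, E)`. -/
noncomputable def extendZero (s : Set ℝ) (hs : MeasurableSet s) :
    Lp E 2 (volume.restrict s) →L[ℂ] L2Line E :=
  toL2Line (fun f => s.indicator f)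
    (fun f => (memLp_indicator_iff_restrict hs).2 (Lp.memLp f))
    (fun f g => by
      rw [← indicator_add']
      filter_upwards [(ae_restrict_iff' hs).1 (Lp.coeFn_add f g)] with x hx
      by_cases h : x ∈ s
      · simp only [h, indicator_of_mem, hx h]
      · simp only [h, indicator_of_notMem, not_false_eq_true])
    (fun c f => by
      rw [← indicator_const_smul_fun]
      filter_upwards [(ae_restrict_iff' hs).1 (Lp.coeFn_smul c f)] with x hx
      by_cases h : x ∈ s
      · simp only [h, indicator_of_mem, hx h, Pi.smul_apply]
      · simp only [h, indicator_of_notMem, not_false_eq_true])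
    (fun f => by rw [eLpNorm_indicator_eq_eLpNorm_restrict hs, eLpNorm_coeFn_eq])

theorem coeFn_extendZero (s : Set ℝ) (hs : MeasurableSet s) (f : Lp E 2 (volume.restrict s)) :
    extendZero s hs f =ᵐ[volume] s.indicator f :=
  coeFn_toL2Line f

theorem norm_indicator_IccExtend_le {E : Type*} [NormedAddCommGroup E] (f : C(UnitI, E)) (x : ℝ) :
    ‖(Ioc (0 : ℝ) 1).indicator (IccExtend zero_le_one f) x‖ ≤
      ‖(Ioc (0 : ℝ) 1).indicator (fun _ => ‖f‖) x‖ := by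
  by_cases h : x ∈ Ioc (0 : ℝ) 1
  · simp only [h, indicator_of_mem, norm_norm]
    exact f.norm_coe_le_norm _
  · simp [h]

/-- Extension by zero of a continuous function on `[0, 1]`, as an element of `L_2(ℝ, E)`. -/
noncomputable def embLine : C(UnitI, E) →L[ℂ] L2Line E :=
  toL2Line (fun f => (Ioc (0 : ℝ) 1).indicator (IccExtend zero_le_one f))
    (fun f => (memLp_indicator_const 2 measurableSet_Ioc ‖f‖ (Or.inr (by simp))).mono
      ((f.continuous.Icc_extend' (h := zero_le_one)).aestronglyMeasurable.indicator
        measurableSet_Ioc) (Eventually.of_forall (norm_indicator_IccExtend_le f)))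
    (fun f g => by
      rw [← indicator_add']
      exact Eventually.of_forall fun x => rfl)
    (fun c f => by
      rw [← indicator_const_smul_fun]
      exact Eventually.of_forall fun x => rfl)
    (fun f => by
      have h1 := eLpNorm_mono (p := 2) (μ := volume) (norm_indicator_IccExtend_le f)
      rw [eLpNorm_indicator_const measurableSet_Ioc (by norm_num) (by norm_num)] at h1
      refine h1.trans ?_
      simp [← ofReal_norm])

theorem coeFn_embLine (f : C(UnitI, E)) :
    embLine f =ᵐ[volume] (Ioc (0 : ℝ) 1).indicator (IccExtend zero_le_one f) :=
  coeFn_toL2Line f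

theorem norm_embLine_le (f : C(UnitI, E)) : ‖embLine f‖ ≤ ‖f‖ :=
  norm_toL2Line_le f

theorem cut_cut (a b c d : ℝ) (f : L2Line E) :
    cut a b (cut c d f) = cut (max a c) (min b d) f := by
  ext1
  filter_upwards [coeFn_cut a b (cut c d f), coeFn_cut c d f, coeFn_cut (max a c) (min b d) f]
    with x h1 h2 h3
  rw [h1, h3, ← Ioc_inter_Ioc, ← indicator_indicator]
  simp only [indicator_apply, h2]

theorem coeFn_cut_embLine {a b : ℝ} (ha : 0 ≤ a) (hb : b ≤ 1) (f : C(UnitI, E)) :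
    cut a b (embLine f) =ᵐ[volume] (Ioc a b).indicator (IccExtend zero_le_one f) := by
  filter_upwards [coeFn_cut a b (embLine f), coeFn_embLine f] with x h1 h2
  rw [h1]
  simp only [indicator_apply, h2]
  grind

end Basic

/-! ### Integral pairings and integral operators on spaces of continuous functions -/

section Pairing

variable {A : Type*} [NormedRing A] [NormedAlgebra ℂ A] [CompleteSpace A]

/-- The bilinear pairing `∫ B (f ξ) (g ξ) dξ` on `L_2(ℝ, A)`. -/
noncomputable def pairing (B : A →L[ℂ] A →L[ℂ] A) (f g : L2Line A) : A :=
  ∫ ξ, B (f ξ) (g ξ)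

theorem pairing_eq_lpPairing (B : A →L[ℂ] A →L[ℂ] A) (f g : L2Line A) :
    pairing B f g = B.lpPairing volume 2 2 f g :=
  (B.lpPairing_eq_integral f g).symm

theorem norm_pairing_le {B : A →L[ℂ] A →L[ℂ] A} (hB : ‖B‖ ≤ 1) (f g : L2Line A) :
    ‖pairing B f g‖ ≤ ‖f‖ * ‖g‖ := by
  have h1 : pairing B f g = L1.integral (B.holder 1 f g) := by
    rw [pairing, L1.integral_eq_integral]
    exact integral_congr_ae (B.coeFn_holder f g).symm
  rw [h1]
  refine (L1.norm_integral_le _).trans ((B.norm_holder_apply_apply_le f g).trans ?_)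
  gcongr
  exact mul_le_of_le_one_left (norm_nonneg _) hB

theorem continuous_pairing (B : A →L[ℂ] A →L[ℂ] A) :
    Continuous fun p : L2Line A × L2Line A => pairing B p.1 p.2 := by
  simp only [pairing_eq_lpPairing]
  exact (B.lpPairing volume 2 2).continuous₂

theorem pairing_add_left (B : A →L[ℂ] A →L[ℂ] A) (f f' g : L2Line A) :
    pairing B (f + f') g = pairing B f g + pairing B f' g := by
  simp only [pairing_eq_lpPairing]
  rw [map_add]
  rfl

theorem pairing_add_right (B : A →L[ℂ] A →L[ℂ] A) (f g g' : L2Line A) :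
    pairing B f (g + g') = pairing B f g + pairing B f g' := by
  simp only [pairing_eq_lpPairing]
  exact map_add _ _ _

theorem pairing_smul_left (B : A →L[ℂ] A →L[ℂ] A) (c : ℂ) (f g : L2Line A) :
    pairing B (c • f) g = c • pairing B f g := by
  simp only [pairing_eq_lpPairing]
  rw [map_smul]
  rfl

theorem pairing_smul_right (B : A →L[ℂ] A →L[ℂ] A) (c : ℂ) (f g : L2Line A) :
    pairing B f (c • g) = c • pairing B f g := by
  simp only [pairing_eq_lpPairing]
  exact map_smul _ _ _

theorem pairing_neg_left (B : A →L[ℂ] A →L[ℂ] A) (f g : L2Line A) :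
    pairing B (-f) g = -pairing B f g := by
  simpa using pairing_smul_left B (-1) f g

theorem pairing_neg_right (B : A →L[ℂ] A →L[ℂ] A) (f g : L2Line A) :
    pairing B f (-g) = -pairing B f g := by
  simpa using pairing_smul_right B (-1) f g

theorem pairing_sub_left (B : A →L[ℂ] A →L[ℂ] A) (f f' g : L2Line A) :
    pairing B (f - f') g = pairing B f g - pairing B f' g := by
  rw [sub_eq_add_neg, pairing_add_left, pairing_neg_left, sub_eq_add_neg]

theorem pairing_sub_right (B : A →L[ℂ] A →L[ℂ] A) (f g g' : L2Line A) :
    pairing B f (g - g') = pairing B f g - pairing B f g' := by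
  rw [sub_eq_add_neg, pairing_add_right, pairing_neg_right, sub_eq_add_neg]

theorem pairing_cut_left (B : A →L[ℂ] A →L[ℂ] A) {a b : ℝ} (hab : a ≤ b) (f g : L2Line A) :
    pairing B (cut a b f) g = ∫ ξ in a..b, B (f ξ) (g ξ) := by
  rw [pairing, intervalIntegral.integral_of_le hab,
    ← integral_indicator measurableSet_Ioc]
  refine integral_congr_ae ?_
  filter_upwards [coeFn_cut a b f] with x hx
  by_cases h : x ∈ Ioc a b <;> simp [hx, h]

theorem pairing_cut_right (B : A →L[ℂ] A →L[ℂ] A) {a b : ℝ} (hab : a ≤ b) (f g : L2Line A) :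
    pairing B f (cut a b g) = ∫ ξ in a..b, B (f ξ) (g ξ) := by
  rw [pairing, intervalIntegral.integral_of_le hab,
    ← integral_indicator measurableSet_Ioc]
  refine integral_congr_ae ?_
  filter_upwards [coeFn_cut a b g] with x hx
  by_cases h : x ∈ Ioc a b <;> simp [hx, h]

theorem pairing_cut_comm (B : A →L[ℂ] A →L[ℂ] A) (a b : ℝ) (f g : L2Line A) :
    pairing B (cut a b f) g = pairing B f (cut a b g) := by
  simp only [pairing]
  refine integral_congr_ae ?_
  filter_upwards [coeFn_cut a b f, coeFn_cut a b g] with x h1 h2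
  by_cases h : x ∈ Ioc a b <;> simp [h1, h2, h]

theorem integrable_bilin_L2 (B : A →L[ℂ] A →L[ℂ] A) (f g : L2Line A) :
    Integrable (fun ξ => B (f ξ) (g ξ)) volume :=
  memLp_one_iff_integrable.1 (B.memLp_of_bilin (p := 2) (q := 2) 1 (Lp.memLp f) (Lp.memLp g))

theorem norm_cut_sq {a b : ℝ} (hab : a ≤ b) (f : L2Line A) :
    ‖cut a b f‖ ^ 2 = ∫ ξ in a..b, ‖f ξ‖ ^ 2 := by
  have h1 := (MemLp.eLpNorm_eq_integral_rpow_norm two_ne_zero ENNReal.ofNat_ne_top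
    (Lp.memLp (cut a b f)))
  rw [eLpNorm_coeFn_eq, ENNReal.ofReal_eq_ofReal_iff (norm_nonneg _) (by positivity)] at h1
  rw [h1]
  have h2 : ∫ ξ, ‖cut a b f ξ‖ ^ (ENNReal.toReal 2) = ∫ ξ in a..b, ‖f ξ‖ ^ 2 := by
    rw [intervalIntegral.integral_of_le hab, ← integral_indicator measurableSet_Ioc]
    refine integral_congr_ae ?_
    filter_upwards [coeFn_cut a b f] with x hx
    by_cases h : x ∈ Ioc a b <;> simp [hx, h]
  rw [h2, ENNReal.toReal_ofNat, ← Real.rpow_natCast, ← Real.rpow_mul]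
  · norm_num
  · exact intervalIntegral.integral_nonneg hab fun _ _ => by positivity

/-- The `L_2` family `y ↦ f (σ (y, ·))` on `(0, 1]` attached to a continuous function `f`. -/
noncomputable def sample {Y : Type*} [TopologicalSpace Y] [CompactSpace Y] (σ : C(Y × UnitI, Y)) :
    C(Y, A) →L[ℂ] C(Y, L2Line A) :=
  LinearMap.mkContinuous
    { toFun := fun f => (⟨embLine, embLine.continuous⟩ : C(C(UnitI, A), L2Line A)).comp
        (f.comp σ).curry
      map_add' := fun f g => by
        ext1 y
        exact map_add embLine ((f.comp σ).curry y) ((g.comp σ).curry y)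
      map_smul' := fun c f => by
        ext1 y
        exact map_smul embLine c ((f.comp σ).curry y) } 1 (fun f => by
    rw [one_mul, ContinuousMap.norm_le _ (norm_nonneg _)]
    intro y
    refine (norm_embLine_le _).trans ?_
    rw [ContinuousMap.norm_le _ (norm_nonneg _)]
    exact fun s => f.norm_coe_le_norm _)

theorem sample_apply {Y : Type*} [TopologicalSpace Y] [CompactSpace Y] (σ : C(Y × UnitI, Y))
    (f : C(Y, A)) (y : Y) : sample σ f y = embLine ((f.comp σ).curry y) := rfl

theorem norm_sample_apply_le {Y : Type*} [TopologicalSpace Y] [CompactSpace Y]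
    (σ : C(Y × UnitI, Y)) (f : C(Y, A)) (y : Y) : ‖sample σ f y‖ ≤ ‖f‖ := by
  rw [sample_apply]
  refine (norm_embLine_le _).trans ?_
  rw [ContinuousMap.norm_le _ (norm_nonneg _)]
  exact fun s => f.norm_coe_le_norm _

/-- The pointwise pairing of two continuous families in `L_2(ℝ, A)`. -/
noncomputable def pairFamily {Y : Type*} [TopologicalSpace Y]
    (B : A →L[ℂ] A →L[ℂ] A) (k g : C(Y, L2Line A)) : C(Y, A) :=
  ⟨fun y => pairing B (k y) (g y),
    (continuous_pairing B).comp (k.continuous.prodMk g.continuous)⟩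

/-- The integral operator `f ↦ ∫_0^1 B (k y s) (f (σ (y, s))) ds` on continuous functions. -/
noncomputable def kernelOp {Y : Type*} [TopologicalSpace Y] [CompactSpace Y]
    {B : A →L[ℂ] A →L[ℂ] A} (hB : ‖B‖ ≤ 1) (σ : C(Y × UnitI, Y)) :
    C(Y, L2Line A) →L[ℂ] C(Y, A) →L[ℂ] C(Y, A) :=
  LinearMap.mkContinuous₂
    (LinearMap.mk₂ ℂ (fun k f => pairFamily B k (sample σ f))
      (fun k l f => ContinuousMap.ext fun y => pairing_add_left B (k y) (l y) (sample σ f y))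
      (fun c k f => ContinuousMap.ext fun y => pairing_smul_left B c (k y) (sample σ f y))
      (fun k f g => ContinuousMap.ext fun y => by
        rw [map_add]
        exact pairing_add_right B (k y) (sample σ f y) (sample σ g y))
      (fun c k f => ContinuousMap.ext fun y => by
        rw [map_smul]
        exact pairing_smul_right B c (k y) (sample σ f y)))
    1 (fun k f => by
      rw [ContinuousMap.norm_le _ (by positivity), one_mul]
      intro y
      refine (norm_pairing_le hB (k y) (sample σ f y)).trans ?_
      gcongr
      · exact k.norm_coe_le_norm y
      · exact norm_sample_apply_le σ f y)

theorem kernelOp_apply {Y : Type*} [TopologicalSpace Y] [CompactSpace Y]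
    {B : A →L[ℂ] A →L[ℂ] A} (hB : ‖B‖ ≤ 1) (σ : C(Y × UnitI, Y)) (k : C(Y, L2Line A))
    (f : C(Y, A)) (y : Y) :
    kernelOp hB σ k f y = pairing B (k y) (sample σ f y) := rfl

end Pairing

/-- Grönwall's lemma: iterating the inequality from a bound M of u gives u(x) ≤ M (Kx)^n / n! for
every n. -/
theorem eq_zero_of_le_mul_integral {b K : ℝ} (hK : 0 ≤ K) {u : ℝ → ℝ}
    (hu : ContinuousOn u (Icc 0 b)) (h0 : ∀ x ∈ Icc 0 b, 0 ≤ u x)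
    (hle : ∀ x ∈ Icc 0 b, u x ≤ K * ∫ t in (0 : ℝ)..x, u t) : ∀ x ∈ Icc 0 b, u x = 0 := by
  obtain ⟨M, hM⟩ := isCompact_Icc.exists_bound_of_continuousOn hu
  have hpow : ∀ n : ℕ, ∀ x ∈ Icc 0 b, u x ≤ M * ((K * x) ^ n / n.factorial) := by
    intro n
    induction n with
    | zero => intro x hx; simpa using (le_abs_self _).trans (hM x hx)
    | succ n ih =>
      intro x hx
      refine (hle x hx).trans ?_
      have h1 : ∫ t in (0 : ℝ)..x, u t ≤ ∫ t in (0 : ℝ)..x, M * ((K * t) ^ n / n.factorial) := by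
        refine intervalIntegral.integral_mono_on hx.1 ?_ ?_ fun t ht => ih t ⟨ht.1, ht.2.trans hx.2⟩
        · refine ContinuousOn.intervalIntegrable (hu.mono ?_)
          rw [uIcc_of_le hx.1]
          exact Icc_subset_Icc_right hx.2
        · exact Continuous.intervalIntegrable (by fun_prop) _ _
      refine (mul_le_mul_of_nonneg_left h1 hK).trans_eq ?_
      have h2 : ∫ t in (0 : ℝ)..x, M * ((K * t) ^ n / n.factorial) =
          M * K ^ n / n.factorial * (x ^ (n + 1) / (n + 1)) := by
        rw [show (fun t : ℝ => M * ((K * t) ^ n / n.factorial)) =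
          fun t => M * K ^ n / n.factorial * t ^ n by ext t; rw [mul_pow]; ring]
        rw [intervalIntegral.integral_const_mul, integral_pow]
        simp
      rw [h2, Nat.factorial_succ]
      push_cast
      field_simp
      ring
  intro x hx
  refine le_antisymm ?_ (h0 x hx)
  have hlim : Tendsto (fun n : ℕ => M * ((K * x) ^ n / n.factorial)) atTop (𝓝 (M * 0)) :=
    (FloorSemiring.tendsto_pow_div_factorial_atTop (K * x)).const_mul M
  rw [mul_zero] at hlim
  exact ge_of_tendsto' hlim fun n => hpow n x hx

/-! ### Volterra operators -/

section Volterra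

variable {A : Type*} [NormedRing A] [NormedAlgebra ℂ A] [CompleteSpace A]
  {Y : Type*} [TopologicalSpace Y] [CompactSpace Y] {B : A →L[ℂ] A →L[ℂ] A}

/-- One step of the Volterra iteration, with κ playing the role of the upper limit of integration:
Cauchy–Schwarz on (0, κ y], where the sampled values satisfy ‖g‖² ≤ C s^n because κ(σ(y,s)) ≤ s, and
then integration of s^n. -/
theorem norm_kernelOp_apply_sq_le (hB : ‖B‖ ≤ 1) {σ : C(Y × UnitI, Y)} {k : C(Y, L2Line A)}
    {κ : Y → ℝ} (hκ : ∀ y, κ y ∈ Icc (0 : ℝ) 1) (hk : ∀ y, cut 0 (κ y) (k y) = k y)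
    (hσ : ∀ y (s : UnitI), κ (σ (y, s)) ≤ s) {g : C(Y, A)} {C : ℝ} (hC : 0 ≤ C) {n : ℕ}
    (hg : ∀ y, ‖g y‖ ^ 2 ≤ C * κ y ^ n) (y : Y) :
    ‖kernelOp hB σ k g y‖ ^ 2 ≤ ‖k‖ ^ 2 * (C * (κ y ^ (n + 1) / (n + 1))) := by
  rw [kernelOp_apply, ← hk y, pairing_cut_comm]
  have h1 : ‖cut 0 (κ y) (sample σ g y)‖ ^ 2 ≤ C * (κ y ^ (n + 1) / (n + 1)) := by
    rw [norm_cut_sq (hκ y).1]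
    set G : ℝ → A := IccExtend zero_le_one ((g.comp σ).curry y) with hG
    have hGc : Continuous G := ((g.comp σ).curry y).continuous.Icc_extend'
    have h2 : ∫ ξ in (0 : ℝ)..κ y, ‖sample σ g y ξ‖ ^ 2 = ∫ ξ in (0 : ℝ)..κ y, ‖G ξ‖ ^ 2 := by
      refine intervalIntegral.integral_congr_ae ?_
      filter_upwards [coeFn_embLine ((g.comp σ).curry y)] with x hx hx'
      rw [uIoc_of_le (hκ y).1] at hx'
      have hx1 : x ∈ Ioc (0 : ℝ) 1 := ⟨hx'.1, hx'.2.trans (hκ y).2⟩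
      rw [sample_apply, hx, indicator_of_mem hx1]
    have h3 : ∫ ξ in (0 : ℝ)..κ y, ‖G ξ‖ ^ 2 ≤ ∫ ξ in (0 : ℝ)..κ y, C * ξ ^ n := by
      refine intervalIntegral.integral_mono_on (hκ y).1
        (Continuous.intervalIntegrable (by fun_prop) _ _)
        (Continuous.intervalIntegrable (by fun_prop) _ _) fun t ht => ?_
      have ht' : t ∈ Icc (0 : ℝ) 1 := ⟨ht.1, ht.2.trans (hκ y).2⟩
      rw [hG, IccExtend_of_mem _ _ ht']
      refine (hg _).trans (mul_le_mul_of_nonneg_left ?_ hC)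
      exact pow_le_pow_left₀ (hκ _).1 (hσ y ⟨t, ht'⟩) n
    rw [h2]
    refine h3.trans_eq ?_
    rw [intervalIntegral.integral_const_mul, integral_pow]
    simp
  have h4 := norm_pairing_le hB (k y) (cut 0 (κ y) (sample σ g y))
  calc _ ≤ (‖k y‖ * ‖cut 0 (κ y) (sample σ g y)‖) ^ 2 := by gcongr
    _ = ‖k y‖ ^ 2 * ‖cut 0 (κ y) (sample σ g y)‖ ^ 2 := mul_pow _ _ _
    _ ≤ _ := by
      gcongr
      exact k.norm_coe_le_norm y

/-- A Volterra operator on continuous functions is quasinilpotent. -/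
theorem isUnit_one_sub_kernelOp (hB : ‖B‖ ≤ 1) {σ : C(Y × UnitI, Y)} {k : C(Y, L2Line A)}
    {κ : Y → ℝ} (hκ : ∀ y, κ y ∈ Icc (0 : ℝ) 1) (hk : ∀ y, cut 0 (κ y) (k y) = k y)
    (hσ : ∀ y (s : UnitI), κ (σ (y, s)) ≤ s) : IsUnit (1 - kernelOp hB σ k) := by
  set T := kernelOp hB σ k with hT
  have hpow : ∀ (n : ℕ) (f : C(Y, A)) (y : Y),
      ‖(T ^ n) f y‖ ^ 2 ≤ ‖f‖ ^ 2 * (‖k‖ ^ 2) ^ n / n.factorial * κ y ^ n := by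
    intro n
    induction n with
    | zero =>
      intro f y
      simpa using pow_le_pow_left₀ (norm_nonneg _) (f.norm_coe_le_norm y) 2
    | succ n ih =>
      intro f y
      rw [pow_succ' T]
      refine (norm_kernelOp_apply_sq_le hB hκ hk hσ (by positivity) (ih f) y).trans_eq ?_
      rw [Nat.factorial_succ]
      push_cast
      field_simp
      ring
  have hlim : Tendsto (fun n : ℕ => (‖k‖ ^ 2) ^ n / n.factorial) atTop (𝓝 0) :=
    FloorSemiring.tendsto_pow_div_factorial_atTop (‖k‖ ^ 2)
  -- The estimates are for squared norms, so 1/4 here gives operator norm at most 1/2 for T^n.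
  obtain ⟨n, hn⟩ := (hlim.eventually (gt_mem_nhds (show (0 : ℝ) < 1 / 4 by norm_num))).exists
  have hnorm : ‖T ^ n‖ < 1 := by
    refine lt_of_le_of_lt (ContinuousLinearMap.opNorm_le_bound _ (show (0 : ℝ) ≤ 1 / 2 by norm_num)
      fun f => ?_) (by norm_num)
    rw [ContinuousMap.norm_le _ (by positivity)]
    intro y
    refine le_of_sq_le_sq ?_ (by positivity)
    refine (hpow n f y).trans ?_
    have h1 : κ y ^ n ≤ 1 := pow_le_one₀ (hκ y).1 (hκ y).2
    have h2 : 0 ≤ κ y ^ n := pow_nonneg (hκ y).1 n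
    calc _ = ‖f‖ ^ 2 * ((‖k‖ ^ 2) ^ n / n.factorial) * κ y ^ n := by ring
      _ ≤ ‖f‖ ^ 2 * (1 / 4) * 1 := by gcongr
      _ = _ := by ring
  -- 1 - T is a commuting factor of the invertible 1 - T^n.
  have hu : IsUnit (1 - T ^ n) := isUnit_one_sub_of_norm_lt_one (R := C(Y, A) →L[ℂ] C(Y, A)) hnorm
  have hcomm : Commute (1 - T) (∑ i ∈ Finset.range n, T ^ i) :=
    Commute.sum_right _ _ _ fun i _ =>
      ((Commute.one_left _).sub_left ((Commute.refl T).pow_right i))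
  rw [← mul_neg_geom_sum, hcomm.isUnit_mul_iff] at hu
  exact hu.1

theorem bijective_add_kernelOp_of_volterra (hB : ‖B‖ ≤ 1) {σ : C(Y × UnitI, Y)}
    {k : C(Y, L2Line A)} {κ : Y → ℝ} (hκ : ∀ y, κ y ∈ Icc (0 : ℝ) 1)
    (hk : ∀ y, cut 0 (κ y) (k y) = k y) (hσ : ∀ y (s : UnitI), κ (σ (y, s)) ≤ s) :
    Function.Bijective fun f => f + kernelOp hB σ k f := by
  have h1 := ContinuousLinearMap.isUnit_iff_bijective.1
    (isUnit_one_sub_kernelOp hB (k := -k) hκ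
      (fun y => by rw [ContinuousMap.neg_apply, map_neg, hk y]) hσ)
  convert h1 using 2 with f
  refine ContinuousMap.ext fun y => ?_
  change f y + pairing B (k y) (sample σ f y) = f y - pairing B (-k y) (sample σ f y)
  rw [pairing_neg_left, sub_neg_eq_add]

end Volterra

/-! ### Compactness and the Fredholm alternative -/

section Fredholm

variable {A : Type*} [NormedRing A] [NormedAlgebra ℂ A] [CompleteSpace A] [FiniteDimensional ℂ A]
  {B : A →L[ℂ] A →L[ℂ] A}

/-- The sampling map of an ordinary integral operator on `[0, 1]`. -/
def secondVar : C(UnitI × UnitI, UnitI) := ⟨Prod.snd, continuous_snd⟩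

/-- Arzelà–Ascoli: on the unit ball the images are bounded by ‖k‖, and their oscillation between t₀
and t is at most ‖k t₀ - k t‖. Finite dimension of `A` makes its closed balls compact. -/
theorem isCompactOperator_kernelOp (hB : ‖B‖ ≤ 1) (k : C(UnitI, L2Line A)) :
    IsCompactOperator (kernelOp hB secondVar k) := by
  have : ProperSpace A := FiniteDimensional.proper ℂ A
  refine (isCompactOperator_iff_isCompact_closure_image_closedBall
    (kernelOp hB secondVar k : C(UnitI, A) →ₗ[ℂ] C(UnitI, A)) zero_lt_one).2 ?_
  change IsCompact (closure (kernelOp hB secondVar k '' Metric.closedBall 0 1))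
  set S := kernelOp hB secondVar k '' Metric.closedBall 0 1 with hS
  let e := ContinuousMap.isometryEquivBoundedOfCompact UnitI A
  have hc : IsCompact (closure (e '' S)) := by
    refine BoundedContinuousFunction.arzela_ascoli (Metric.closedBall 0 ‖k‖)
      (isCompact_closedBall _ _) _ ?_ ?_
    · rintro _ t ⟨_, ⟨f, hf, rfl⟩, rfl⟩
      rw [mem_closedBall_zero_iff] at hf ⊢
      change ‖pairing B (k t) (embLine f)‖ ≤ _
      refine (norm_pairing_le hB _ _).trans ?_
      have h1 := k.norm_coe_le_norm t
      have h2 := (norm_embLine_le f).trans hf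
      calc _ ≤ ‖k‖ * 1 := by gcongr
        _ = _ := mul_one _
    · intro t₀
      rw [Metric.equicontinuousAt_iff_right]
      intro ε hε
      filter_upwards [Metric.continuousAt_iff'.1 k.continuous.continuousAt ε hε] with t ht
      rintro ⟨_, _, ⟨f, hf, rfl⟩, rfl⟩
      rw [mem_closedBall_zero_iff] at hf
      rw [dist_comm, dist_eq_norm] at ht
      change dist (pairing B (k t₀) (embLine f)) (pairing B (k t) (embLine f)) < ε
      rw [dist_eq_norm, ← pairing_sub_left]
      refine (norm_pairing_le hB _ _).trans_lt ?_
      have h2 := (norm_embLine_le f).trans hf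
      calc _ ≤ ‖k t₀ - k t‖ * 1 := by gcongr
        _ < ε := by rwa [mul_one]
  have h2 : closure S = e.symm '' closure (e '' S) := by
    have h3 := e.symm.toHomeomorph.image_closure (e '' S)
    have h4 : e.symm.toHomeomorph '' closure (e '' S) = e.symm '' closure (e '' S) := rfl
    rw [← h4, h3]
    congr 1
    ext f
    simp
  rw [h2]
  exact hc.image e.symm.continuous

/-- The Fredholm alternative for `1 + T` with `T` an integral operator on `C([0, 1], A)`. -/
theorem isUnit_one_add_kernelOp (hB : ‖B‖ ≤ 1) (k : C(UnitI, L2Line A))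
    (hinj : ∀ f, f + kernelOp hB secondVar k f = 0 → f = 0) :
    IsUnit (1 + kernelOp hB secondVar k) := by
  have hneg : kernelOp hB secondVar (-k) = -kernelOp hB secondVar k := by
    ext f t
    exact pairing_neg_left B (k t) (sample secondVar f t)
  rcases (isCompactOperator_kernelOp hB (-k)).hasEigenvalue_or_mem_resolventSet
    (one_ne_zero (α := ℂ)) with h | h
  · obtain ⟨f, hf⟩ := h.exists_hasEigenvector
    refine absurd (hinj f ?_) hf.2
    have h1 : kernelOp hB secondVar (-k) f = (1 : ℂ) • f := hf.apply_eq_smul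
    rw [hneg, one_smul] at h1
    have h2 : -(kernelOp hB secondVar k f) = f := h1
    rw [← sub_neg_eq_add, h2, sub_self]
  · have h1 : IsUnit (algebraMap ℂ (C(UnitI, A) →L[ℂ] C(UnitI, A)) 1 -
      kernelOp hB secondVar (-k)) := h
    have h3 : 1 + kernelOp hB secondVar k = algebraMap ℂ (C(UnitI, A) →L[ℂ] C(UnitI, A)) 1 -
        kernelOp hB secondVar (-k) := by
      rw [map_one, hneg]
      exact ContinuousLinearMap.ext fun f => (sub_neg_eq_add f (kernelOp hB secondVar k f)).symm
    rwa [h3]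

theorem bijective_add_kernelOp (hB : ‖B‖ ≤ 1) (k : C(UnitI, L2Line A))
    (hinj : ∀ f, f + kernelOp hB secondVar k f = 0 → f = 0) :
    Function.Bijective fun f => f + kernelOp hB secondVar k f :=
  ContinuousLinearMap.isUnit_iff_bijective.1 (isUnit_one_add_kernelOp hB k hinj)

end Fredholm

/-! ### Left and right convolution with a potential -/

section Conv

variable {A : Type*} [NormedRing A] [NormedAlgebra ℂ A] [CompleteSpace A]

/-- Left multiplication `(h, f) ↦ h f`. -/
noncomputable abbrev mulLeftB (A : Type*) [NormedRing A] [NormedAlgebra ℂ A] : A →L[ℂ] A →L[ℂ] A :=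
  ContinuousLinearMap.mul ℂ A

/-- Right multiplication `(h, f) ↦ f h`. -/
noncomputable abbrev mulRightB (A : Type*) [NormedRing A] [NormedAlgebra ℂ A] :
    A →L[ℂ] A →L[ℂ] A :=
  (ContinuousLinearMap.mul ℂ A).flip

theorem norm_mulLeftB_le : ‖mulLeftB A‖ ≤ 1 := ContinuousLinearMap.opNorm_mul_le ℂ A

theorem norm_mulRightB_le : ‖mulRightB A‖ ≤ 1 := by
  rw [mulRightB, ContinuousLinearMap.opNorm_flip]
  exact norm_mulLeftB_le

theorem pairing_mulRightB (f g : L2Line A) :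
    pairing (mulRightB A) f g = pairing (mulLeftB A) g f := rfl

/-- The function `t ↦ ∫ B (H (ξ - t)) (f ξ) dξ` on `[0, 1]`. -/
noncomputable def convMap (B : A →L[ℂ] A →L[ℂ] A) (H f : L2Line A) : C(UnitI, A) :=
  ⟨fun t => pairing B (shift t H) f, (continuous_pairing B).comp
    ((continuous_shift.comp (continuous_const.prodMk continuous_subtype_val)).prodMk
      continuous_const)⟩

theorem convMap_apply (B : A →L[ℂ] A →L[ℂ] A) (H f : L2Line A) (t : UnitI) :
    convMap B H f t = pairing B (shift t H) f := rfl

theorem convMap_apply_eq_integral (B : A →L[ℂ] A →L[ℂ] A) (H f : L2Line A) (t : UnitI) :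
    convMap B H f t = ∫ ξ, B (H (ξ - t)) (f ξ) := by
  rw [convMap_apply, pairing]
  refine integral_congr_ae ?_
  filter_upwards [coeFn_shift (t : ℝ) H] with ξ hξ
  rw [hξ]

theorem convMap_cut_apply (B : A →L[ℂ] A →L[ℂ] A) {a b : ℝ} (hab : a ≤ b) (H f : L2Line A)
    (t : UnitI) : convMap B H (cut a b f) t = ∫ ξ in a..b, B (H (ξ - t)) (f ξ) := by
  rw [convMap_apply, pairing_cut_right _ hab]
  refine intervalIntegral.integral_congr_ae ?_
  filter_upwards [coeFn_shift (t : ℝ) H] with ξ hξ _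
  rw [hξ]

theorem norm_convMap_le {B : A →L[ℂ] A →L[ℂ] A} (hB : ‖B‖ ≤ 1) (H f : L2Line A) :
    ‖convMap B H f‖ ≤ ‖H‖ * ‖f‖ := by
  rw [ContinuousMap.norm_le _ (by positivity)]
  intro t
  refine (norm_pairing_le hB _ _).trans ?_
  rw [LinearIsometry.norm_map]

theorem convMap_add_right (B : A →L[ℂ] A →L[ℂ] A) (H f g : L2Line A) :
    convMap B H (f + g) = convMap B H f + convMap B H g :=
  ContinuousMap.ext fun _ => pairing_add_right _ _ _ _

theorem convMap_neg_right (B : A →L[ℂ] A →L[ℂ] A) (H f : L2Line A) :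
    convMap B H (-f) = -convMap B H f :=
  ContinuousMap.ext fun _ => pairing_neg_right _ _ _

theorem convMap_sub_right (B : A →L[ℂ] A →L[ℂ] A) (H f g : L2Line A) :
    convMap B H (f - g) = convMap B H f - convMap B H g :=
  ContinuousMap.ext fun _ => pairing_sub_right _ _ _ _

theorem convMap_zero_right (B : A →L[ℂ] A →L[ℂ] A) (H : L2Line A) : convMap B H 0 = 0 :=
  ContinuousMap.ext fun t => by
    have h := pairing_smul_right B 0 (shift (t : ℝ) H) 0
    rwa [zero_smul, zero_smul] at h

theorem convMap_sub_left (B : A →L[ℂ] A →L[ℂ] A) (H K f : L2Line A) :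
    convMap B (H - K) f = convMap B H f - convMap B K f :=
  ContinuousMap.ext fun t => by
    rw [convMap_apply, map_sub]
    exact pairing_sub_left _ _ _ _

theorem continuous_convMap (B : A →L[ℂ] A →L[ℂ] A) :
    Continuous fun p : L2Line A × L2Line A => convMap B p.1 p.2 := by
  refine ContinuousMap.continuous_of_continuous_uncurry _ ?_
  exact (continuous_pairing B).comp ((continuous_shift.comp ((continuous_fst.comp continuous_fst).prodMk
    (continuous_subtype_val.comp continuous_snd))).prodMk (continuous_snd.comp continuous_fst))

/-- The family `t ↦ 1_{(0, a]} H (· - t)`. -/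
noncomputable def convKernel (a : ℝ) (H : L2Line A) : C(UnitI, L2Line A) :=
  ⟨fun t => cut 0 a (shift t H), continuous_cut.comp
    (f := fun t : UnitI => (shift (t : ℝ) H, ((0 : ℝ), a)))
    ((continuous_shift.comp (f := fun t : UnitI => (H, (t : ℝ)))
      (continuous_const.prodMk continuous_subtype_val)).prodMk continuous_const)⟩

theorem continuous_convKernel : Continuous fun p : ℝ × L2Line A => convKernel p.1 p.2 := by
  refine ContinuousMap.continuous_of_continuous_uncurry _ ?_
  exact continuous_cut.comp
    (f := fun q : (ℝ × L2Line A) × UnitI => (shift (q.2 : ℝ) q.1.2, ((0 : ℝ), q.1.1)))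
    ((continuous_shift.comp (f := fun q : (ℝ × L2Line A) × UnitI => (q.1.2, (q.2 : ℝ)))
      (by fun_prop)).prodMk (by fun_prop))

/-- The operator `f ↦ ∫_0^a B (H (ξ - ·)) (f ξ) dξ` on `C([0, 1], A)`. -/
noncomputable def convOp {B : A →L[ℂ] A →L[ℂ] A} (hB : ‖B‖ ≤ 1) (a : ℝ) (H : L2Line A) :
    C(UnitI, A) →L[ℂ] C(UnitI, A) :=
  kernelOp hB secondVar (convKernel a H)

theorem convOp_apply {B : A →L[ℂ] A →L[ℂ] A} (hB : ‖B‖ ≤ 1) (a : ℝ) (H : L2Line A)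
    (f : C(UnitI, A)) : convOp hB a H f = convMap B H (cut 0 a (embLine f)) :=
  ContinuousMap.ext fun _ => pairing_cut_comm _ _ _ _ _

theorem continuous_convOp {B : A →L[ℂ] A →L[ℂ] A} (hB : ‖B‖ ≤ 1) :
    Continuous fun p : ℝ × L2Line A => convOp hB p.1 p.2 :=
  (kernelOp hB secondVar).continuous.comp continuous_convKernel

/-- `1 + 𝓗_a` is injective for all `a ∈ [0, 1]`. -/
def ConvInjective {B : A →L[ℂ] A →L[ℂ] A} (hB : ‖B‖ ≤ 1) (H : L2Line A) : Prop :=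
  ∀ a ∈ Icc (0 : ℝ) 1, ∀ F : C(UnitI, A), F + convOp hB a H F = 0 → F = 0

theorem ConvInjective.bijective [FiniteDimensional ℂ A] {B : A →L[ℂ] A →L[ℂ] A} {hB : ‖B‖ ≤ 1}
    {H : L2Line A} (h : ConvInjective hB H) {a : ℝ} (ha : a ∈ Icc (0 : ℝ) 1) :
    Function.Bijective fun f => f + convOp hB a H f :=
  bijective_add_kernelOp hB _ (h a ha)

/-- The convolution of f is itself a continuous solution of the homogeneous equation, so it
vanishes, and f is minus its truncation. Injectivity on C([0,1]) thus yields uniqueness in L_2. -/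
theorem ConvInjective.eq_zero {B : A →L[ℂ] A →L[ℂ] A} {hB : ‖B‖ ≤ 1}
    {H : L2Line A} (h : ConvInjective hB H) {a : ℝ} (ha : a ∈ Icc (0 : ℝ) 1) {f : L2Line A}
    (hf : f + cut 0 a (embLine (convMap B H f)) = 0) : f = 0 := by
  have h1 : f = -cut 0 a (embLine (convMap B H f)) := eq_neg_of_add_eq_zero_left hf
  have h2 : convMap B H f + convOp hB a H (convMap B H f) = 0 := by
    rw [convOp_apply, ← convMap_add_right, hf, convMap_zero_right]
  rw [h1, h a ha _ h2, map_zero, map_zero, neg_zero]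

/-- `H` is even. -/
def IsEven (H : L2Line A) : Prop := ∀ᵐ x : ℝ, H (-x) = H x

/-- Reconciles the translate H(· - t), used in the operators, with the H(t - ·) of the integral
equations. -/
theorem IsEven.shift_eq {H : L2Line A} (h : IsEven H) (t : ℝ) :
    ∀ᵐ ξ : ℝ, H (ξ - t) = H (t - ξ) := by
  have h1 := (quasiMeasurePreserving_sub_left_of_right_invariant (volume : Measure ℝ) t).ae h
  filter_upwards [h1] with ξ hξ
  rw [← hξ, neg_sub]

/-- ‖f‖‖H‖‖g‖ ≤ (‖f‖² + ‖H‖²)‖g‖, and both terms on the right are integrable: a product, and a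
convolution integrand of two integrable functions. -/
theorem integrable_triple {f H g : L2Line A} (hg : Integrable g volume) :
    Integrable (fun p : ℝ × ℝ => f p.1 * (H (p.1 - p.2) * g p.2)) (volume.prod volume) := by
  have hf2 : Integrable (fun x => ‖f x‖ ^ 2) volume := (Lp.memLp f).integrable_norm_pow two_ne_zero
  have hH2 : Integrable (fun x => ‖H x‖ ^ 2) volume := (Lp.memLp H).integrable_norm_pow two_ne_zero
  have h1 : Integrable (fun p : ℝ × ℝ => ‖f p.1‖ ^ 2 * ‖g p.2‖) (volume.prod volume) :=
    hf2.mul_prod hg.norm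
  have h2 : Integrable (fun p : ℝ × ℝ => ‖g p.2‖ * ‖H (p.1 - p.2)‖ ^ 2) (volume.prod volume) :=
    hg.norm.convolution_integrand (ContinuousLinearMap.mul ℝ ℝ) hH2
  have hHm : StronglyMeasurable (fun p : ℝ × ℝ => H (p.1 - p.2)) :=
    (Lp.stronglyMeasurable H).comp_measurable (measurable_fst.sub measurable_snd)
  refine (h1.add h2).mono' ?_ (Eventually.of_forall fun p => ?_)
  · exact (((Lp.stronglyMeasurable f).comp_measurable measurable_fst).mul
      (hHm.mul ((Lp.stronglyMeasurable g).comp_measurable measurable_snd))).aestronglyMeasurable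
  · refine (norm_mul_le _ _).trans ((mul_le_mul_of_nonneg_left (norm_mul_le _ _)
      (norm_nonneg _)).trans ?_)
    change _ ≤ ‖f p.1‖ ^ 2 * ‖g p.2‖ + ‖g p.2‖ * ‖H (p.1 - p.2)‖ ^ 2
    nlinarith [mul_nonneg (norm_nonneg (g p.2)) (sq_nonneg (‖f p.1‖ - ‖H (p.1 - p.2)‖)),
      mul_nonneg (norm_nonneg (g p.2)) (add_nonneg (sq_nonneg (‖f p.1‖))
        (sq_nonneg ‖H (p.1 - p.2)‖))]

theorem integral_mul_conv_comm {f H g : L2Line A} (hg : Integrable g volume) :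
    ∫ ξ, f ξ * ∫ τ, H (ξ - τ) * g τ = ∫ τ, (∫ ξ, f ξ * H (ξ - τ)) * g τ := by
  have h1 : ∀ ξ, f ξ * ∫ τ, H (ξ - τ) * g τ = ∫ τ, f ξ * (H (ξ - τ) * g τ) := fun ξ => by
    refine (integral_const_mul_of_integrable ?_).symm
    -- H is not assumed even here, so τ ↦ H(ξ - τ) is obtained by reflecting first and translating
    -- afterwards.
    have := integrable_bilin_L2 (mulLeftB A) (shift ξ (Lp.compMeasurePreserving (fun x : ℝ => -x)
      (Measure.measurePreserving_neg volume) H)) g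
    refine this.congr ?_
    filter_upwards [coeFn_shift ξ (Lp.compMeasurePreserving (fun x : ℝ => -x)
      (Measure.measurePreserving_neg volume) H),
      (measurePreserving_sub_right volume ξ).quasiMeasurePreserving.ae_eq_comp
        (Lp.coeFn_compMeasurePreserving H (Measure.measurePreserving_neg volume))] with τ h1 h2
    rw [h1]
    have h3 : (Lp.compMeasurePreserving (fun x : ℝ => -x)
      (Measure.measurePreserving_neg volume) H) (τ - ξ) = H (-(τ - ξ)) := h2
    rw [h3, neg_sub]
    rfl
  have h2 : ∀ τ, (∫ ξ, f ξ * H (ξ - τ)) * g τ = ∫ ξ, f ξ * (H (ξ - τ) * g τ) := fun τ => by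
    simp only [← mul_assoc]
    refine (integral_mul_const_of_integrable ?_).symm
    refine (integrable_bilin_L2 (mulLeftB A) f (shift τ H)).congr ?_
    filter_upwards [coeFn_shift τ H] with ξ h1
    rw [h1]
    rfl
  simp only [h1, h2]
  exact integral_integral_swap (integrable_triple hg)

theorem integrable_cut (a b : ℝ) (f : L2Line A) : Integrable (cut a b f) volume := by
  refine (integrable_congr (coeFn_cut a b f)).2 ((integrable_indicator_iff measurableSet_Ioc).2 ?_)
  exact ((Lp.memLp f).restrict _).integrable (by norm_num)

/-- Left and right convolution with an even `H` are transposes of each other. -/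
theorem pairing_convMap_comm {H : L2Line A} (hH : IsEven H) (f g : L2Line A) :
    pairing (mulLeftB A) (cut 0 1 f) (embLine (convMap (mulLeftB A) H (cut 0 1 g))) =
      pairing (mulLeftB A) (embLine (convMap (mulRightB A) H (cut 0 1 f))) (cut 0 1 g) := by
  have hL : ∀ ξ (hξ : ξ ∈ Ioc (0 : ℝ) 1), convMap (mulLeftB A) H (cut 0 1 g) ⟨ξ, hξ.1.le, hξ.2⟩ =
      ∫ τ, H (ξ - τ) * cut 0 1 g τ := fun ξ hξ => by
    rw [convMap_apply_eq_integral]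
    refine integral_congr_ae ?_
    filter_upwards [hH.shift_eq ξ] with τ hτ
    rw [← hτ]
    rfl
  have hR : ∀ τ (hτ : τ ∈ Ioc (0 : ℝ) 1), convMap (mulRightB A) H (cut 0 1 f) ⟨τ, hτ.1.le, hτ.2⟩ =
      ∫ ξ, cut 0 1 f ξ * H (ξ - τ) := fun τ hτ => convMap_apply_eq_integral _ _ _ _
  have h1 : pairing (mulLeftB A) (cut 0 1 f) (embLine (convMap (mulLeftB A) H (cut 0 1 g))) =
      ∫ ξ, cut 0 1 f ξ * ∫ τ, H (ξ - τ) * cut 0 1 g τ := by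
    refine integral_congr_ae ?_
    filter_upwards [coeFn_embLine (convMap (mulLeftB A) H (cut 0 1 g)), coeFn_cut 0 1 f]
      with ξ h1 h2
    by_cases h : ξ ∈ Ioc (0 : ℝ) 1
    · rw [h1, indicator_of_mem h, IccExtend_of_mem _ _ ⟨h.1.le, h.2⟩, hL ξ h]
      rfl
    · rw [h1, h2, indicator_of_notMem h, indicator_of_notMem h]
      simp
  have h2 : pairing (mulLeftB A) (embLine (convMap (mulRightB A) H (cut 0 1 f))) (cut 0 1 g) =
      ∫ τ, (∫ ξ, cut 0 1 f ξ * H (ξ - τ)) * cut 0 1 g τ := by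
    refine integral_congr_ae ?_
    filter_upwards [coeFn_embLine (convMap (mulRightB A) H (cut 0 1 f)), coeFn_cut 0 1 g]
      with τ h1 h2
    by_cases h : τ ∈ Ioc (0 : ℝ) 1
    · rw [h1, indicator_of_mem h, IccExtend_of_mem _ _ ⟨h.1.le, h.2⟩, hR τ h]
      rfl
    · rw [h1, h2, indicator_of_notMem h, indicator_of_notMem h]
      simp
  rw [h1, h2]
  exact integral_mul_conv_comm (integrable_cut 0 1 g)

/-- Continuous functions separate: each functional ℓ on `A` has a scalar test function that turns ℓ
of the pairing into ∫ |ℓ(G)|². -/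
theorem eq_zero_of_pairing_eq_zero {a : ℝ} (ha : a ∈ Icc (0 : ℝ) 1) (G : C(UnitI, A))
    (h : ∀ φ : C(UnitI, A), pairing (mulLeftB A) (cut 0 a (embLine G)) (embLine φ) = 0) :
    cut 0 a (embLine G) = 0 := by
  have hG : ∀ t ∈ Ioc (0 : ℝ) a, IccExtend zero_le_one G t = 0 := by
    intro t ht
    refine SeparatingDual.eq_zero_of_forall_dual_eq_zero (R := ℂ) fun ℓ => ?_
    set g : ℝ → A := IccExtend zero_le_one G with hg
    have hgc : Continuous g := G.continuous.Icc_extend'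
    let φ : C(UnitI, A) := ⟨fun s => (starRingEnd ℂ (ℓ (G s))) • (1 : A), by fun_prop⟩
    have h1 := congrArg ℓ (h φ)
    rw [pairing_cut_left _ ha.1, map_zero] at h1
    have h2 : ∫ ξ in (0 : ℝ)..a, mulLeftB A (embLine G ξ) (embLine φ ξ) =
        ∫ ξ in (0 : ℝ)..a, (starRingEnd ℂ (ℓ (g ξ))) • g ξ := by
      refine intervalIntegral.integral_congr_ae ?_
      filter_upwards [coeFn_embLine G, coeFn_embLine φ] with ξ h3 h4 h5
      rw [uIoc_of_le ha.1] at h5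
      have h6 : ξ ∈ Ioc (0 : ℝ) 1 := ⟨h5.1, h5.2.trans ha.2⟩
      rw [h3, h4, indicator_of_mem h6, indicator_of_mem h6]
      simp [φ, IccExtend, g]
    rw [h2, ← ContinuousLinearMap.intervalIntegral_comp_comm ℓ
      (Continuous.intervalIntegrable (by fun_prop) _ _)] at h1
    have h3 : ∫ ξ in (0 : ℝ)..a, ‖ℓ (g ξ)‖ ^ 2 = 0 := by
      have h4 : ∀ ξ, ℓ ((starRingEnd ℂ (ℓ (g ξ))) • g ξ) = ((‖ℓ (g ξ)‖ ^ 2 : ℝ) : ℂ) := fun ξ => by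
        rw [map_smul, smul_eq_mul, Complex.conj_mul']
        norm_cast
      simp only [h4] at h1
      rw [intervalIntegral.integral_ofReal] at h1
      exact_mod_cast h1
    rw [intervalIntegral.integral_of_le ha.1, setIntegral_eq_zero_iff_of_nonneg_ae
      (Eventually.of_forall fun x => by positivity)
      ((Continuous.integrableOn_Icc (by fun_prop)).mono_set Ioc_subset_Icc_self)] at h3
    have h4 := Measure.eqOn_Ioc_of_ae_eq volume h3
      (by fun_prop) (by fun_prop) ht
    simpa using h4
  ext1
  filter_upwards [coeFn_cut_embLine (a := 0) le_rfl ha.2 G, Lp.coeFn_zero A 2 volume] with x h1 h2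
  rw [h1, h2]
  by_cases hx : x ∈ Ioc 0 a
  · rw [indicator_of_mem hx, hG x hx]
    rfl
  · rw [indicator_of_notMem hx]
    rfl

/-- By the Fredholm alternative the left-hand operator is onto. An element G of the kernel of the
right-hand operator, cut to (0,a], annihilates its range by transposition, so G vanishes on (0,a];
the equation then gives G = 0 on all of [0,1]. -/
theorem ConvInjective.right_of_left [FiniteDimensional ℂ A] {H : L2Line A} (hH : IsEven H)
    (h : ConvInjective (norm_mulLeftB_le (A := A)) H) :
    ConvInjective (norm_mulRightB_le (A := A)) H := by
  intro a ha G hG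
  have hcut : ∀ f : L2Line A, cut 0 1 (cut 0 a f) = cut 0 a f := fun f => by
    rw [cut_cut, max_self, min_eq_right ha.2]
  have hzero : cut 0 a (embLine G) = 0 := by
    refine eq_zero_of_pairing_eq_zero ha G fun φ => ?_
    obtain ⟨u, h1⟩ := (h.bijective ha).2 φ
    have h2 : convMap (mulRightB A) H (cut 0 a (embLine G)) = -G := by
      rw [← convOp_apply norm_mulRightB_le]
      exact eq_neg_of_add_eq_zero_right hG
    rw [← h1, map_add, pairing_add_right, convOp_apply]
    have h3 := pairing_convMap_comm hH (cut 0 a (embLine G)) (cut 0 a (embLine u))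
    rw [hcut, hcut, h2, map_neg, pairing_neg_left, ← pairing_cut_comm] at h3
    rw [h3, add_neg_cancel]
  have h4 : convOp norm_mulRightB_le a H G = 0 := by
    rw [convOp_apply, hzero, convMap_zero_right]
  rwa [h4, add_zero] at hG

end Conv

/-! ### Continuous dependence of solutions on the operator -/

section Inverse

variable {V Z : Type*} [NormedAddCommGroup V] [NormedSpace ℂ V] [CompleteSpace V]
  [TopologicalSpace Z]

theorem continuous_inverse_apply {T : Z → V →L[ℂ] V} {v : Z → V} (hT : Continuous T)
    (hv : Continuous v) (hu : ∀ z, IsUnit (T z)) :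
    Continuous fun z => Ring.inverse (T z) (v z) := by
  refine Continuous.clm_apply (continuous_iff_continuousAt.2 fun z => ?_) hv
  obtain ⟨u, hu⟩ := hu z
  have h1 : ContinuousAt (Ring.inverse : (V →L[ℂ] V) → _) (T z) := by
    rw [← hu]
    exact NormedRing.inverse_continuousAt u
  exact h1.comp hT.continuousAt

/-- The solution `f` of `f + T f = v`. -/
noncomputable def solveOneAdd (T : V →L[ℂ] V) (v : V) : V := Ring.inverse (1 + T) v

theorem isUnit_one_add_of_bijective {T : V →L[ℂ] V}
    (hT : Function.Bijective fun v => v + T v) : IsUnit (1 + T) :=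
  ContinuousLinearMap.isUnit_iff_bijective.2 hT

theorem solveOneAdd_spec {T : V →L[ℂ] V} (hT : Function.Bijective fun v => v + T v) (v : V) :
    solveOneAdd T v + T (solveOneAdd T v) = v :=
  DFunLike.congr_fun (Ring.mul_inverse_cancel _ (isUnit_one_add_of_bijective hT)) v

theorem continuous_solveOneAdd {T : Z → V →L[ℂ] V} {v : Z → V} (hT : Continuous T)
    (hv : Continuous v) (hu : ∀ z, Function.Bijective fun v => v + T z v) :
    Continuous fun z => solveOneAdd (T z) (v z) :=
  continuous_inverse_apply (continuous_const.add hT) hv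
    fun z => isUnit_one_add_of_bijective (hu z)

end Inverse

/-! ### The Krein equation row by row -/

section KreinRow

variable {A : Type*} [NormedRing A] [NormedAlgebra ℂ A] [CompleteSpace A]

/-- `r` is the row `R(x, ·)` of a solution of the Krein equation. -/
def IsKreinRow (H : L2Line A) (x : ℝ) (r : L2Line A) : Prop :=
  r + cut 0 x (embLine (convMap (mulRightB A) H r)) = -cut 0 x (shift x H)

theorem IsKreinRow.unique {H : L2Line A} (hH : ConvInjective (norm_mulRightB_le (A := A)) H)
    {x : ℝ} (hx : x ∈ Icc (0 : ℝ) 1) {r s : L2Line A} (hr : IsKreinRow H x r)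
    (hs : IsKreinRow H x s) : r = s := by
  refine sub_eq_zero.1 (hH.eq_zero hx ?_)
  rw [convMap_sub_right, map_sub, map_sub]
  have h1 : r + cut 0 x (embLine (convMap (mulRightB A) H r)) =
    s + cut 0 x (embLine (convMap (mulRightB A) H s)) := hr.trans hs.symm
  rw [sub_add_sub_comm, h1, sub_self]

/-- The continuous part `t ↦ R(x, t) + H(x - t)` of the row `R(x, ·)`. -/
noncomputable def kreinC (H : L2Line A) (x : ℝ) : C(UnitI, A) :=
  solveOneAdd (convOp (norm_mulRightB_le (A := A)) x H)
    (convMap (mulRightB A) H (cut 0 x (shift x H)))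

/-- The row `R(x, ·)`. -/
noncomputable def kreinRow (H : L2Line A) (x : ℝ) : L2Line A :=
  cut 0 x (embLine (kreinC H x) - shift x H)

variable [FiniteDimensional ℂ A]

/-- Applying convolution to the formula for the row reproduces the equation that defines the
continuous part. -/
theorem kreinC_eq {H : L2Line A} (hH : ConvInjective (norm_mulRightB_le (A := A)) H)
    {x : ℝ} (hx : x ∈ Icc (0 : ℝ) 1) :
    kreinC H x = -convMap (mulRightB A) H (kreinRow H x) := by
  have h3 : kreinC H x + convOp (norm_mulRightB_le (A := A)) x H (kreinC H x) =
    convMap (mulRightB A) H (cut 0 x (shift x H)) := solveOneAdd_spec (hH.bijective hx) _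
  rw [kreinRow, map_sub, convMap_sub_right, ← h3, convOp_apply]
  abel

theorem isKreinRow_kreinRow {H : L2Line A} (hH : ConvInjective (norm_mulRightB_le (A := A)) H)
    {x : ℝ} (hx : x ∈ Icc (0 : ℝ) 1) : IsKreinRow H x (kreinRow H x) := by
  have h1 : convMap (mulRightB A) H (kreinRow H x) = -kreinC H x := by
    rw [kreinC_eq hH hx, neg_neg]
  rw [IsKreinRow, h1, kreinRow, map_neg, map_neg, map_sub]
  abel

/-- The operator depends on (H, x) continuously in operator norm, and inversion is continuous on
units. The continuity of Θ and of the sections of R rests on this. -/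
theorem continuous_kreinC : Continuous fun p : {H : L2Line A //
    ConvInjective (norm_mulRightB_le (A := A)) H} × UnitI => kreinC p.1.1 p.2 := by
  have hT : Continuous fun p : {H : L2Line A //
      ConvInjective (norm_mulRightB_le (A := A)) H} × UnitI =>
        convOp (norm_mulRightB_le (A := A)) p.2 p.1.1 :=
    (continuous_convOp (norm_mulRightB_le (A := A))).comp
      (f := fun p : {H : L2Line A // ConvInjective (norm_mulRightB_le (A := A)) H} × UnitI =>
        ((p.2 : ℝ), p.1.1)) (by fun_prop)
  have hv : Continuous fun p : {H : L2Line A //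
      ConvInjective (norm_mulRightB_le (A := A)) H} × UnitI =>
        convMap (mulRightB A) p.1.1 (cut 0 (p.2 : ℝ) (shift (p.2 : ℝ) p.1.1)) := by
    refine (continuous_convMap (mulRightB A)).comp
      ((continuous_subtype_val.comp continuous_fst).prodMk ?_)
    exact continuous_cut.comp (f := fun p : {H : L2Line A //
      ConvInjective (norm_mulRightB_le (A := A)) H} × UnitI =>
        (shift (p.2 : ℝ) p.1.1, ((0 : ℝ), (p.2 : ℝ))))
      ((continuous_shift.comp (f := fun p : {H : L2Line A //
        ConvInjective (norm_mulRightB_le (A := A)) H} × UnitI => (p.1.1, (p.2 : ℝ)))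
          (by fun_prop)).prodMk (by fun_prop))
  exact continuous_solveOneAdd hT hv fun p => p.1.2.bijective p.2.2

theorem continuous_kreinC_right {H : L2Line A}
    (hH : ConvInjective (norm_mulRightB_le (A := A)) H) :
    Continuous fun x : UnitI => kreinC H x :=
  continuous_kreinC.comp (f := fun x : UnitI => ((⟨H, hH⟩ : {H : L2Line A //
    ConvInjective (norm_mulRightB_le (A := A)) H}), x)) (by fun_prop)

/-- The function `x ↦ kreinC H x t` for fixed `t`. -/
noncomputable def kreinSection {H : L2Line A} (hH : ConvInjective (norm_mulRightB_le (A := A)) H)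
    (t : UnitI) : C(UnitI, A) :=
  ⟨fun x => kreinC H x t, (continuous_kreinC_right hH).eval_const t⟩

theorem continuous_kreinSection :
    Continuous fun p : {H : L2Line A // ConvInjective (norm_mulRightB_le (A := A)) H} × UnitI =>
      kreinSection p.1.2 p.2 := by
  refine ContinuousMap.continuous_of_continuous_uncurry _ ?_
  exact (continuous_kreinC.comp (f := fun q : ({H : L2Line A //
    ConvInjective (norm_mulRightB_le (A := A)) H} × UnitI) × UnitI => (q.1.1, q.2))
      (by fun_prop)).eval (by fun_prop)

/-- The kernel `R(x, t)` as a function. -/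
noncomputable def kreinKernel (H : L2Line A) (p : ℝ × ℝ) : A :=
  kreinC H (projIcc 0 1 zero_le_one p.1) (projIcc 0 1 zero_le_one p.2) - H (p.1 - p.2)

theorem stronglyMeasurable_kreinKernel {H : L2Line A}
    (hH : ConvInjective (norm_mulRightB_le (A := A)) H) : StronglyMeasurable (kreinKernel H) := by
  refine StronglyMeasurable.sub ?_ ((Lp.stronglyMeasurable H).comp_measurable
    (measurable_fst.sub measurable_snd))
  refine Continuous.stronglyMeasurable ?_
  exact ((continuous_kreinC_right hH).comp (continuous_projIcc.comp continuous_fst)).eval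
    (continuous_projIcc.comp continuous_snd)

theorem coeFn_kreinRow {H : L2Line A} (hE : IsEven H) {x : ℝ} (hx : x ∈ Icc (0 : ℝ) 1) :
    kreinRow H x =ᵐ[volume] (Ioc 0 x).indicator fun t => kreinKernel H (x, t) := by
  have h0 := (quasiMeasurePreserving_sub_left_of_right_invariant (volume : Measure ℝ) x).ae hE
  filter_upwards [coeFn_cut 0 x (embLine (kreinC H x) - shift x H),
    Lp.coeFn_sub (embLine (kreinC H x)) (shift x H), coeFn_embLine (kreinC H x),
    coeFn_shift x H, h0] with t h1 h2 h3 h4 h5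
  rw [kreinRow, h1]
  by_cases ht : t ∈ Ioc 0 x
  · have ht1 : t ∈ Ioc (0 : ℝ) 1 := ⟨ht.1, ht.2.trans hx.2⟩
    rw [indicator_of_mem ht, indicator_of_mem ht, h2, Pi.sub_apply, h3, indicator_of_mem ht1, h4,
      kreinKernel, projIcc_of_mem zero_le_one hx, ← h5, neg_sub]
    rfl
  · rw [indicator_of_notMem ht, indicator_of_notMem ht]

theorem integral_kreinKernel_mul {H : L2Line A}
    (hH : ConvInjective (norm_mulRightB_le (A := A)) H) (hE : IsEven H) {x t : ℝ}
    (hx : x ∈ Icc (0 : ℝ) 1) (ht : t ∈ Icc (0 : ℝ) 1) :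
    ∫ ξ in (0 : ℝ)..x, kreinKernel H (x, ξ) * H (ξ - t) = -kreinC H x ⟨t, ht⟩ := by
  rw [kreinC_eq hH hx, ContinuousMap.neg_apply, neg_neg, convMap_apply_eq_integral,
    intervalIntegral.integral_of_le hx.1, ← integral_indicator measurableSet_Ioc]
  refine integral_congr_ae ?_
  filter_upwards [coeFn_kreinRow hE hx] with ξ hξ
  rw [hξ]
  by_cases h : ξ ∈ Ioc 0 x
  · rw [indicator_of_mem h, indicator_of_mem h]
    rfl
  · rw [indicator_of_notMem h, indicator_of_notMem h]
    simp

theorem kreinKernel_eq {H : L2Line A}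
    (hH : ConvInjective (norm_mulRightB_le (A := A)) H) (hE : IsEven H) {x t : ℝ}
    (hx : x ∈ Icc (0 : ℝ) 1) (ht : t ∈ Icc (0 : ℝ) 1) :
    kreinKernel H (x, t) + H (x - t) + ∫ ξ in (0 : ℝ)..x, kreinKernel H (x, ξ) * H (ξ - t) = 0 := by
  rw [integral_kreinKernel_mul hH hE hx ht, kreinKernel, projIcc_of_mem zero_le_one hx,
    projIcc_of_mem zero_le_one ht]
  simp

/-- The continuous part is bounded on the unit square; ‖H(x - t)‖² is integrable over the strip 0 ≤
x ≤ 1 as the integrand of the convolution of an indicator with ‖H‖². -/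
theorem memLp_kreinKernel {H : L2Line A}
    (hH : ConvInjective (norm_mulRightB_le (A := A)) H) :
    MemLp (kreinKernel H) 2 (volume.restrict triangle) := by
  have hsub : triangle ⊆ Icc (0 : ℝ) 1 ×ˢ Icc (0 : ℝ) 1 := fun p hp =>
    ⟨⟨hp.1.trans hp.2.1, hp.2.2⟩, ⟨hp.1, hp.2.1.trans hp.2.2⟩⟩
  refine MemLp.mono_measure (Measure.restrict_mono hsub le_rfl) ?_
  rw [Measure.volume_eq_prod, ← Measure.prod_restrict]
  refine MemLp.sub ?_ ?_
  · obtain ⟨C, hC⟩ := isCompact_univ.exists_bound_of_continuousOn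
      (f := fun p : UnitI × UnitI => kreinC H p.1 p.2)
      (((continuous_kreinC_right hH).comp continuous_fst).eval continuous_snd).continuousOn
    refine MemLp.of_bound (C := C) ?_ (Eventually.of_forall fun p => hC (_, _) (mem_univ _))
    exact (((continuous_kreinC_right hH).comp (continuous_projIcc.comp continuous_fst)).eval
      (continuous_projIcc.comp continuous_snd)).aestronglyMeasurable
  · have hHm : StronglyMeasurable (fun p : ℝ × ℝ => H (p.1 - p.2)) :=
      (Lp.stronglyMeasurable H).comp_measurable (measurable_fst.sub measurable_snd)
    rw [memLp_two_iff_integrable_sq_norm hHm.aestronglyMeasurable]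
    have hH2 : Integrable (fun x => ‖H x‖ ^ 2) volume :=
      (Lp.memLp H).integrable_norm_pow two_ne_zero
    have h1 : Integrable (fun _ : ℝ => (1 : ℝ)) (volume.restrict (Icc (0 : ℝ) 1)) :=
      integrable_const _
    have h2 := h1.convolution_integrand (ContinuousLinearMap.mul ℝ ℝ) hH2
    simp only [ContinuousLinearMap.mul_apply', one_mul] at h2
    exact h2.mono_measure (Measure.prod_mono Measure.restrict_le_self le_rfl)

end KreinRow

/-! ### From accelerants to injectivity on matrix-valued continuous functions, and back -/

section Accelerant

variable {r : ℕ}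

/-- Restriction to `(0, 1)`. -/
noncomputable def restrictUnit (E : Type*) [NormedAddCommGroup E] [NormedSpace ℂ E] :
    L2Line E →L[ℂ] Lp E 2 volUnit :=
  LpToLpRestrictCLM ℝ E ℂ volume 2 (Ioo (0 : ℝ) 1)

theorem coeFn_restrictUnit {E : Type*} [NormedAddCommGroup E] [NormedSpace ℂ E] (f : L2Line E) :
    restrictUnit E f =ᵐ[volUnit] f :=
  LpToLpRestrictCLM_coeFn ℂ (Ioo (0 : ℝ) 1) f

/-- Extension by zero of `H ∈ L_2((-1, 1), M_r)`. -/
noncomputable def symExt : L2Sym r →L[ℂ] L2Line (Mr r) :=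
  extendZero (Ioo (-1 : ℝ) 1) measurableSet_Ioo

/-- Extension by zero of an element of `L_2((0, 1), M_r)`. -/
noncomputable def unitExt : L2Unit r →L[ℂ] L2Line (Mr r) :=
  extendZero (Ioo (0 : ℝ) 1) measurableSet_Ioo

theorem symExt_ae (H : L2Sym r) : ∀ᵐ y : ℝ, y ∈ Ioo (-1 : ℝ) 1 → symExt H y = H y := by
  filter_upwards [coeFn_extendZero (Ioo (-1 : ℝ) 1) measurableSet_Ioo H] with y hy h
  rw [symExt, hy, indicator_of_mem h]

theorem isEven_symExt_iff (H : L2Sym r) :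
    IsEven (symExt H) ↔ ∀ᵐ x ∂volSym, H (-x) = H x := by
  have h1 := coeFn_extendZero (Ioo (-1 : ℝ) 1) measurableSet_Ioo H
  have h2 := (Measure.measurePreserving_neg (volume : Measure ℝ)).quasiMeasurePreserving.ae h1
  have hmem : ∀ x : ℝ, -x ∈ Ioo (-1 : ℝ) 1 ↔ x ∈ Ioo (-1 : ℝ) 1 := fun x => by
    simp only [mem_Ioo]
    constructor <;> rintro ⟨h3, h4⟩ <;> constructor <;> linarith
  rw [ae_restrict_iff' measurableSet_Ioo]
  constructor
  · intro h
    filter_upwards [h, h1, h2] with x hx h3 h4 hx1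
    rw [symExt, h3, h4, indicator_of_mem hx1, indicator_of_mem ((hmem x).2 hx1)] at hx
    exact hx
  · intro h
    filter_upwards [h, h1, h2] with x hx h3 h4
    rw [symExt, h3, h4]
    by_cases hx1 : x ∈ Ioo (-1 : ℝ) 1
    · rw [indicator_of_mem hx1, indicator_of_mem ((hmem x).2 hx1), hx hx1]
    · rw [indicator_of_notMem hx1, indicator_of_notMem (fun h => hx1 ((hmem x).1 h))]

theorem symExt_sub_ae (H : L2Sym r) {x : ℝ} (hx : x ∈ Ioo (0 : ℝ) 1) :
    ∀ᵐ t : ℝ, t ∈ Ioc (0 : ℝ) 1 → symExt H (x - t) = H (x - t) := by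
  have h1 := (quasiMeasurePreserving_sub_left_of_right_invariant (volume : Measure ℝ) x).ae
    (symExt_ae H)
  filter_upwards [h1] with t ht h
  exact ht ⟨by linarith [hx.1, h.2], by linarith [hx.2, h.1]⟩

/-- The `j`-th column of a matrix. -/
noncomputable def colMap (j : Fin r) : Mr r →L[ℂ] CVec r :=
  LinearMap.toContinuousLinearMap
    { toFun := fun X => Matrix.toEuclideanCLM (𝕜 := ℂ) X (EuclideanSpace.single j 1)
      map_add' := fun X Y => by simp
      map_smul' := fun c X => by simp }

theorem colMap_apply (j : Fin r) (X : Mr r) :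
    colMap j X = Matrix.toEuclideanCLM (𝕜 := ℂ) X (EuclideanSpace.single j 1) := rfl

theorem colMap_mul (j : Fin r) (X Y : Mr r) :
    colMap j (X * Y) = Matrix.toEuclideanCLM (𝕜 := ℂ) X (colMap j Y) := by
  rw [colMap_apply, map_mul]
  rfl

theorem eq_zero_of_colMap {X : Mr r} (h : ∀ j, colMap j X = 0) : X = 0 := by
  ext i j
  have h1 := congrArg (fun v : CVec r => v i) (h j)
  simpa [colMap_apply, Matrix.ofLp_toEuclideanCLM] using h1

/-- The matrix all of whose columns are equal to a given vector. -/
noncomputable def repeatCol : CVec r →L[ℂ] Mr r :=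
  LinearMap.toContinuousLinearMap
    { toFun := fun v => Matrix.of fun i _ => v i
      map_add' := fun v w => by ext; simp
      map_smul' := fun c v => by ext; simp }

theorem repeatCol_mul (X : Mr r) (v : CVec r) :
    repeatCol (Matrix.toEuclideanCLM (𝕜 := ℂ) X v) = X * repeatCol v := by
  ext i j
  simp [repeatCol, Matrix.ofLp_toEuclideanCLM, Matrix.mulVec, dotProduct, Matrix.mul_apply]

/-- The diagonal of a matrix. -/
noncomputable def diagMap : Mr r →L[ℂ] CVec r :=
  LinearMap.toContinuousLinearMap
    { toFun := fun X => WithLp.toLp 2 fun i => X i i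
      map_add' := fun X Y => by ext; simp
      map_smul' := fun c X => by ext; simp }

theorem diagMap_repeatCol (v : CVec r) : diagMap (repeatCol v) = v := rfl

theorem eq_zero_of_repeatCol {v : CVec r} (h : repeatCol v = 0) : v = 0 := by
  rw [← diagMap_repeatCol v, h, map_zero]

/-- Each column of F solves the vector equation, hence is zero almost everywhere on (0,1);
continuity of F removes the exceptional set. -/
theorem convInjective_of_mem_accelerants {H : L2Sym r} (hH : H ∈ accelerants r) :
    ConvInjective (norm_mulLeftB_le (A := Mr r)) (symExt H) := by
  have hE := (isEven_symExt_iff H).2 hH.1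
  intro a ha F hF
  have hcol : ∀ j, ∀ᵐ x ∂volUnit, colMap j (IccExtend zero_le_one F x) = 0 := by
    intro j
    set f : Lp (CVec r) 2 volUnit := (colMap j).compLp (restrictUnit (Mr r) (embLine F)) with hf
    have hfx : ∀ᵐ x : ℝ, x ∈ Ioo (0 : ℝ) 1 → f x = colMap j (embLine F x) := by
      refine (ae_restrict_iff' measurableSet_Ioo).1 ?_
      filter_upwards [(colMap j).coeFn_compLp (restrictUnit (Mr r) (embLine F)),
        coeFn_restrictUnit (embLine F)] with x h1 h2
      rw [hf, h1, h2]
    have hf0 : f = 0 := by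
      refine hH.2 a ha f ?_
      rw [ae_restrict_iff' measurableSet_Ioo]
      filter_upwards [hfx, coeFn_embLine F] with x h1 h2 hx
      have hx1 : x ∈ Icc (0 : ℝ) 1 := ⟨hx.1.le, hx.2.le⟩
      have h3 : ∫ t in (0 : ℝ)..a, Matrix.toEuclideanCLM (𝕜 := ℂ) (H (x - t)) (f t) =
          ∫ t in (0 : ℝ)..a, colMap j (symExt H (t - x) * embLine F t) := by
        refine intervalIntegral.integral_congr_ae ?_
        filter_upwards [hfx, symExt_sub_ae H hx, hE.shift_eq x,
          (Ioo_ae_eq_Ioc (μ := volume) (a := (0 : ℝ)) (b := 1)).mem_iff] with t h4 h5 h6 h7 h8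
        rw [uIoc_of_le ha.1] at h8
        have h9 : t ∈ Ioc (0 : ℝ) 1 := ⟨h8.1, h8.2.trans ha.2⟩
        rw [h4 (h7.2 h9), ← h5 h9, ← h6, colMap_mul]
      have h4 : IntervalIntegrable (fun t => symExt H (t - x) * embLine F t) volume 0 a := by
        refine Integrable.intervalIntegrable ?_
        refine (integrable_bilin_L2 (mulLeftB (Mr r)) (shift x (symExt H)) (embLine F)).congr ?_
        filter_upwards [coeFn_shift x (symExt H)] with t h5
        rw [h5]
        rfl
      have h5 := DFunLike.congr_fun hF ⟨x, hx1⟩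
      rw [ContinuousMap.add_apply, convOp_apply, convMap_cut_apply _ ha.1] at h5
      rw [h3, ContinuousLinearMap.intervalIntegral_comp_comm _ h4, h1 hx, ← map_add, h2,
        indicator_of_mem (Ioo_subset_Ioc_self hx), IccExtend_of_mem _ _ hx1]
      have h6 := congrArg (colMap j) h5
      rw [ContinuousMap.zero_apply, map_zero] at h6
      exact h6
    rw [ae_restrict_iff' measurableSet_Ioo]
    filter_upwards [hfx, coeFn_embLine F, (ae_restrict_iff' measurableSet_Ioo).1
      (Lp.coeFn_zero (CVec r) 2 volUnit)] with x h1 h2 h3 hx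
    rw [indicator_of_mem (Ioo_subset_Ioc_self hx)] at h2
    rw [← h2, ← h1 hx, hf0, h3 hx]
    rfl
  have hae : ∀ᵐ x ∂volume.restrict (Icc (0 : ℝ) 1), IccExtend zero_le_one F x = 0 := by
    rw [← restrict_Ioo_eq_restrict_Icc]
    filter_upwards [ae_all_iff.2 hcol] with x hx
    exact eq_zero_of_colMap hx
  have heq := Measure.eqOn_Icc_of_ae_eq volume zero_ne_one hae
    (F.continuous.Icc_extend' (h := zero_le_one)).continuousOn continuousOn_const
  ext1 t
  have h1 := heq t.2
  rw [IccExtend_of_mem _ _ t.2] at h1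
  exact h1

/-- A vector solution f becomes a matrix solution g by repeating it in every column. The equation
shows that g agrees a.e. with a continuous function, to which injectivity on C([0,1]) applies. -/
theorem mem_accelerants_of_convInjective {H : L2Sym r} (hE : IsEven (symExt H))
    (hH : ConvInjective (norm_mulLeftB_le (A := Mr r)) (symExt H)) : H ∈ accelerants r := by
  refine ⟨(isEven_symExt_iff H).1 hE, fun a ha f hf => ?_⟩
  set g : L2Line (Mr r) := unitExt (repeatCol.compLp f) with hg
  have hgx : ∀ᵐ x : ℝ, g x = (Ioo (0 : ℝ) 1).indicator (fun x => repeatCol (f x)) x := by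
    filter_upwards [coeFn_extendZero (Ioo (0 : ℝ) 1) measurableSet_Ioo (repeatCol.compLp f),
      (ae_restrict_iff' measurableSet_Ioo).1 (repeatCol.coeFn_compLp f)] with x h1 h2
    rw [hg, unitExt, h1]
    by_cases hx : x ∈ Ioo (0 : ℝ) 1
    · rw [indicator_of_mem hx, indicator_of_mem hx, h2 hx]
    · rw [indicator_of_notMem hx, indicator_of_notMem hx]
  set c := convMap (mulLeftB (Mr r)) (symExt H) (cut 0 a g) with hc
  have hgc : g = -embLine c := by
    ext1
    filter_upwards [hgx, (ae_restrict_iff' measurableSet_Ioo).1 hf, coeFn_embLine c,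
      Lp.coeFn_neg (embLine c), (Ioo_ae_eq_Ioc (μ := volume) (a := (0 : ℝ)) (b := 1)).mem_iff]
      with x h1 h2 h3 h4 h5
    rw [h1, h4, Pi.neg_apply, h3]
    by_cases hx : x ∈ Ioo (0 : ℝ) 1
    · rw [indicator_of_mem hx, indicator_of_mem (h5.1 hx)]
      have hx1 : x ∈ Icc (0 : ℝ) 1 := ⟨hx.1.le, hx.2.le⟩
      rw [IccExtend_of_mem _ _ hx1, hc, convMap_cut_apply _ ha.1]
      have h6 : f x = -∫ t in (0 : ℝ)..a, Matrix.toEuclideanCLM (𝕜 := ℂ) (H (x - t)) (f t) :=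
        eq_neg_of_add_eq_zero_left (h2 hx)
      have hcongr : ∀ᵐ t : ℝ, t ∈ Ioc (0 : ℝ) a → symExt H (t - x) * g t =
          repeatCol (Matrix.toEuclideanCLM (𝕜 := ℂ) (H (x - t)) (f t)) := by
        filter_upwards [hgx, symExt_sub_ae H hx, hE.shift_eq x,
          (Ioo_ae_eq_Ioc (μ := volume) (a := (0 : ℝ)) (b := 1)).mem_iff] with t h4 h5 h6 h7 h8
        have h9 : t ∈ Ioc (0 : ℝ) 1 := ⟨h8.1, h8.2.trans ha.2⟩
        rw [repeatCol_mul, ← h5 h9, ← h6, h4, indicator_of_mem (h7.2 h9)]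
      have hint : IntervalIntegrable (fun t => symExt H (t - x) * g t) volume 0 a := by
        refine Integrable.intervalIntegrable ?_
        refine (integrable_bilin_L2 (mulLeftB (Mr r)) (shift x (symExt H)) g).congr ?_
        filter_upwards [coeFn_shift x (symExt H)] with t h5
        rw [h5]
        rfl
      have hr : IntervalIntegrable (fun t =>
          Matrix.toEuclideanCLM (𝕜 := ℂ) (H (x - t)) (f t)) volume 0 a := by
        rw [intervalIntegrable_iff_integrableOn_Ioc_of_le ha.1] at hint ⊢
        -- The diagonal inverts the repetition of columns, so integrability passes from the matrix
        -- integrand to the vector one.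
        refine (diagMap.integrable_comp hint).congr ?_
        rw [EventuallyEq, ae_restrict_iff' measurableSet_Ioc]
        filter_upwards [hcongr] with t ht h8
        rw [ht h8, diagMap_repeatCol]
      rw [h6, map_neg, ← ContinuousLinearMap.intervalIntegral_comp_comm _ hr]
      congr 1
      refine intervalIntegral.integral_congr_ae ?_
      filter_upwards [hcongr] with t ht h8
      rw [uIoc_of_le ha.1] at h8
      exact (ht h8).symm
    · rw [indicator_of_notMem hx, indicator_of_notMem (fun h => hx (h5.2 h)), neg_zero]
  have hc0 : c = 0 := by
    refine hH a ha c ?_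
    rw [convOp_apply]
    have h1 : embLine c = -g := by rw [hgc, neg_neg]
    rw [h1, map_neg, convMap_neg_right, ← hc, add_neg_cancel]
  rw [hc0, map_zero, neg_zero] at hgc
  rw [Lp.eq_zero_iff_ae_eq_zero, EventuallyEq, ae_restrict_iff' measurableSet_Ioo]
  filter_upwards [hgx, Lp.coeFn_zero (Mr r) 2 volume] with x h1 h2 hx
  rw [hgc, h2, indicator_of_mem hx] at h1
  exact eq_zero_of_repeatCol h1.symm

end Accelerant

/-! ### Null sets of the triangle and of its rows -/

section Triangle

theorem ae_ae_of_ae_triangle {P : ℝ × ℝ → Prop} (h : ∀ᵐ p ∂(volume.restrict triangle), P p) :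
    ∀ᵐ x ∂volUnit, ∀ᵐ t : ℝ, t ∈ Ioc 0 x → P (x, t) := by
  rw [ae_restrict_iff' measurableSet_triangle, Measure.volume_eq_prod] at h
  rw [ae_restrict_iff' measurableSet_Ioo]
  filter_upwards [Measure.ae_ae_of_ae_prod h] with x hx hx1
  filter_upwards [hx] with t ht h1
  exact ht ⟨h1.1.le, h1.2, hx1.2.le⟩

theorem ae_triangle_of_ae_ae {P : ℝ × ℝ → Prop} (hP : MeasurableSet {p | P p})
    (h : ∀ᵐ x ∂volUnit, ∀ᵐ t : ℝ, t ∈ Ioc 0 x → P (x, t)) :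
    ∀ᵐ p ∂(volume.restrict triangle), P p := by
  rw [ae_restrict_iff' measurableSet_triangle, Measure.volume_eq_prod]
  refine (Measure.ae_prod_iff_ae_ae (measurableSet_triangle.imp hP)).2 ?_
  rw [ae_restrict_iff' measurableSet_Ioo] at h
  filter_upwards [h, (Ioo_ae_eq_Icc (μ := volume) (a := (0 : ℝ)) (b := 1)).mem_iff] with x hx h1
  by_cases hx1 : x ∈ Ioo (0 : ℝ) 1
  · filter_upwards [hx hx1, (Ioc_ae_eq_Icc (μ := volume) (a := (0 : ℝ)) (b := x)).mem_iff]
      with t ht h2 h3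
    exact ht (h2.2 ⟨h3.1, h3.2.1⟩)
  · exact Eventually.of_forall fun t ht => absurd (h1.2 ⟨ht.1.trans ht.2.1, ht.2.2⟩) hx1

theorem ae_triangle_fst {P : ℝ → Prop} (h : ∀ᵐ x ∂volUnit, P x) :
    ∀ᵐ p ∂(volume.restrict triangle), P p.1 := by
  rw [ae_restrict_iff' measurableSet_Ioo] at h
  have h1 : ∀ᵐ x : ℝ, x ∈ Icc (0 : ℝ) 1 → P x := by
    filter_upwards [h, (Ioo_ae_eq_Icc (μ := volume) (a := (0 : ℝ)) (b := 1)).mem_iff] with x hx h1 h2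
    exact hx (h1.2 h2)
  rw [ae_restrict_iff' measurableSet_triangle, Measure.volume_eq_prod]
  have h2 := (Measure.quasiMeasurePreserving_fst (μ := (volume : Measure ℝ))
    (ν := (volume : Measure ℝ))).ae h1
  filter_upwards [h2] with p hp hp1
  exact hp ⟨hp1.1.trans hp1.2.1, hp1.2.2⟩

end Triangle

/-! ### Solvability of the Krein equation, the section at t = 0 and continuity of Θ -/

section Krein

variable {r : ℕ}

theorem symExt_sub_ae' (H : L2Sym r) {x t : ℝ} (hx : x ∈ Ioo (0 : ℝ) 1) (ht : t ∈ Icc (0 : ℝ) 1) :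
    ∀ᵐ ξ : ℝ, ξ ∈ Ioc (0 : ℝ) x → symExt H (ξ - t) = H (ξ - t) := by
  have h1 := (measurePreserving_sub_right (volume : Measure ℝ) t).quasiMeasurePreserving.ae (symExt_ae H)
  filter_upwards [h1] with ξ hξ h
  exact hξ ⟨by linarith [hx.1, h.1, ht.2], by linarith [hx.2, h.2, ht.1]⟩

/-- The exceptional set of x does not depend on t. This permits t = 0, which a statement for almost
every point of the triangle would not. -/
theorem ae_integral_mul_eq (H : L2Sym r) {R k : ℝ × ℝ → Mr r}
    (h : ∀ᵐ p ∂(volume.restrict triangle), R p = k p) :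
    ∀ᵐ x ∂volUnit, ∀ t ∈ Icc (0 : ℝ) 1, ∫ ξ in (0 : ℝ)..x, R (x, ξ) * H (ξ - t) =
      ∫ ξ in (0 : ℝ)..x, k (x, ξ) * symExt H (ξ - t) := by
  filter_upwards [ae_ae_of_ae_triangle h, ae_restrict_mem measurableSet_Ioo] with x hx hx1 t ht
  refine intervalIntegral.integral_congr_ae ?_
  filter_upwards [hx, symExt_sub_ae' H hx1 ht] with ξ h1 h2 h3
  rw [uIoc_of_le hx1.1.le] at h3
  rw [h1 h3, h2 h3]

theorem ae_krein_expr_eq (H : L2Sym r) {R k : ℝ × ℝ → Mr r}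
    (h : ∀ᵐ p ∂(volume.restrict triangle), R p = k p) :
    ∀ᵐ p ∂(volume.restrict triangle),
      R p + H (p.1 - p.2) + ∫ ξ in (0 : ℝ)..p.1, R (p.1, ξ) * H (ξ - p.2) =
      k p + symExt H (p.1 - p.2) + ∫ ξ in (0 : ℝ)..p.1, k (p.1, ξ) * symExt H (ξ - p.2) := by
  have h1 : ∀ᵐ p : ℝ × ℝ ∂(volume.restrict triangle), p.1 - p.2 ∈ Ioo (-1 : ℝ) 1 →
      symExt H (p.1 - p.2) = H (p.1 - p.2) := by
    refine ae_restrict_of_ae ?_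
    rw [Measure.volume_eq_prod]
    exact (quasiMeasurePreserving_sub_of_right_invariant (volume : Measure ℝ)
      (volume : Measure ℝ)).ae (symExt_ae H)
  filter_upwards [h, h1, ae_triangle_fst (ae_integral_mul_eq H h),
    ae_triangle_fst (ae_restrict_mem (measurableSet_Ioo (a := (0 : ℝ)) (b := 1))),
    ae_restrict_mem measurableSet_triangle] with p h2 h3 h4 h5 h6
  rw [h2, h4 p.2 ⟨h6.1, h6.2.1.trans h6.2.2⟩, h3 ⟨by linarith [h6.1, h6.2.1], by
    linarith [h6.1, h5.2]⟩]

theorem convInjective_right_of_mem_accelerants {H : L2Sym r} (hH : H ∈ accelerants r) :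
    ConvInjective (norm_mulRightB_le (A := Mr r)) (symExt H) :=
  (convInjective_of_mem_accelerants hH).right_of_left ((isEven_symExt_iff H).2 hH.1)

/-- The element of `L_2(Ω, M_r)` given by the Krein kernel. -/
noncomputable def kreinLp {H : L2Sym r}
    (hH : ConvInjective (norm_mulRightB_le (A := Mr r)) (symExt H)) : L2Tri r :=
  (memLp_kreinKernel hH).toLp _

theorem isKreinSolution_kreinLp {H : L2Sym r}
    (hH : ConvInjective (norm_mulRightB_le (A := Mr r)) (symExt H)) (hE : IsEven (symExt H)) :
    IsKreinSolution H (kreinLp hH) := by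
  filter_upwards [ae_krein_expr_eq H (memLp_kreinKernel hH).coeFn_toLp,
    ae_restrict_mem measurableSet_triangle] with p h1 h2
  refine h1.trans ?_
  exact kreinKernel_eq hH hE ⟨h2.1.trans h2.2.1, h2.2.2⟩ ⟨h2.1, h2.2.1.trans h2.2.2⟩

theorem ae_memLp_row (R : L2Tri r) :
    ∀ᵐ x ∂volUnit, MemLp ((Ioc 0 x).indicator fun t => R (x, t)) 2 volume := by
  have h1 : Integrable (fun p => ‖R p‖ ^ 2) (volume.restrict triangle) :=
    (Lp.memLp R).integrable_norm_pow two_ne_zero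
  rw [← IntegrableOn, ← integrable_indicator_iff measurableSet_triangle] at h1
  have h3 : Integrable (triangle.indicator fun p => ‖R p‖ ^ 2)
    ((volume : Measure ℝ).prod volume) := h1
  filter_upwards [ae_restrict_of_ae h3.prod_right_ae, ae_restrict_mem measurableSet_Ioo]
    with x hx hx1
  have hm : StronglyMeasurable ((Ioc 0 x).indicator fun t => R (x, t)) :=
    ((Lp.stronglyMeasurable R).comp_measurable measurable_prodMk_left).indicator measurableSet_Ioc
  rw [memLp_two_iff_integrable_sq_norm hm.aestronglyMeasurable]
  refine (hx.indicator (measurableSet_Ioc (a := (0 : ℝ)) (b := x))).congr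
    (Eventually.of_forall fun t => ?_)
  by_cases ht : t ∈ Ioc 0 x
  · have h2 : (x, t) ∈ triangle := ⟨ht.1.le, ht.2, hx1.2.le⟩
    simp only [indicator_of_mem ht, indicator_of_mem h2]
  · simp [indicator_of_notMem ht]

/-- Almost every row of an L_2 solution is square integrable and solves the row equation, whose
solution is unique. -/
theorem IsKreinSolution.ae_eq_kreinKernel {H : L2Sym r} {R : L2Tri r} (hR : IsKreinSolution H R)
    (hH : ConvInjective (norm_mulRightB_le (A := Mr r)) (symExt H)) (hE : IsEven (symExt H)) :
    ∀ᵐ p ∂(volume.restrict triangle), R p = kreinKernel (symExt H) p := by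
  refine ae_triangle_of_ae_ae ((Lp.stronglyMeasurable R).measurableSet_eq_fun
    (stronglyMeasurable_kreinKernel hH)) ?_
  have h0 : ∀ᵐ p ∂(volume.restrict triangle), R p + symExt H (p.1 - p.2) +
      ∫ ξ in (0 : ℝ)..p.1, R (p.1, ξ) * symExt H (ξ - p.2) = 0 := by
    filter_upwards [hR, ae_krein_expr_eq H (R := R) (k := R)
      (Eventually.of_forall fun _ => rfl)] with p h1 h2
    rw [← h2, h1]
  filter_upwards [ae_ae_of_ae_triangle h0, ae_memLp_row R, ae_restrict_mem measurableSet_Ioo]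
    with x h1 h2 hx
  have hx1 : x ∈ Icc (0 : ℝ) 1 := ⟨hx.1.le, hx.2.le⟩
  have hrow : IsKreinRow (symExt H) x (h2.toLp _) := by
    rw [IsKreinRow]
    ext1
    filter_upwards [h1, h2.coeFn_toLp, coeFn_cut 0 x (shift x (symExt H)),
      coeFn_shift x (symExt H), hE.shift_eq x,
      coeFn_cut_embLine (a := 0) le_rfl hx.2.le
        (convMap (mulRightB (Mr r)) (symExt H) (h2.toLp _)),
      Lp.coeFn_add (h2.toLp _) (cut 0 x (embLine (convMap (mulRightB (Mr r)) (symExt H)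
        (h2.toLp _)))), Lp.coeFn_neg (cut 0 x (shift x (symExt H)))]
      with t g1 g2 g3 g4 g5 g6 g7 g8
    rw [g7, g8, Pi.add_apply, Pi.neg_apply, g2, g3, g6]
    by_cases ht : t ∈ Ioc 0 x
    · have ht1 : t ∈ Icc (0 : ℝ) 1 := ⟨ht.1.le, ht.2.trans hx.2.le⟩
      rw [indicator_of_mem ht, indicator_of_mem ht, indicator_of_mem ht, g4, g5,
        IccExtend_of_mem _ _ ht1, convMap_apply_eq_integral]
      have g9 : ∫ ξ, mulRightB (Mr r) (symExt H (ξ - t)) (h2.toLp _ ξ) =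
          ∫ ξ in (0 : ℝ)..x, R (x, ξ) * symExt H (ξ - t) := by
        rw [intervalIntegral.integral_of_le hx.1.le, ← integral_indicator measurableSet_Ioc]
        refine integral_congr_ae ?_
        filter_upwards [h2.coeFn_toLp] with ξ hξ
        rw [hξ]
        by_cases h : ξ ∈ Ioc 0 x
        · rw [indicator_of_mem h, indicator_of_mem h]
          rfl
        · rw [indicator_of_notMem h, indicator_of_notMem h, map_zero]
      rw [g9, eq_neg_iff_add_eq_zero, add_right_comm]
      exact g1 ht
    · simp only [indicator_of_notMem ht, add_zero, neg_zero]
  have heq := hrow.unique hH hx1 (isKreinRow_kreinRow hH hx1)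
  filter_upwards [h2.coeFn_toLp, coeFn_kreinRow hE hx1] with t g1 g2 ht
  rw [heq, g2, indicator_of_mem ht, indicator_of_mem ht] at g1
  exact g1.symm

theorem existsUnique_kreinSolution {H : L2Sym r} (hH : H ∈ accelerants r) :
    ∃! R : L2Tri r, IsKreinSolution H R := by
  have hR := convInjective_right_of_mem_accelerants hH
  have hE := (isEven_symExt_iff H).2 hH.1
  refine ⟨kreinLp hR, isKreinSolution_kreinLp hR hE, fun R h => ?_⟩
  ext1
  filter_upwards [h.ae_eq_kreinKernel hR hE, (memLp_kreinKernel hR).coeFn_toLp] with p h1 h2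
  rw [h1, kreinLp, h2]

theorem kreinSolution_ae_eq {H : L2Sym r} (hH : H ∈ accelerants r) :
    ∀ᵐ p ∂(volume.restrict triangle), kreinSolution H p = kreinKernel (symExt H) p :=
  (Classical.epsilon_spec (existsUnique_kreinSolution hH).exists).ae_eq_kreinKernel
    (convInjective_right_of_mem_accelerants hH) ((isEven_symExt_iff H).2 hH.1)

/-- By the Krein equation the integral term of Θ is minus the continuous part of R at t = 0. -/
theorem Theta_eq (H : accelerants r) :
    Theta r H = restrictUnit (Mr r) (symExt H.1 -
      embLine (kreinSection (convInjective_right_of_mem_accelerants H.2) 0)) := by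
  have hR := convInjective_right_of_mem_accelerants H.2
  have hE := (isEven_symExt_iff H.1).2 H.2.1
  ext1
  have h0 := (ae_restrict_of_ae (symExt_ae H.1) : ∀ᵐ y ∂volUnit, _)
  filter_upwards [(memLp_thetaFun H.1 (kreinSolution H.1)).coeFn_toLp,
    coeFn_restrictUnit (symExt H.1 - embLine (kreinSection hR 0)),
    (ae_restrict_of_ae (Lp.coeFn_sub (symExt H.1) (embLine (kreinSection hR 0))) :
      ∀ᵐ y ∂volUnit, _),
    (ae_restrict_of_ae (coeFn_embLine (kreinSection hR 0)) : ∀ᵐ y ∂volUnit, _),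
    ae_integral_mul_eq H.1 (kreinSolution_ae_eq H.2), h0, ae_restrict_mem measurableSet_Ioo]
    with x h1 h2 h3 h4 h5 h6 hx
  have hx1 : x ∈ Icc (0 : ℝ) 1 := ⟨hx.1.le, hx.2.le⟩
  rw [Theta, h1, h2, h3, Pi.sub_apply, h4, indicator_of_mem (Ioo_subset_Ioc_self hx),
    h6 ⟨by linarith [hx.1], hx.2⟩, IccExtend_of_mem _ _ hx1, sub_eq_add_neg]
  have h7 := h5 0 ⟨le_rfl, zero_le_one⟩
  simp only [sub_zero] at h7
  rw [h7]
  have h8 := integral_kreinKernel_mul hR hE hx1 (t := 0) ⟨le_rfl, zero_le_one⟩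
  simp only [sub_zero] at h8
  rw [h8]
  rfl

/-- The continuous map is t ↦ 1_{(t,1]} (c(·,t) - H(· - t)): c is continuous, and truncation and
translation are continuous in L_2. At t = 0 it is c(·,0) - H. -/
theorem isSectionAtZero_kreinSolution (H : accelerants r) :
    IsSectionAtZero (kreinSolution H.1) (-Theta r H) := by
  have hR := convInjective_right_of_mem_accelerants H.2
  have hE := (isEven_symExt_iff H.1).2 H.2.1
  refine ⟨fun t => restrictUnit (Mr r) (cut t 1 (embLine (kreinSection hR
    (projIcc 0 1 zero_le_one t)) - shift t (symExt H.1))), ?_, ?_, ?_⟩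
  · refine Continuous.continuousOn ((restrictUnit (Mr r)).continuous.comp ?_)
    refine continuous_cut.comp (f := fun t : ℝ => (embLine (kreinSection hR
      (projIcc 0 1 zero_le_one t)) - shift t (symExt H.1), (t, (1 : ℝ)))) (Continuous.prodMk ?_
        (by fun_prop))
    refine (embLine.continuous.comp ?_).sub (continuous_shift.comp (f := fun t : ℝ =>
      (symExt H.1, t)) (by fun_prop))
    exact continuous_kreinSection.comp (f := fun t : ℝ => ((⟨symExt H.1, hR⟩ : {H : L2Line (Mr r) //
      ConvInjective (norm_mulRightB_le (A := Mr r)) H}), projIcc (0 : ℝ) 1 zero_le_one t))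
      (continuous_const.prodMk continuous_projIcc)
  · have h0 : ∀ᵐ t : ℝ, ∀ᵐ x : ℝ, (x, t) ∈ triangle →
        kreinSolution H.1 (x, t) = kreinKernel (symExt H.1) (x, t) := by
      have h1 := kreinSolution_ae_eq H.2
      rw [ae_restrict_iff' measurableSet_triangle] at h1
      have h2 : ∀ᵐ p ∂((volume : Measure ℝ).prod volume), p ∈ triangle →
        kreinSolution H.1 p = kreinKernel (symExt H.1) p := h1
      exact Measure.ae_ae_of_ae_prod (Measure.measurePreserving_swap.quasiMeasurePreserving.ae h2)
    filter_upwards [ae_restrict_of_ae h0, ae_restrict_mem measurableSet_Ioo] with t h1 ht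
    have ht1 : t ∈ Icc (0 : ℝ) 1 := ⟨ht.1.le, ht.2.le⟩
    rw [projIcc_of_mem zero_le_one ht1]
    set g := embLine (kreinSection hR ⟨t, ht1⟩)
    -- The triangle contains its diagonal while the truncation to (t,1] omits x = t.
    have hne : ∀ᵐ x : ℝ, x ≠ t := by simp [ae_iff]
    filter_upwards [coeFn_restrictUnit (cut t 1 (g - shift t (symExt H.1))),
      ae_restrict_of_ae (coeFn_cut t 1 (g - shift t (symExt H.1))),
      ae_restrict_of_ae (Lp.coeFn_sub g (shift t (symExt H.1))),
      ae_restrict_of_ae (coeFn_embLine (kreinSection hR ⟨t, ht1⟩)),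
      ae_restrict_of_ae (coeFn_shift t (symExt H.1)), ae_restrict_of_ae h1,
      ae_restrict_of_ae hne, ae_restrict_mem measurableSet_Ioo] with x h2 h3 h4 h5 h6 h7 h8 hx
    have hx1 : x ∈ Icc (0 : ℝ) 1 := ⟨hx.1.le, hx.2.le⟩
    rw [h2, h3]
    by_cases hxt : t < x
    · have h9 : (x, t) ∈ triangle := ⟨ht.1.le, hxt.le, hx.2.le⟩
      have h10 : x ∈ Ioc t 1 := ⟨hxt, hx.2.le⟩
      rw [indicator_of_mem h9, indicator_of_mem h10, h7 h9, h4, Pi.sub_apply, h5, h6,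
        indicator_of_mem (Ioo_subset_Ioc_self hx), IccExtend_of_mem _ _ hx1, kreinKernel,
        projIcc_of_mem zero_le_one hx1, projIcc_of_mem zero_le_one ht1]
      rfl
    · have h9 : (x, t) ∉ triangle := fun h => h8 (le_antisymm (not_lt.1 hxt) h.2.1)
      have h10 : x ∉ Ioc t 1 := fun h => hxt h.1
      rw [indicator_of_notMem h9, indicator_of_notMem h10]
  · have h0 : shift 0 (symExt H.1) = symExt H.1 := by
      ext1
      filter_upwards [coeFn_shift 0 (symExt H.1)] with x hx
      rw [hx, sub_zero]
    beta_reduce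
    rw [Theta_eq, h0, ← map_neg, neg_sub, projIcc_of_mem zero_le_one ⟨le_rfl, zero_le_one⟩]
    change restrictUnit (Mr r) (cut 0 1 (embLine (kreinSection hR 0) - symExt H.1)) =
      restrictUnit (Mr r) (embLine (kreinSection hR 0) - symExt H.1)
    ext1
    filter_upwards [coeFn_restrictUnit (cut 0 1 (embLine (kreinSection hR 0) - symExt H.1)),
      coeFn_restrictUnit (embLine (kreinSection hR 0) - symExt H.1),
      ae_restrict_of_ae (coeFn_cut 0 1 (embLine (kreinSection hR 0) - symExt H.1)),
      ae_restrict_mem measurableSet_Ioo] with x h1 h2 h3 hx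
    rw [h1, h2, h3, indicator_of_mem (Ioo_subset_Ioc_self hx)]

theorem continuous_Theta : Continuous (Theta r) := by
  have h1 : Theta r = fun H : accelerants r => restrictUnit (Mr r) (symExt H.1 -
      embLine (kreinSection (convInjective_right_of_mem_accelerants H.2) 0)) := funext Theta_eq
  rw [h1]
  refine (restrictUnit (Mr r)).continuous.comp ?_
  refine (symExt.continuous.comp continuous_subtype_val).sub (embLine.continuous.comp ?_)
  exact continuous_kreinSection.comp (f := fun H : accelerants r => ((⟨symExt H.1,
    convInjective_right_of_mem_accelerants H.2⟩ : {H : L2Line (Mr r) //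
      ConvInjective (norm_mulRightB_le (A := Mr r)) H}), (0 : UnitI)))
    ((Continuous.subtype_mk (symExt.continuous.comp continuous_subtype_val) _).prodMk
      continuous_const)

end Krein

/-! ### Uniform bounds for inverses over a compact parameter space -/

section UniformBound

variable {V Z : Type*} [NormedAddCommGroup V] [NormedSpace ℂ V] [CompleteSpace V]
  [TopologicalSpace Z] [CompactSpace Z]

/-- The inverse depends continuously on the parameter, so its norm is bounded on a compact space. -/
theorem exists_norm_le_of_bijective {T : Z → V →L[ℂ] V} (hT : Continuous T)
    (hu : ∀ z, Function.Bijective fun v => v + T z v) :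
    ∃ M : ℝ, 0 ≤ M ∧ ∀ z v, ‖v‖ ≤ M * ‖v + T z v‖ := by
  have hc : Continuous fun z => Ring.inverse (1 + T z) := by
    refine continuous_iff_continuousAt.2 fun z => ?_
    obtain ⟨u, hu⟩ := isUnit_one_add_of_bijective (hu z)
    have h1 : ContinuousAt (Ring.inverse : (V →L[ℂ] V) → _) (1 + T z) := by
      rw [← hu]
      exact NormedRing.inverse_continuousAt u
    exact ContinuousAt.comp (f := fun z => 1 + T z) h1 (continuous_const.add hT).continuousAt
  obtain ⟨M, hM⟩ := isCompact_univ.exists_bound_of_continuousOn hc.continuousOn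
  refine ⟨max M 0, le_max_right _ _, fun z v => ?_⟩
  have h1 : Ring.inverse (1 + T z) (v + T z v) = v :=
    DFunLike.congr_fun (Ring.inverse_mul_cancel _ (isUnit_one_add_of_bijective (hu z))) v
  calc ‖v‖ = ‖Ring.inverse (1 + T z) (v + T z v)‖ := by rw [h1]
    _ ≤ ‖Ring.inverse (1 + T z)‖ * ‖v + T z v‖ := ContinuousLinearMap.le_opNorm _ _
    _ ≤ _ := by
      gcongr
      exact (hM z (mem_univ z)).trans (le_max_left _ _)

end UniformBound

/-! ### Local dependence of the kernel on the potential, and uniqueness of the potential -/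

section Injective

variable {A : Type*} [NormedRing A] [NormedAlgebra ℂ A] [CompleteSpace A] [FiniteDimensional ℂ A]

/-- For t in (0,x] the argument t - x lies in (-x,x], so the row at x sees only the part of the
potential there. -/
theorem cut_shift_cut (x : ℝ) (f : L2Line A) :
    cut 0 x (shift x (cut (-x) x f)) = cut 0 x (shift x f) := by
  ext1
  have h0 := (measurePreserving_sub_right (volume : Measure ℝ) x).quasiMeasurePreserving.ae
    (coeFn_cut (-x) x f)
  filter_upwards [coeFn_cut 0 x (shift x (cut (-x) x f)), coeFn_cut 0 x (shift x f),
    coeFn_shift x (cut (-x) x f), coeFn_shift x f, h0] with t h1 h2 h3 h4 h5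
  rw [h1, h2]
  by_cases ht : t ∈ Ioc 0 x
  · have h6 : t - x ∈ Ioc (-x) x := ⟨by linarith [ht.1], by linarith [ht.1, ht.2]⟩
    rw [indicator_of_mem ht, indicator_of_mem ht, h3, h4, h5, indicator_of_mem h6]
  · rw [indicator_of_notMem ht, indicator_of_notMem ht]

theorem convMap_cut_symm (B : A →L[ℂ] A →L[ℂ] A) {x : ℝ} (hx : 0 ≤ x) (H f : L2Line A)
    (t : UnitI) (ht : (t : ℝ) ∈ Ico 0 x) :
    convMap B (cut (-x) x H) (cut 0 x f) t = convMap B H (cut 0 x f) t := by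
  rw [convMap_cut_apply _ hx, convMap_cut_apply _ hx]
  refine intervalIntegral.integral_congr_ae ?_
  filter_upwards [(measurePreserving_sub_right (volume : Measure ℝ) (t : ℝ)).quasiMeasurePreserving.ae
    (coeFn_cut (-x) x H)] with ξ h1 h2
  rw [uIoc_of_le hx] at h2
  have h3 : ξ - t ∈ Ioc (-x) x := ⟨by linarith [ht.2, h2.1], by linarith [ht.1, h2.2]⟩
  rw [h1, indicator_of_mem h3]

theorem cut_kreinRow (H : L2Line A) (x : ℝ) : cut 0 x (kreinRow H x) = kreinRow H x := by
  rw [kreinRow, cut_cut, max_self, min_self]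

/-- The Krein kernels of two potentials differ on `(0, x)` by at most a constant times the
difference of the potentials on `(-x, x)`. -/
theorem exists_norm_kreinC_sub_le {H K : L2Line A}
    (hH : ConvInjective (norm_mulRightB_le (A := A)) H)
    (hK : ConvInjective (norm_mulRightB_le (A := A)) K) :
    ∃ M : ℝ, 0 ≤ M ∧ ∀ x ∈ Ioc (0 : ℝ) 1,
      ‖kreinC H x 0 - kreinC K x 0‖ ≤ M * ‖cut (-x) x (H - K)‖ := by
  obtain ⟨M, hM0, hM⟩ := exists_norm_le_of_bijective
    (T := fun x : UnitI => convOp (norm_mulRightB_le (A := A)) x H)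
    ((continuous_convOp (norm_mulRightB_le (A := A))).comp
      (f := fun x : UnitI => ((x : ℝ), H)) (by fun_prop)) fun x => hH.bijective x.2
  obtain ⟨C, hC⟩ := isCompact_univ.exists_bound_of_continuousOn
    (continuous_kreinC_right hK).continuousOn
  set N := |C| + ‖K‖ with hN
  have hN0 : 0 ≤ N := by positivity
  -- `N` bounds the rows for K and `M` the inverses of 1 + 𝓗_x. The first term estimates the
  -- convolution of H with the difference of the rows, the second that of H - K with the row for K.
  refine ⟨‖H‖ * ((1 + M * ‖H‖) * (1 + N)) + N, by positivity, fun x hx => ?_⟩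
  have hx1 : x ∈ Icc (0 : ℝ) 1 := ⟨hx.1.le, hx.2⟩
  set r := kreinRow H x
  set s := kreinRow K x with hs
  set d := r - s with hd
  set Δ := cut (-x) x (H - K) with hΔ
  have hsN : ‖s‖ ≤ N := by
    refine (norm_cut_le _ _ _).trans ((norm_sub_le _ _).trans ?_)
    rw [LinearIsometry.norm_map]
    refine add_le_add ?_ le_rfl
    exact (norm_embLine_le _).trans ((hC ⟨x, hx1⟩ (mem_univ _)).trans (le_abs_self C))
  have hr1 : r + cut 0 x (embLine (convMap (mulRightB A) H r)) = -cut 0 x (shift x H) :=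
    isKreinRow_kreinRow hH hx1
  have hs1 : s + cut 0 x (embLine (convMap (mulRightB A) K s)) = -cut 0 x (shift x K) :=
    isKreinRow_kreinRow hK hx1
  have hsub : ∀ t : UnitI, (t : ℝ) ∈ Ico 0 x →
      convMap (mulRightB A) (H - K) s t = convMap (mulRightB A) Δ s t := fun t ht => by
    rw [hs, ← cut_kreinRow K x, hΔ, convMap_cut_symm _ hx.1.le _ _ t ht]
  have hcut : cut 0 x (embLine (convMap (mulRightB A) (H - K) s)) =
      cut 0 x (embLine (convMap (mulRightB A) Δ s)) := by
    ext1
    filter_upwards [coeFn_cut_embLine (a := 0) le_rfl hx.2 (convMap (mulRightB A) (H - K) s),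
      coeFn_cut_embLine (a := 0) le_rfl hx.2 (convMap (mulRightB A) Δ s),
      (Ioo_ae_eq_Ioc (μ := volume) (a := (0 : ℝ)) (b := x)).mem_iff] with t h1 h2 h3
    rw [h1, h2]
    by_cases ht : t ∈ Ioc 0 x
    · have ht1 : t ∈ Icc (0 : ℝ) 1 := ⟨ht.1.le, ht.2.trans hx.2⟩
      rw [indicator_of_mem ht, indicator_of_mem ht, IccExtend_of_mem _ _ ht1,
        IccExtend_of_mem _ _ ht1]
      exact hsub _ ⟨ht.1.le, (h3.2 ht).2⟩
    · rw [indicator_of_notMem ht, indicator_of_notMem ht]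
  -- Subtracting the two row equations leaves the equation of H for the difference of the rows, with
  -- a right-hand side linear in Δ.
  have heq : d + cut 0 x (embLine (convMap (mulRightB A) H d)) =
      -cut 0 x (shift x Δ) - cut 0 x (embLine (convMap (mulRightB A) Δ s)) := by
    rw [← hcut, hΔ, cut_shift_cut, hd, convMap_sub_right, convMap_sub_left, map_sub, map_sub,
      map_sub, map_sub, map_sub, map_sub]
    have h1 := congrArg₂ (· - ·) hr1 hs1
    rw [← sub_eq_zero] at h1 ⊢
    rw [← h1]
    abel
  set g := -cut 0 x (shift x Δ) - cut 0 x (embLine (convMap (mulRightB A) Δ s)) with hg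
  have hgn : ‖g‖ ≤ (1 + N) * ‖Δ‖ := by
    refine (norm_sub_le _ _).trans ?_
    rw [norm_neg, add_mul, one_mul]
    refine add_le_add ((norm_cut_le _ _ _).trans_eq (LinearIsometry.norm_map _ _)) ?_
    refine (norm_cut_le _ _ _).trans ((norm_embLine_le _).trans
      ((norm_convMap_le norm_mulRightB_le _ _).trans ?_))
    rw [mul_comm]
    gcongr
  have hcn : ‖convMap (mulRightB A) H d‖ ≤ M * (‖H‖ * ‖g‖) := by
    refine (hM ⟨x, hx1⟩ (convMap (mulRightB A) H d)).trans ?_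
    rw [convOp_apply, ← convMap_add_right, heq]
    gcongr
    exact norm_convMap_le norm_mulRightB_le _ _
  have hdn : ‖d‖ ≤ (1 + M * ‖H‖) * ((1 + N) * ‖Δ‖) := by
    have h1 : d = g - cut 0 x (embLine (convMap (mulRightB A) H d)) := by rw [← heq]; abel
    calc ‖d‖ = ‖g - cut 0 x (embLine (convMap (mulRightB A) H d))‖ := by rw [← h1]
      _ ≤ ‖g‖ + M * (‖H‖ * ‖g‖) := (norm_sub_le _ _).trans (add_le_add le_rfl
          ((norm_cut_le _ _ _).trans ((norm_embLine_le _).trans hcn)))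
      _ = (1 + M * ‖H‖) * ‖g‖ := by ring
      _ ≤ _ := by gcongr
  have hfin : kreinC H x 0 - kreinC K x 0 =
      -(convMap (mulRightB A) H d 0 + convMap (mulRightB A) Δ s 0) := by
    rw [← hsub 0 ⟨le_rfl, hx.1⟩, kreinC_eq hH hx1, kreinC_eq hK hx1, hd, convMap_sub_right,
      convMap_sub_left]
    simp only [ContinuousMap.neg_apply, ContinuousMap.sub_apply]
    abel
  rw [hfin, norm_neg]
  refine (norm_add_le _ _).trans ?_
  rw [add_mul]
  refine add_le_add ?_ ?_
  · refine ((ContinuousMap.norm_coe_le_norm _ _).trans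
      (norm_convMap_le norm_mulRightB_le _ _)).trans ?_
    rw [mul_assoc, mul_assoc]
    gcongr
  · refine ((ContinuousMap.norm_coe_le_norm _ _).trans
      (norm_convMap_le norm_mulRightB_le _ _)).trans ?_
    rw [mul_comm]
    gcongr

/-- The hypothesis gives Δ(x) = c_H(x,0) - c_K(x,0), so ‖Δ(x)‖ ≤ M ‖Δ‖ with the L_2 norm over
(-x,x). With u(x) the square of that norm, evenness gives u(x) = 2∫_0^x ‖Δ‖² ≤ 2M² ∫_0^x u, and
Grönwall applies. -/
theorem cut_sub_eq_zero_of_kreinSection_eq {H K : L2Line A} (hHE : IsEven H) (hKE : IsEven K)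
    (hH : ConvInjective (norm_mulRightB_le (A := A)) H)
    (hK : ConvInjective (norm_mulRightB_le (A := A)) K)
    (h : ∀ᵐ x ∂volUnit, (H - embLine (kreinSection hH 0)) x = (K - embLine (kreinSection hK 0)) x) :
    cut (-1) 1 (H - K) = 0 := by
  obtain ⟨M, hM0, hM⟩ := exists_norm_kreinC_sub_le hH hK
  set Δ := H - K with hΔ
  have hΔE : ∀ᵐ x : ℝ, Δ (-x) = Δ x := by
    filter_upwards [hHE, hKE, Lp.coeFn_sub H K,
      (Measure.measurePreserving_neg (volume : Measure ℝ)).quasiMeasurePreserving.ae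
        (Lp.coeFn_sub H K)] with x h1 h2 h3 h4
    rw [hΔ, h3, h4, Pi.sub_apply, Pi.sub_apply, h1, h2]
  have hΔx : ∀ᵐ x : ℝ, x ∈ Ioo (0 : ℝ) 1 → ‖Δ x‖ ≤ M * ‖cut (-x) x Δ‖ := by
    filter_upwards [(ae_restrict_iff' measurableSet_Ioo).1 h, Lp.coeFn_sub H K,
      Lp.coeFn_sub H (embLine (kreinSection hH 0)), Lp.coeFn_sub K (embLine (kreinSection hK 0)),
      coeFn_embLine (kreinSection hH 0), coeFn_embLine (kreinSection hK 0)]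
      with x h1 h2 h3 h4 h5 h6 hx
    have hx1 : x ∈ Ioc (0 : ℝ) 1 := Ioo_subset_Ioc_self hx
    refine le_trans (le_of_eq ?_) (hM x hx1)
    have h7 := h1 hx
    rw [h3, h4, Pi.sub_apply, Pi.sub_apply, h5, h6, indicator_of_mem hx1, indicator_of_mem hx1,
      IccExtend_of_mem _ _ (Ioc_subset_Icc_self hx1),
      IccExtend_of_mem _ _ (Ioc_subset_Icc_self hx1), sub_eq_sub_iff_sub_eq_sub] at h7
    rw [hΔ, h2, Pi.sub_apply, h7]
    rfl
  set u : ℝ → ℝ := fun x => ‖cut (-x) x Δ‖ ^ 2 with hu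
  have huc : Continuous u := by
    refine Continuous.pow (Continuous.norm ?_) 2
    exact continuous_cut.comp (f := fun x : ℝ => (Δ, (-x, x))) (by fun_prop)
  have hint : ∀ a b : ℝ, IntervalIntegrable (fun x => ‖Δ x‖ ^ 2) volume a b := fun a b =>
    ((Lp.memLp Δ).integrable_norm_pow two_ne_zero).intervalIntegrable
  have hle : ∀ x ∈ Icc (0 : ℝ) 1, u x ≤ (2 * M ^ 2) * ∫ t in (0 : ℝ)..x, u t := by
    intro x hx
    have h1 : ∫ t in (-x)..(0 : ℝ), ‖Δ t‖ ^ 2 = ∫ t in (0 : ℝ)..x, ‖Δ t‖ ^ 2 := by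
      have h2 := intervalIntegral.integral_comp_neg (a := 0) (b := x) fun t => ‖Δ t‖ ^ 2
      rw [neg_zero] at h2
      rw [← h2]
      refine intervalIntegral.integral_congr_ae ?_
      filter_upwards [hΔE] with t ht _
      rw [ht]
    have h3 : ∫ t in (0 : ℝ)..x, ‖Δ t‖ ^ 2 ≤ ∫ t in (0 : ℝ)..x, M ^ 2 * u t := by
      refine intervalIntegral.integral_mono_ae_restrict hx.1 (hint _ _)
        (Continuous.intervalIntegrable (by fun_prop) _ _) ?_
      rw [← restrict_Ioo_eq_restrict_Icc, EventuallyLE, ae_restrict_iff' measurableSet_Ioo]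
      filter_upwards [hΔx] with t ht h4
      rw [← mul_pow]
      exact pow_le_pow_left₀ (norm_nonneg _) (ht ⟨h4.1, h4.2.trans_le hx.2⟩) 2
    rw [intervalIntegral.integral_const_mul] at h3
    rw [hu]
    simp only
    rw [norm_cut_sq (by linarith [hx.1]), ← intervalIntegral.integral_add_adjacent_intervals
      (hint (-x) 0) (hint 0 x), h1]
    linarith
  have h1 := eq_zero_of_le_mul_integral (by positivity) huc.continuousOn
    (fun x _ => sq_nonneg _) hle 1 ⟨zero_le_one, le_rfl⟩
  exact norm_eq_zero.1 (pow_eq_zero_iff two_ne_zero |>.1 h1)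

end Injective

/-! ### Injectivity of Θ -/

section ThetaInjective

variable {r : ℕ}

theorem Theta_injective : Function.Injective (Theta r) := by
  intro H K h
  have hH := convInjective_right_of_mem_accelerants H.2
  have hK := convInjective_right_of_mem_accelerants K.2
  rw [Theta_eq, Theta_eq] at h
  have h1 := cut_sub_eq_zero_of_kreinSection_eq ((isEven_symExt_iff H.1).2 H.2.1)
    ((isEven_symExt_iff K.1).2 K.2.1) hH hK (by
      filter_upwards [coeFn_restrictUnit (symExt H.1 - embLine (kreinSection hH 0)),
        coeFn_restrictUnit (symExt K.1 - embLine (kreinSection hK 0))] with x h1 h2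
      rw [← h1, ← h2, h])
  refine Subtype.ext (Lp.ext ?_)
  rw [EventuallyEq, ae_restrict_iff' measurableSet_Ioo]
  filter_upwards [symExt_ae H.1, symExt_ae K.1, coeFn_cut (-1) 1 (symExt H.1 - symExt K.1),
    Lp.coeFn_sub (symExt H.1) (symExt K.1), Lp.coeFn_zero (Mr r) 2 volume] with x h2 h3 h4 h5 h6 hx
  rw [h1, h6, indicator_of_mem (Ioo_subset_Ioc_self hx), h5, Pi.sub_apply, h2 hx, h3 hx] at h4
  exact (sub_eq_zero.1 h4.symm)

end ThetaInjective

/-! ### Reflections on L_2(ℝ) -/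

section Reflect

variable {E : Type*} [NormedAddCommGroup E] [NormedSpace ℂ E]

/-- The reflection `f ↦ f (x - ·)` on `L_2(ℝ, E)`. -/
noncomputable def reflect (x : ℝ) : L2Line E →ₗᵢ[ℂ] L2Line E :=
  (shift x).comp (Lp.compMeasurePreservingₗᵢ ℂ (fun x : ℝ => -x)
    (Measure.measurePreserving_neg volume))

theorem coeFn_reflect (x : ℝ) (f : L2Line E) : reflect x f =ᵐ[volume] fun t => f (x - t) := by
  have h1 := Lp.coeFn_compMeasurePreserving f (Measure.measurePreserving_neg (volume : Measure ℝ))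
  filter_upwards [coeFn_shift x (Lp.compMeasurePreserving (fun x : ℝ => -x)
    (Measure.measurePreserving_neg volume) f),
    (measurePreserving_sub_right (volume : Measure ℝ) x).quasiMeasurePreserving.ae h1]
    with t h2 h3
  refine h2.trans (h3.trans ?_)
  rw [Function.comp_apply, neg_sub]

theorem continuous_reflect : Continuous fun p : L2Line E × ℝ => reflect p.2 p.1 :=
  continuous_shift.comp (f := fun p : L2Line E × ℝ => (Lp.compMeasurePreservingₗᵢ ℂ
    (fun x : ℝ => -x) (Measure.measurePreserving_neg volume) p.1, p.2))
    (((LinearIsometry.continuous _).comp continuous_fst).prodMk continuous_snd)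

theorem cut_reflect (x : ℝ) (f : L2Line E) : cut 0 x (reflect x f) = reflect x (cut 0 x f) := by
  ext1
  have h0 := (quasiMeasurePreserving_sub_left_of_right_invariant (volume : Measure ℝ) x).ae
    (coeFn_cut 0 x f)
  have hne : ∀ᵐ t : ℝ, t ≠ 0 ∧ t ≠ x := by
    rw [eventually_and]
    constructor <;> simp [ae_iff]
  filter_upwards [coeFn_cut 0 x (reflect x f), coeFn_reflect x f, coeFn_reflect x (cut 0 x f), h0,
    hne] with t h1 h2 h3 h4 h5
  rw [h1, h3, h4]
  by_cases ht : t ∈ Ioc 0 x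
  · have h6 : x - t ∈ Ioc 0 x := ⟨sub_pos.2 (lt_of_le_of_ne ht.2 h5.2), by linarith [ht.1]⟩
    rw [indicator_of_mem ht, indicator_of_mem h6, h2]
  · have h6 : x - t ∉ Ioc 0 x := fun h => ht ⟨lt_of_le_of_ne (by linarith [h.2]) h5.1.symm,
      by linarith [h.1]⟩
    rw [indicator_of_notMem ht, indicator_of_notMem h6]

end Reflect

/-! ### Adjoints -/

section Star

variable {A : Type*} [NormedRing A] [NormedAlgebra ℂ A] [CompleteSpace A]

/-- Substitution ξ ↦ x - ξ together with evenness of H. -/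
theorem convMap_reflect (B : A →L[ℂ] A →L[ℂ] A) {H : L2Line A} (hH : IsEven H) (f : L2Line A)
    {x : ℝ} {s t : UnitI} (hst : (s : ℝ) = x - t) :
    convMap B H (reflect x f) t = convMap B H f s := by
  rw [convMap_apply_eq_integral, convMap_apply_eq_integral,
    ← integral_sub_left_eq_self (fun ξ => B (H (ξ - s)) (f ξ)) volume x]
  refine integral_congr_ae ?_
  filter_upwards [coeFn_reflect x f, hH.shift_eq (t : ℝ)] with ξ h1 h2
  rw [h1, h2, hst]
  congr 3
  ring

variable [StarRing A] [NormedStarGroup A] [StarModule ℂ A]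

theorem L2Line_star_add (f g : L2Line A) : star (f + g) = star f + star g := by
  ext1
  filter_upwards [Lp.coeFn_star (f + g), Lp.coeFn_star f, Lp.coeFn_star g, Lp.coeFn_add f g,
    Lp.coeFn_add (star f) (star g)] with x h1 h2 h3 h4 h5
  rw [h1, h5, Pi.star_apply, h4, Pi.add_apply, Pi.add_apply, star_add, h2, h3]
  rfl

theorem L2Line_star_neg (f : L2Line A) : star (-f) = -star f := by
  ext1
  filter_upwards [Lp.coeFn_star (-f), Lp.coeFn_star f, Lp.coeFn_neg f, Lp.coeFn_neg (star f)]
    with x h1 h2 h3 h4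
  rw [h1, h4, Pi.star_apply, h3, Pi.neg_apply, Pi.neg_apply, star_neg, h2]
  rfl

theorem L2Line_star_sub (f g : L2Line A) : star (f - g) = star f - star g := by
  rw [sub_eq_add_neg, L2Line_star_add, L2Line_star_neg, sub_eq_add_neg]

theorem star_pairing_mulRightB (f g : L2Line A) :
    star (pairing (mulRightB A) f g) = pairing (mulLeftB A) (star f) (star g) := by
  have h1 := (starL' ℝ : A ≃L[ℝ] A).integral_comp_comm
    (μ := volume) (fun ξ => mulRightB A (f ξ) (g ξ))
  refine h1.symm.trans (integral_congr_ae ?_)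
  filter_upwards [Lp.coeFn_star f, Lp.coeFn_star g] with ξ h2 h3
  rw [h2, h3]
  exact star_mul (g ξ) (f ξ)

theorem star_pairing_mulLeftB (f g : L2Line A) :
    star (pairing (mulLeftB A) f g) = pairing (mulRightB A) (star f) (star g) := by
  rw [← pairing_mulRightB, star_pairing_mulRightB, pairing_mulRightB]

theorem shift_star (t : ℝ) (f : L2Line A) : shift t (star f) = star (shift t f) := by
  ext1
  filter_upwards [coeFn_shift t (star f), coeFn_shift t f, Lp.coeFn_star (shift t f),
    (measurePreserving_sub_right (volume : Measure ℝ) t).quasiMeasurePreserving.ae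
      (Lp.coeFn_star f)] with x h1 h2 h3 h4
  rw [h1, h3, h4, Pi.star_apply, Pi.star_apply, h2]

theorem cut_star (a b : ℝ) (f : L2Line A) : cut a b (star f) = star (cut a b f) := by
  ext1
  filter_upwards [coeFn_cut a b (star f), coeFn_cut a b f, Lp.coeFn_star (cut a b f),
    Lp.coeFn_star f] with x h1 h2 h3 h4
  rw [h1, h3, Pi.star_apply, h2]
  by_cases hx : x ∈ Ioc a b
  · rw [indicator_of_mem hx, indicator_of_mem hx, h4, Pi.star_apply]
  · rw [indicator_of_notMem hx, indicator_of_notMem hx, star_zero]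

theorem embLine_star (f : C(UnitI, A)) : embLine (star f) = star (embLine f) := by
  ext1
  filter_upwards [coeFn_embLine f, coeFn_embLine (star f), Lp.coeFn_star (embLine f)]
    with x h1 h2 h3
  rw [h2, h3, Pi.star_apply, h1]
  by_cases hx : x ∈ Ioc (0 : ℝ) 1
  · rw [indicator_of_mem hx, indicator_of_mem hx]
    rfl
  · rw [indicator_of_notMem hx, indicator_of_notMem hx, star_zero]

theorem convMap_star (H f : L2Line A) :
    convMap (mulRightB A) (star H) (star f) = star (convMap (mulLeftB A) H f) :=
  ContinuousMap.ext fun t => by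
    rw [convMap_apply, shift_star, ← star_pairing_mulLeftB]
    rfl

/-- Taking adjoints reverses products and so exchanges the left and right equations. -/
theorem ConvInjective.star_left {H : L2Line A}
    (h : ConvInjective (norm_mulRightB_le (A := A)) H) :
    ConvInjective (norm_mulLeftB_le (A := A)) (star H) := by
  intro a ha F hF
  have h1 := congrArg star hF
  rw [star_add, star_zero, convOp_apply, ← convMap_star, star_star, ← cut_star, ← embLine_star,
    ← convOp_apply norm_mulRightB_le] at h1
  exact star_eq_zero.1 (h a ha _ h1)

theorem IsEven.star {H : L2Line A} (h : IsEven H) : IsEven (star H) := by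
  filter_upwards [h, Lp.coeFn_star H,
    (Measure.measurePreserving_neg (volume : Measure ℝ)).quasiMeasurePreserving.ae
      (Lp.coeFn_star H)] with x h1 h2 h3
  rw [h2, h3, Pi.star_apply, Pi.star_apply, h1]

variable [FiniteDimensional ℂ A]

/-- The reflected adjoint row solves the transposed Krein equation. -/
theorem reflect_star_kreinRow {H : L2Line A} (hE : IsEven H)
    (hS : ConvInjective (norm_mulRightB_le (A := A)) (star H)) {x : ℝ} (hx : x ∈ Icc (0 : ℝ) 1) :
    reflect x (star (kreinRow (star H) x)) + cut 0 x (embLine (convMap (mulLeftB A) H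
      (reflect x (star (kreinRow (star H) x))))) = -cut 0 x H := by
  set s := kreinRow (star H) x
  have h1 : s + cut 0 x (embLine (convMap (mulRightB A) (star H) s)) =
    -cut 0 x (shift x (star H)) := isKreinRow_kreinRow hS hx
  have h2 := congrArg (fun f => reflect x (star f)) h1
  have h3 : convMap (mulRightB A) (star H) s = star (convMap (mulLeftB A) H (star s)) := by
    rw [← convMap_star, star_star]
  beta_reduce at h2
  rw [h3, shift_star, embLine_star, cut_star, cut_star, L2Line_star_add,
    L2Line_star_neg, star_star, star_star,
    map_add, map_neg, ← cut_reflect, ← cut_reflect] at h2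
  have h4 : cut 0 x (reflect x (shift x H)) = cut 0 x H := by
    congr 1
    ext1
    filter_upwards [coeFn_reflect x (shift x H), hE,
      (quasiMeasurePreserving_sub_left_of_right_invariant (volume : Measure ℝ) x).ae
        (coeFn_shift x H)] with t h5 h6 h7
    rw [h5, h7, ← h6]
    congr 1
    ring
  have h5 : cut 0 x (embLine (convMap (mulLeftB A) H (reflect x (star s)))) =
      cut 0 x (reflect x (embLine (convMap (mulLeftB A) H (star s)))) := by
    ext1
    filter_upwards [coeFn_cut_embLine (a := 0) le_rfl hx.2
      (convMap (mulLeftB A) H (reflect x (star s))),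
      coeFn_cut 0 x (reflect x (embLine (convMap (mulLeftB A) H (star s)))),
      coeFn_reflect x (embLine (convMap (mulLeftB A) H (star s))),
      (quasiMeasurePreserving_sub_left_of_right_invariant (volume : Measure ℝ) x).ae
        (coeFn_embLine (convMap (mulLeftB A) H (star s))),
      (Ioo_ae_eq_Ioc (μ := volume) (a := (0 : ℝ)) (b := x)).mem_iff] with t g1 g2 g3 g4 g5
    rw [g1, g2]
    by_cases ht : t ∈ Ioc 0 x
    · have ht1 : t ∈ Icc (0 : ℝ) 1 := ⟨ht.1.le, ht.2.trans hx.2⟩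
      have ht2 : x - t ∈ Ioc (0 : ℝ) 1 := ⟨sub_pos.2 (g5.2 ht).2, by linarith [ht.1, hx.2]⟩
      rw [indicator_of_mem ht, indicator_of_mem ht, g3, g4, indicator_of_mem ht2,
        IccExtend_of_mem _ _ ht1, IccExtend_of_mem _ _ (Ioc_subset_Icc_self ht2)]
      exact convMap_reflect _ hE _ rfl
    · rw [indicator_of_notMem ht, indicator_of_notMem ht]
  rw [h5, h2, h4]

/-- Here r solves the right-hand equation with source -H(x - ·) and l the left-hand equation with
source -H. Pairing each equation with the other solution and using transposition gives ∫ H(x - ξ)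
l(ξ) dξ = ∫ r H, and these integrals are, up to sign and adjoint, the two values at t = 0. -/
theorem kreinC_star_apply_zero {H : L2Line A} (hE : IsEven H)
    (hH : ConvInjective (norm_mulRightB_le (A := A)) H)
    (hS : ConvInjective (norm_mulRightB_le (A := A)) (star H)) {x : ℝ} (hx : x ∈ Icc (0 : ℝ) 1) :
    kreinC (star H) x 0 = star (kreinC H x 0) := by
  set s := kreinRow (star H) x with hs
  set r := kreinRow H x with hr
  set l := reflect x (star s) with hl
  have hr1 : r + cut 0 x (embLine (convMap (mulRightB A) H r)) = -cut 0 x (shift x H) :=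
    isKreinRow_kreinRow hH hx
  have hl1 : l + cut 0 x (embLine (convMap (mulLeftB A) H l)) = -cut 0 x H :=
    reflect_star_kreinRow hE hS hx
  have hrx : cut 0 x r = r := cut_kreinRow H x
  have hlx : cut 0 x l = l := by rw [hl, cut_reflect, cut_star, hs, cut_kreinRow]
  have h01 : ∀ f : L2Line A, cut 0 x f = f → cut 0 1 f = f := fun f hf => by
    rw [← hf, cut_cut, max_self, min_eq_right hx.2]
  have h0 : ∀ f : L2Line A, shift ((0 : UnitI) : ℝ) f = f := fun f => by
    ext1
    filter_upwards [coeFn_shift ((0 : UnitI) : ℝ) f] with t ht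
    rw [ht]
    simp
  have hP := pairing_convMap_comm hE r l
  rw [h01 r hrx, h01 l hlx] at hP
  have hA : pairing (mulLeftB A) (shift x H) l = pairing (mulLeftB A) r H := by
    have g1 : pairing (mulLeftB A) (shift x H) l = -(pairing (mulLeftB A) r l +
        pairing (mulLeftB A) (embLine (convMap (mulRightB A) H r)) l) := by
      rw [← hlx, ← pairing_cut_comm, ← neg_neg (cut 0 x (shift x H)), ← hr1, pairing_neg_left,
        pairing_add_left, pairing_cut_comm, hlx]
    have g2 : pairing (mulLeftB A) r H = -(pairing (mulLeftB A) r l +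
        pairing (mulLeftB A) r (embLine (convMap (mulLeftB A) H l))) := by
      rw [← hrx, pairing_cut_comm, ← neg_neg (cut 0 x H), ← hl1, pairing_neg_right,
        pairing_add_right, ← pairing_cut_comm, hrx]
    rw [g1, g2, hP]
  have h1 : kreinC H x 0 = -pairing (mulLeftB A) r H := by
    rw [kreinC_eq hH hx, ContinuousMap.neg_apply, convMap_apply, h0, pairing_mulRightB]
  have h2 : kreinC (star H) x 0 = -star (pairing (mulLeftB A) (shift x H) l) := by
    have g1 : convMap (mulLeftB A) H (star s) 0 = pairing (mulLeftB A) (shift x H) l :=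
      (convMap_reflect (mulLeftB A) hE (star s) (x := x) (s := 0) (t := ⟨x, hx⟩)
        (by simp)).symm
    rw [kreinC_eq hS hx, ContinuousMap.neg_apply, ← g1, ← hs, ← star_star s, convMap_star,
      star_star]
    rfl
  rw [h1, h2, hA, star_neg]

end Star

/-! ### Compatibility of Θ with adjoints -/

section ThetaStar

variable {r : ℕ}

theorem symExt_star (H : L2Sym r) : symExt (star H) = star (symExt H) := by
  ext1
  have h0 := (ae_restrict_iff' measurableSet_Ioo).1 (Lp.coeFn_star H)
  filter_upwards [coeFn_extendZero (Ioo (-1 : ℝ) 1) measurableSet_Ioo H,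
    coeFn_extendZero (Ioo (-1 : ℝ) 1) measurableSet_Ioo (star H), Lp.coeFn_star (symExt H), h0]
    with x h1 h2 h3 h4
  refine h2.trans (Eq.trans ?_ (h3.trans (congrArg star h1)).symm)
  by_cases hx : x ∈ Ioo (-1 : ℝ) 1
  · rw [indicator_of_mem hx, indicator_of_mem hx, h4 hx, Pi.star_apply]
  · rw [indicator_of_notMem hx, indicator_of_notMem hx, star_zero]

theorem star_mem_accelerants {H : L2Sym r} (hH : H ∈ accelerants r) : star H ∈ accelerants r := by
  refine mem_accelerants_of_convInjective ?_ ?_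
  · rw [symExt_star]
    exact ((isEven_symExt_iff H).2 hH.1).star
  · rw [symExt_star]
    exact (convInjective_right_of_mem_accelerants hH).star_left

theorem Theta_star (H : accelerants r) :
    Theta r ⟨star H.1, star_mem_accelerants H.2⟩ = star (Theta r H) := by
  have hH := convInjective_right_of_mem_accelerants H.2
  have hS := convInjective_right_of_mem_accelerants (star_mem_accelerants H.2)
  have hE := (isEven_symExt_iff H.1).2 H.2.1
  have hS' : ConvInjective (norm_mulRightB_le (A := Mr r)) (star (symExt H.1)) := by
    rwa [← symExt_star]
  have h1 : kreinSection hS 0 = star (kreinSection hH 0) := ContinuousMap.ext fun x => by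
    change kreinC (symExt (star H.1)) x 0 = star (kreinC (symExt H.1) x 0)
    rw [symExt_star, kreinC_star_apply_zero hE hH hS' x.2]
  rw [Theta_eq, Theta_eq]
  change restrictUnit (Mr r) (symExt (star H.1) - embLine (kreinSection hS 0)) = _
  rw [h1, symExt_star, embLine_star, ← L2Line_star_sub]
  ext1
  set f := symExt H.1 - embLine (kreinSection hH 0)
  filter_upwards [coeFn_restrictUnit (star f), coeFn_restrictUnit f,
    Lp.coeFn_star (restrictUnit (Mr r) f), ae_restrict_of_ae (Lp.coeFn_star f)] with x g1 g2 g3 g4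
  rw [g1, g3, g4, Pi.star_apply, Pi.star_apply, g2]

end ThetaStar

/-! ### Construction of a kernel and a potential from ρ -/

section InverseKernel

variable {A : Type*} [NormedRing A] [NormedAlgebra ℂ A] [CompleteSpace A]

/-- The map `((x, y), s) ↦ (s, s - y)`. -/
noncomputable def diagonalVar : C((UnitI × UnitI) × UnitI, UnitI × UnitI) :=
  ⟨fun p => (p.2, projIcc 0 1 zero_le_one ((p.2 : ℝ) - p.1.2)),
    continuous_snd.prodMk (continuous_projIcc.comp (by fun_prop))⟩

/-- The family `(x, y) ↦ 1_{(y, x]} ρ`. -/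
noncomputable def windowKernel (ρ : L2Line A) : C(UnitI × UnitI, L2Line A) :=
  ⟨fun p => cut p.2 p.1 ρ, continuous_cut.comp
    (f := fun p : UnitI × UnitI => (ρ, ((p.2 : ℝ), (p.1 : ℝ)))) (by fun_prop)⟩

/-- The function `(x, y) ↦ ∫_y^x ρ(s) ρ(s - y) ds`. -/
noncomputable def windowSource (ρ : L2Line A) : C(UnitI × UnitI, A) :=
  pairFamily (mulLeftB A) (windowKernel ρ)
    ⟨fun p => shift p.2 ρ, continuous_shift.comp
      (f := fun p : UnitI × UnitI => (ρ, (p.2 : ℝ))) (by fun_prop)⟩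

theorem continuous_windowKernel : Continuous (windowKernel (A := A)) := by
  refine ContinuousMap.continuous_of_continuous_uncurry _ ?_
  exact continuous_cut.comp
    (f := fun q : L2Line A × (UnitI × UnitI) => (q.1, ((q.2.2 : ℝ), (q.2.1 : ℝ)))) (by fun_prop)

theorem continuous_windowSource : Continuous (windowSource (A := A)) := by
  refine ContinuousMap.continuous_of_continuous_uncurry _ ?_
  refine (continuous_pairing (mulLeftB A)).comp
    (f := fun q : L2Line A × (UnitI × UnitI) => (cut (q.2.2 : ℝ) q.2.1 q.1, shift (q.2.2 : ℝ) q.1))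
    (Continuous.prodMk ?_ ?_)
  · exact continuous_cut.comp
      (f := fun q : L2Line A × (UnitI × UnitI) => (q.1, ((q.2.2 : ℝ), (q.2.1 : ℝ)))) (by fun_prop)
  · exact continuous_shift.comp
      (f := fun q : L2Line A × (UnitI × UnitI) => (q.1, (q.2.2 : ℝ))) (by fun_prop)

/-- The operator `f ↦ ∫_y^x ρ(s) f(s, s - y) ds`. -/
noncomputable def windowOp (ρ : L2Line A) : C(UnitI × UnitI, A) →L[ℂ] C(UnitI × UnitI, A) :=
  kernelOp norm_mulLeftB_le diagonalVar (windowKernel ρ)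

/-- Volterra in the first variable alone: integration runs over (y,x] ⊆ (0,x], and the unknown is
sampled at points with first coordinate s. -/
theorem bijective_add_windowOp (ρ : L2Line A) : Function.Bijective fun f => f + windowOp ρ f :=
  bijective_add_kernelOp_of_volterra norm_mulLeftB_le (κ := fun p => p.1) (fun p => p.1.2)
    (fun p => by
      change cut 0 p.1 (cut p.2 p.1 ρ) = cut p.2 p.1 ρ
      rw [cut_cut, max_eq_right p.2.2.1, min_self]) fun _ _ => le_rfl

/-- The solution `β` of `β(x, y) = ∫_y^x ρ(s) (ρ(s - y) - β(s, s - y)) ds`; the function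
`β(x, x - t) - ρ(x - t)` is going to be the Krein kernel of the potential determined by `ρ`. -/
noncomputable def invC (ρ : L2Line A) : C(UnitI × UnitI, A) :=
  solveOneAdd (windowOp ρ) (windowSource ρ)

theorem invC_add_windowOp (ρ : L2Line A) : invC ρ + windowOp ρ (invC ρ) = windowSource ρ :=
  solveOneAdd_spec (bijective_add_windowOp ρ) _

theorem continuous_invC : Continuous (invC (A := A)) :=
  continuous_solveOneAdd
    ((kernelOp norm_mulLeftB_le diagonalVar).continuous.comp continuous_windowKernel)
    continuous_windowSource bijective_add_windowOp

/-- The rows `t ↦ β(x, x - t) - ρ(x - t)` on `(0, x]`. -/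
noncomputable def invRow (ρ : L2Line A) (x : UnitI) : L2Line A :=
  reflect x (cut 0 x (embLine ((invC ρ).curry x) - ρ))

theorem continuous_invRow : Continuous fun p : L2Line A × UnitI => invRow p.1 p.2 := by
  refine continuous_reflect.comp (f := fun p : L2Line A × UnitI =>
    (cut 0 p.2 (embLine ((invC p.1).curry p.2) - p.1), (p.2 : ℝ))) (Continuous.prodMk ?_
      (by fun_prop))
  refine continuous_cut.comp (f := fun p : L2Line A × UnitI =>
    (embLine ((invC p.1).curry p.2) - p.1, ((0 : ℝ), (p.2 : ℝ)))) (Continuous.prodMk ?_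
      (by fun_prop))
  refine (embLine.continuous.comp ?_).sub continuous_fst
  refine ContinuousMap.continuous_of_continuous_uncurry _ ?_
  exact (continuous_invC.comp (f := fun q : (L2Line A × UnitI) × UnitI => q.1.1)
    (by fun_prop)).eval (by fun_prop)

theorem cut_invRow (ρ : L2Line A) (x : UnitI) : cut 0 x (invRow ρ x) = invRow ρ x := by
  rw [invRow, cut_reflect, cut_cut, max_self, min_self]

/-- The rows as a continuous family. -/
noncomputable def invRowMap (ρ : L2Line A) : C(UnitI, L2Line A) :=
  ⟨invRow ρ, continuous_invRow.comp (f := fun x : UnitI => (ρ, x)) (by fun_prop)⟩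

theorem bijective_add_invRowMap (ρ : L2Line A) : Function.Bijective fun f : C(UnitI, A) =>
    f + kernelOp norm_mulLeftB_le secondVar (invRowMap ρ) f :=
  bijective_add_kernelOp_of_volterra norm_mulLeftB_le (κ := fun x => x) (fun x => x.2)
    (cut_invRow ρ) fun _ _ => le_rfl

/-- The function `x ↦ ∫_0^x R(x, ξ) ρ(ξ) dξ`. -/
noncomputable def invSource (ρ : L2Line A) : C(UnitI, A) :=
  pairFamily (mulLeftB A) (invRowMap ρ) (ContinuousMap.const _ ρ)

/-- The solution `h` of `h(x) = -∫_0^x R(x, ξ) (ρ(ξ) + h(ξ)) dξ`. -/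
noncomputable def invH (ρ : L2Line A) : C(UnitI, A) :=
  solveOneAdd (kernelOp norm_mulLeftB_le secondVar (invRowMap ρ)) (-invSource ρ)

theorem invH_apply (ρ : L2Line A) (x : UnitI) :
    invH ρ x = -pairing (mulLeftB A) (invRow ρ x) (ρ + embLine (invH ρ)) := by
  have h1 : invH ρ + kernelOp norm_mulLeftB_le secondVar (invRowMap ρ) (invH ρ) = -invSource ρ :=
    solveOneAdd_spec (bijective_add_invRowMap ρ) _
  have h2 : invH ρ x + pairing (mulLeftB A) (invRow ρ x) (embLine (invH ρ)) =
      -pairing (mulLeftB A) (invRow ρ x) ρ := DFunLike.congr_fun h1 x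
  rw [pairing_add_right, neg_add, ← h2]
  abel

theorem continuous_invH : Continuous (invH (A := A)) := by
  have h1 : Continuous (invRowMap (A := A)) :=
    ContinuousMap.continuous_of_continuous_uncurry _ continuous_invRow
  refine continuous_solveOneAdd ((kernelOp norm_mulLeftB_le secondVar).continuous.comp h1)
    (Continuous.neg ?_) bijective_add_invRowMap
  refine ContinuousMap.continuous_of_continuous_uncurry _ ?_
  exact (continuous_pairing (mulLeftB A)).comp
    (f := fun q : L2Line A × UnitI => (invRow q.1 q.2, q.1))
    (continuous_invRow.prodMk continuous_fst)

/-- The even extension of the restriction of `f` to `(0, 1]`. -/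
noncomputable def evenExt (f : L2Line A) : L2Line A := cut 0 1 f + reflect 0 (cut 0 1 f)

theorem continuous_evenExt : Continuous (evenExt (A := A)) :=
  (cut 0 1).continuous.add ((reflect 0).continuous.comp (cut 0 1).continuous)

theorem coeFn_evenExt (f : L2Line A) : evenExt f =ᵐ[volume] fun x =>
    (Ioc (0 : ℝ) 1).indicator f x + (Ioc (0 : ℝ) 1).indicator f (-x) := by
  filter_upwards [Lp.coeFn_add (cut 0 1 f) (reflect 0 (cut 0 1 f)), coeFn_cut 0 1 f,
    coeFn_reflect 0 (cut 0 1 f),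
    (Measure.measurePreserving_neg (volume : Measure ℝ)).quasiMeasurePreserving.ae
      (coeFn_cut 0 1 f)] with x h1 h2 h3 h4
  rw [evenExt, h1, Pi.add_apply, h2, h3, zero_sub, h4]

theorem isEven_evenExt (f : L2Line A) : IsEven (evenExt f) := by
  filter_upwards [coeFn_evenExt f,
    (Measure.measurePreserving_neg (volume : Measure ℝ)).quasiMeasurePreserving.ae
      (coeFn_evenExt f)] with x h1 h2
  rw [h1, h2, neg_neg, add_comm]

theorem evenExt_ae (f : L2Line A) : ∀ᵐ x : ℝ, x ∈ Ioc (0 : ℝ) 1 → evenExt f x = f x := by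
  filter_upwards [coeFn_evenExt f] with x h1 hx
  rw [h1, indicator_of_mem hx, indicator_of_notMem fun h => by linarith [h.1, hx.1], add_zero]

/-- The potential determined by `ρ`. -/
noncomputable def invPotential (ρ : L2Line A) : L2Line A := evenExt (ρ + embLine (invH ρ))

theorem continuous_invPotential : Continuous (invPotential (A := A)) :=
  continuous_evenExt.comp (continuous_id.add (embLine.continuous.comp continuous_invH))

/-- The kernel `R(x, t)` as a function. -/
noncomputable def invKernel (ρ : L2Line A) (p : ℝ × ℝ) : A :=
  invC ρ (projIcc 0 1 zero_le_one p.1, projIcc 0 1 zero_le_one (p.1 - p.2)) - ρ (p.1 - p.2)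

theorem coeFn_invRow (ρ : L2Line A) (x : UnitI) :
    invRow ρ x =ᵐ[volume] (Ioc (0 : ℝ) x).indicator fun t => invKernel ρ (x, t) := by
  rw [invRow, ← cut_reflect]
  have hq := quasiMeasurePreserving_sub_left_of_right_invariant (volume : Measure ℝ) (x : ℝ)
  filter_upwards [coeFn_cut 0 (x : ℝ) (reflect x (embLine ((invC ρ).curry x) - ρ)),
    coeFn_reflect (x : ℝ) (embLine ((invC ρ).curry x) - ρ),
    hq.ae (Lp.coeFn_sub (embLine ((invC ρ).curry x)) ρ), hq.ae (coeFn_embLine ((invC ρ).curry x)),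
    (Ioo_ae_eq_Ioc (μ := volume) (a := (0 : ℝ)) (b := x)).mem_iff] with t h1 h2 h3 h4 h5
  rw [h1]
  by_cases ht : t ∈ Ioc (0 : ℝ) x
  · have ht1 : (x : ℝ) - t ∈ Ioc (0 : ℝ) 1 :=
      ⟨sub_pos.2 (h5.2 ht).2, by linarith [ht.1, x.2.2]⟩
    rw [indicator_of_mem ht, indicator_of_mem ht, h2, h3, Pi.sub_apply, h4, indicator_of_mem ht1,
      invKernel, projIcc_val]
    rfl
  · rw [indicator_of_notMem ht, indicator_of_notMem ht]

theorem invKernel_ae (ρ : L2Line A) (x y : UnitI) : ∀ᵐ s : ℝ, s ∈ Ioc (y : ℝ) x →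
    invKernel ρ (s, y) = (sample diagonalVar (invC ρ) (x, y) - shift y ρ) s := by
  filter_upwards [Lp.coeFn_sub (sample diagonalVar (invC ρ) (x, y)) (shift (y : ℝ) ρ),
    coeFn_shift (y : ℝ) ρ,
    coeFn_embLine (((invC ρ).comp diagonalVar).curry (x, y))] with s h2 h3 h4 hs
  have hs1 : s ∈ Ioc (0 : ℝ) 1 := ⟨y.2.1.trans_lt hs.1, hs.2.trans x.2.2⟩
  rw [h2, Pi.sub_apply, h3, sample_apply, h4, indicator_of_mem hs1,
    IccExtend_of_mem _ _ (Ioc_subset_Icc_self hs1), invKernel,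
    projIcc_of_mem zero_le_one (Ioc_subset_Icc_self hs1)]
  rfl

/-- The defining equation of `invC` in terms of the kernel. -/
theorem invC_apply (ρ : L2Line A) {x y : UnitI} (hyx : (y : ℝ) ≤ x) :
    invC ρ (x, y) = -∫ s in (y : ℝ)..x, ρ s * invKernel ρ (s, y) := by
  have h1 : invC ρ (x, y) + pairing (mulLeftB A) (cut y x ρ)
      (sample diagonalVar (invC ρ) (x, y)) = pairing (mulLeftB A) (cut y x ρ) (shift y ρ) :=
    DFunLike.congr_fun (invC_add_windowOp ρ) (x, y)
  rw [← eq_sub_iff_add_eq, ← pairing_sub_right, ← neg_sub, pairing_neg_right,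
    pairing_cut_left _ hyx] at h1
  rw [h1]
  congr 1
  refine intervalIntegral.integral_congr_ae ?_
  filter_upwards [invKernel_ae ρ x y] with s h2 hs
  rw [uIoc_of_le hyx] at hs
  rw [h2 hs]
  rfl

theorem integrableOn_mul_invKernel (ρ : L2Line A) (x y : UnitI) :
    IntegrableOn (fun s => ρ s * invKernel ρ (s, y)) (Ioc (y : ℝ) x) volume := by
  refine ((integrable_bilin_L2 (mulLeftB A) ρ (sample diagonalVar (invC ρ) (x, y) -
    shift y ρ)).integrableOn (s := Ioc (y : ℝ) x)).congr ?_
  rw [EventuallyEq, ae_restrict_iff' measurableSet_Ioc]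
  filter_upwards [invKernel_ae ρ x y] with s h2 hs
  rw [h2 hs]
  rfl

end InverseKernel

/-! ### The constructed kernel solves the Krein equation -/

section InverseKrein

variable {A : Type*} [NormedRing A] [NormedAlgebra ℂ A] [CompleteSpace A]

theorem integrable_invKernel_triple (ρ : L2Line A) {f g : L2Line A} (hf : Integrable f volume)
    (hg : Integrable g volume) :
    Integrable (fun p : ℝ × ℝ => f p.1 * (invKernel ρ p * g p.2)) (volume.prod volume) := by
  obtain ⟨C, hC⟩ := isCompact_univ.exists_bound_of_continuousOn (invC ρ).continuous.continuousOn
  set b : ℝ × ℝ → A := fun p =>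
    invC ρ (projIcc 0 1 zero_le_one p.1, projIcc 0 1 zero_le_one (p.1 - p.2)) with hb
  have hbc : Continuous b := (invC ρ).continuous.comp ((continuous_projIcc.comp continuous_fst).prodMk
    (continuous_projIcc.comp (continuous_fst.sub continuous_snd)))
  have h1 : Integrable (fun p : ℝ × ℝ => f p.1 * (b p * g p.2)) (volume.prod volume) := by
    refine ((hf.norm.mul_prod hg.norm).const_mul C).mono' ?_ (Eventually.of_forall fun p => ?_)
    · exact (((Lp.stronglyMeasurable f).comp_measurable measurable_fst).mul
        (hbc.stronglyMeasurable.mul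
          ((Lp.stronglyMeasurable g).comp_measurable measurable_snd))).aestronglyMeasurable
    · refine (norm_mul_le _ _).trans ((mul_le_mul_of_nonneg_left ((norm_mul_le _ _).trans
        (mul_le_mul_of_nonneg_right (hC _ (mem_univ _)) (norm_nonneg _))) (norm_nonneg _)).trans_eq ?_)
      ring
  refine (h1.sub (integrable_triple (f := f) (H := ρ) hg)).congr (Eventually.of_forall fun p => ?_)
  simp only [Pi.sub_apply, invKernel, hb, sub_mul, mul_sub]

/-- The value at `y` of the rows convolved with `H`. -/
noncomputable def invRowConv (ρ H : L2Line A) (y : UnitI) : C(UnitI, A) :=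
  ⟨fun s => convMap (mulRightB A) H (invRow ρ s) y,
    ((continuous_convMap (mulRightB A)).comp (f := fun s : UnitI => (H, invRow ρ s))
      (continuous_const.prodMk (invRowMap ρ).continuous)).eval_const y⟩

/-- Insert β(x,η) = -∫_η^x ρ(s) R(s,η) ds and exchange the integrations over 0 < η ≤ s ≤ x. -/
theorem convMap_cut_invC (ρ H : L2Line A) (x y : UnitI) :
    convMap (mulRightB A) H (cut 0 x (embLine ((invC ρ).curry x))) y =
      -pairing (mulLeftB A) (cut 0 x ρ) (embLine (invRowConv ρ H y)) := by
  set P := cut 0 x ρ with hP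
  set g := cut 0 x (shift y H) with hg
  set Φ : ℝ × ℝ → A := {p : ℝ × ℝ | p.2 ≤ p.1}.indicator
    fun p => P p.1 * (invKernel ρ p * g p.2) with hΦ
  have hΦi : Integrable Φ (volume.prod volume) := by
    exact (integrable_invKernel_triple ρ (integrable_cut _ _ _) (integrable_cut _ _ _)).indicator
      (measurableSet_le measurable_snd measurable_fst)
  have h1 : pairing (mulLeftB A) P (embLine (invRowConv ρ H y)) = ∫ s, ∫ η, Φ (s, η) := by
    refine integral_congr_ae ?_
    filter_upwards [coeFn_cut 0 (x : ℝ) ρ, coeFn_embLine (invRowConv ρ H y)] with s hs1 hs2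
    by_cases hs : s ∈ Ioc (0 : ℝ) x
    · have hs3 : s ∈ Ioc (0 : ℝ) 1 := ⟨hs.1, hs.2.trans x.2.2⟩
      have hs4 : s ∈ Icc (0 : ℝ) 1 := Ioc_subset_Icc_self hs3
      rw [hs2, indicator_of_mem hs3, IccExtend_of_mem _ _ hs4]
      change P s * pairing (mulRightB A) (shift y H) (invRow ρ ⟨s, hs4⟩) = _
      rw [pairing, ← integral_const_mul_of_integrable (integrable_bilin_L2 _ _ _)]
      refine integral_congr_ae ?_
      filter_upwards [coeFn_invRow ρ ⟨s, hs4⟩, coeFn_cut 0 (x : ℝ) (shift y H)] with η h2 h3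
      change P s * (invRow ρ ⟨s, hs4⟩ η * shift y H η) = Φ (s, η)
      rw [h2]
      by_cases hη : η ∈ Ioc 0 s
      · have h4 : (s, η) ∈ {p : ℝ × ℝ | p.2 ≤ p.1} := hη.2
        have h5 : η ∈ Ioc (0 : ℝ) x := ⟨hη.1, hη.2.trans hs.2⟩
        rw [indicator_of_mem hη, hΦ, indicator_of_mem h4, hg, h3, indicator_of_mem h5]
      · rw [indicator_of_notMem hη, zero_mul, mul_zero, hΦ, indicator_apply]
        split_ifs with h4
        · have h5 : η ∉ Ioc (0 : ℝ) x := fun h => hη ⟨h.1, h4⟩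
          rw [hg, h3, indicator_of_notMem h5, mul_zero, mul_zero]
        · rfl
    · have h2 : P s = 0 := by rw [hP, hs1, indicator_of_notMem hs]
      have h3 : ∀ η, Φ (s, η) = 0 := fun η => by
        rw [hΦ, indicator_apply]
        split_ifs
        · rw [h2, zero_mul]
        · rfl
      simp [h2, h3]
  have h2 : convMap (mulRightB A) H (cut 0 x (embLine ((invC ρ).curry x))) y =
      -∫ η, ∫ s, Φ (s, η) := by
    rw [← integral_neg]
    refine integral_congr_ae ?_
    filter_upwards [coeFn_cut_embLine (a := 0) le_rfl x.2.2 ((invC ρ).curry x),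
      coeFn_cut 0 (x : ℝ) (shift y H)] with η h2 h3
    change cut 0 x (embLine ((invC ρ).curry x)) η * shift y H η = _
    rw [h2]
    by_cases hη : η ∈ Ioc (0 : ℝ) x
    · have hη1 : η ∈ Icc (0 : ℝ) 1 := ⟨hη.1.le, hη.2.trans x.2.2⟩
      rw [indicator_of_mem hη, IccExtend_of_mem _ _ hη1]
      change invC ρ (x, ⟨η, hη1⟩) * _ = _
      rw [invC_apply ρ (y := ⟨η, hη1⟩) hη.2, neg_mul, intervalIntegral.integral_of_le hη.2,
        ← integral_mul_const_of_integrable (integrableOn_mul_invKernel ρ x ⟨η, hη1⟩),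
        ← integral_indicator measurableSet_Ioc]
      congr 1
      refine integral_congr_ae ?_
      have hne : ∀ᵐ s : ℝ, s ≠ η := by simp [ae_iff]
      filter_upwards [coeFn_cut 0 (x : ℝ) ρ, hne] with s hs1 hs2
      by_cases hs : s ∈ Ioc η x
      · have h4 : (s, η) ∈ {p : ℝ × ℝ | p.2 ≤ p.1} := hs.1.le
        have h5 : s ∈ Ioc (0 : ℝ) x := ⟨hη.1.trans hs.1, hs.2⟩
        rw [indicator_of_mem hs, hΦ, indicator_of_mem h4, hg, h3, indicator_of_mem hη, hP, hs1,
          indicator_of_mem h5, mul_assoc]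
      · rw [indicator_of_notMem hs, hΦ, indicator_apply]
        split_ifs with h4
        · have h5 : s ∉ Ioc (0 : ℝ) x := fun h => hs ⟨lt_of_le_of_ne h4 hs2.symm, h.2⟩
          rw [hP, hs1, indicator_of_notMem h5, zero_mul]
        · rfl
    · have h4 : g η = 0 := by rw [hg, h3, indicator_of_notMem hη]
      have h5 : ∀ s, Φ (s, η) = 0 := fun s => by
        rw [hΦ, indicator_apply]
        split_ifs
        · rw [h4, mul_zero, mul_zero]
        · rfl
      simp [h5, indicator_of_notMem hη]
  rw [h1, h2, integral_integral_swap (f := fun s η => Φ (s, η)) hΦi]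

/-- Reflection turns the row into β(x,·) - ρ, and the term with β is rewritten by
`convMap_cut_invC`. The result depends on x only through the upper limit of integration. -/
theorem convMap_invRow {H : L2Line A} (hH : IsEven H) (ρ : L2Line A) {x y t : UnitI}
    (ht : (t : ℝ) = x - y) : convMap (mulRightB A) H (invRow ρ x) t =
      -pairing (mulLeftB A) (cut 0 x ρ) (shift y H + embLine (invRowConv ρ H y)) := by
  rw [invRow, convMap_reflect (mulRightB A) hH _ (s := y) (t := t) (by rw [ht]; ring), map_sub,
    convMap_sub_right, ContinuousMap.sub_apply, convMap_cut_invC, convMap_apply,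
    pairing_mulRightB, pairing_add_right]
  abel

theorem shift_zero_apply (f : L2Line A) : shift ((0 : UnitI) : ℝ) f = f := by
  ext1
  filter_upwards [coeFn_shift ((0 : UnitI) : ℝ) f] with t ht
  rw [ht]
  simp

theorem cut_evenExt (f : L2Line A) {x : ℝ} (hx : x ≤ 1) : cut 0 x (evenExt f) = cut 0 x f := by
  ext1
  filter_upwards [coeFn_cut 0 x (evenExt f), coeFn_cut 0 x f, evenExt_ae f] with t h1 h2 h3
  rw [h1, h2]
  by_cases ht : t ∈ Ioc 0 x
  · rw [indicator_of_mem ht, indicator_of_mem ht, h3 ⟨ht.1, ht.2.trans hx⟩]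
  · rw [indicator_of_notMem ht, indicator_of_notMem ht]

/-- This is what the equation for h was designed for: the Krein equation at t = 0. -/
theorem convMap_invRow_zero (ρ : L2Line A) (x : UnitI) :
    convMap (mulRightB A) (invPotential ρ) (invRow ρ x) 0 = -invH ρ x := by
  rw [invH_apply, neg_neg, convMap_apply, pairing_mulRightB, shift_zero_apply, ← cut_invRow,
    pairing_cut_comm, invPotential, cut_evenExt _ x.2.2, ← pairing_cut_comm]

/-- The left-hand side of the Krein equation at `(x, x - y)`. -/
noncomputable def invDefect (ρ : L2Line A) : C(UnitI × UnitI, A) :=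
  ⟨fun p => invC ρ p + invH ρ p.2 + convMap (mulRightB A) (invPotential ρ) (invRow ρ p.1)
    (projIcc 0 1 zero_le_one ((p.1 : ℝ) - p.2)), by
    refine (by fun_prop : Continuous fun p : UnitI × UnitI => invC ρ p + invH ρ p.2).add ?_
    refine Continuous.eval ((continuous_convMap (mulRightB A)).comp (f := fun p : UnitI × UnitI =>
      (invPotential ρ, invRow ρ p.1)) (continuous_const.prodMk
        ((invRowMap ρ).continuous.comp continuous_fst)))
      (continuous_projIcc.comp (by fun_prop))⟩

theorem invDefect_apply (ρ : L2Line A) {x y t : UnitI} (ht : (t : ℝ) = x - y) :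
    invDefect ρ (x, y) = invC ρ (x, y) + invH ρ y +
      convMap (mulRightB A) (invPotential ρ) (invRow ρ x) t := by
  change _ + _ + convMap (mulRightB A) (invPotential ρ) (invRow ρ x)
    (projIcc 0 1 zero_le_one ((x : ℝ) - y)) = _
  rw [← ht, projIcc_val]

/-- Put V(s) = H(s - y) + ∫ R(s,η) H(η - y) dη. Then h(y) = ∫_0^y ρV, so the defect at (x,y) is
β(x,y) - ∫_y^x ρV. At (s, s - y) the defect is R(s,y) + V(s), and integrating it against ρ over
(y,x] gives -β(x,y) + ∫_y^x ρV. -/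
theorem invDefect_add_windowOp (ρ : L2Line A) {x y : UnitI} (hyx : (y : ℝ) ≤ x) :
    invDefect ρ (x, y) + windowOp ρ (invDefect ρ) (x, y) = 0 := by
  set H := invPotential ρ with hH
  have hE : IsEven H := isEven_evenExt _
  set V := shift y H + embLine (invRowConv ρ H y) with hV
  -- The convolution formula for the row at y, taken at t = 0.
  have h1 : invH ρ y = pairing (mulLeftB A) (cut 0 y ρ) V := by
    rw [← neg_neg (invH ρ y), ← convMap_invRow_zero,
      convMap_invRow hE ρ (y := y) (t := 0) (by simp), neg_neg]
  have h2 := invDefect_apply ρ (x := x) (y := y)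
    (t := ⟨(x : ℝ) - y, sub_nonneg.2 hyx, by linarith [x.2.2, y.2.1]⟩) rfl
  rw [convMap_invRow hE ρ (y := y) rfl, h1] at h2
  have h3 : pairing (mulLeftB A) (cut 0 x ρ) V =
      pairing (mulLeftB A) (cut 0 y ρ) V + pairing (mulLeftB A) (cut y x ρ) V := by
    rw [pairing_cut_left _ x.2.1, pairing_cut_left _ y.2.1, pairing_cut_left _ hyx]
    exact (intervalIntegral.integral_add_adjacent_intervals
      (integrable_bilin_L2 _ _ _).intervalIntegrable
      (integrable_bilin_L2 _ _ _).intervalIntegrable).symm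
  have h4 : invC ρ (x, y) + pairing (mulLeftB A) (cut y x ρ)
      (sample diagonalVar (invC ρ) (x, y)) = pairing (mulLeftB A) (cut y x ρ) (shift y ρ) :=
    DFunLike.congr_fun (invC_add_windowOp ρ) (x, y)
  have h5 : windowOp ρ (invDefect ρ) (x, y) = pairing (mulLeftB A) (cut y x ρ)
      (sample diagonalVar (invC ρ) (x, y) - shift y ρ + V) := by
    change pairing (mulLeftB A) (cut y x ρ) (sample diagonalVar (invDefect ρ) (x, y)) = _
    rw [pairing_cut_left _ hyx, pairing_cut_left _ hyx]
    refine intervalIntegral.integral_congr_ae ?_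
    have hq := (measurePreserving_sub_right (volume : Measure ℝ) (y : ℝ)).quasiMeasurePreserving
    filter_upwards [Lp.coeFn_add (sample diagonalVar (invC ρ) (x, y) - shift (y : ℝ) ρ) V,
      Lp.coeFn_sub (sample diagonalVar (invC ρ) (x, y)) (shift (y : ℝ) ρ),
      Lp.coeFn_add (shift (y : ℝ) H) (embLine (invRowConv ρ H y)),
      coeFn_shift (y : ℝ) ρ, coeFn_shift (y : ℝ) H, coeFn_embLine (invRowConv ρ H y),
      coeFn_embLine (((invC ρ).comp diagonalVar).curry (x, y)),
      coeFn_embLine (((invDefect ρ).comp diagonalVar).curry (x, y)),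
      hq.ae (evenExt_ae (ρ + embLine (invH ρ))), hq.ae (Lp.coeFn_add ρ (embLine (invH ρ))),
      hq.ae (coeFn_embLine (invH ρ))]
      with s g1 g2 g3 g4 g5 g6 g7 g8 g9 g10 g11 hs
    rw [uIoc_of_le hyx] at hs
    have hs1 : s ∈ Ioc (0 : ℝ) 1 := ⟨y.2.1.trans_lt hs.1, hs.2.trans x.2.2⟩
    have hs2 : s ∈ Icc (0 : ℝ) 1 := Ioc_subset_Icc_self hs1
    have hs3 : s - y ∈ Ioc (0 : ℝ) 1 := ⟨sub_pos.2 hs.1, by linarith [hs1.2, y.2.1]⟩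
    have hs4 : s - y ∈ Icc (0 : ℝ) 1 := Ioc_subset_Icc_self hs3
    congr 1
    have g12 : H (s - y) = ρ (s - y) + invH ρ ⟨s - y, hs4⟩ := by
      rw [hH, invPotential, g9 hs3, g10, Pi.add_apply, g11, indicator_of_mem hs3,
        IccExtend_of_mem _ _ hs4]
    have g13 : sample diagonalVar (invC ρ) (x, y) s = invC ρ (⟨s, hs2⟩, ⟨s - y, hs4⟩) := by
      rw [sample_apply, g7, indicator_of_mem hs1, IccExtend_of_mem _ _ hs2]
      change invC ρ (⟨s, hs2⟩, projIcc 0 1 zero_le_one (s - y)) = _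
      rw [projIcc_of_mem zero_le_one hs4]
    have g14 : sample diagonalVar (invDefect ρ) (x, y) s =
        invDefect ρ (⟨s, hs2⟩, ⟨s - y, hs4⟩) := by
      rw [sample_apply, g8, indicator_of_mem hs1, IccExtend_of_mem _ _ hs2]
      change invDefect ρ (⟨s, hs2⟩, projIcc 0 1 zero_le_one (s - y)) = _
      rw [projIcc_of_mem zero_le_one hs4]
    rw [g14, invDefect_apply ρ (t := y) (by simp), g1, Pi.add_apply, g2, Pi.sub_apply, g13, g4,
      hV, g3, Pi.add_apply, g5, g12, g6, indicator_of_mem hs1, IccExtend_of_mem _ _ hs2]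
    change _ = invC ρ (⟨s, hs2⟩, ⟨s - y, hs4⟩) - ρ (s - y) + (ρ (s - y) + invH ρ ⟨s - y, hs4⟩ +
      convMap (mulRightB A) H (invRow ρ ⟨s, hs2⟩) y)
    abel
  rw [pairing_add_right, pairing_sub_right, ← h4] at h5
  rw [h2, h5, ← hV, h3]
  abel

/-- The equation is known only for y ≤ x, bijectivity only on the whole square. The operator W
samples only points (s, s - y), which satisfy s - y ≤ s; so G = E + WE has WG = 0. Hence E and G
have the same image G under 1 + W, and E = G. -/
theorem eq_zero_of_add_windowOp (ρ : L2Line A) {E : C(UnitI × UnitI, A)}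
    (hE : ∀ x y : UnitI, (y : ℝ) ≤ x → E (x, y) + windowOp ρ E (x, y) = 0) {x y : UnitI}
    (hyx : (y : ℝ) ≤ x) : E (x, y) = 0 := by
  set G := E + windowOp ρ E with hG
  have h1 : windowOp ρ G = 0 := ContinuousMap.ext fun p => by
    obtain ⟨x, y⟩ := p
    change pairing (mulLeftB A) (cut y x ρ) (sample diagonalVar G (x, y)) = 0
    refine integral_eq_zero_of_ae ?_
    filter_upwards [coeFn_cut (y : ℝ) x ρ,
      coeFn_embLine ((G.comp diagonalVar).curry (x, y))] with s g1 g2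
    by_cases hs : s ∈ Ioc (y : ℝ) x
    · have hs1 : s ∈ Ioc (0 : ℝ) 1 := ⟨y.2.1.trans_lt hs.1, hs.2.trans x.2.2⟩
      have hs2 : s ∈ Icc (0 : ℝ) 1 := Ioc_subset_Icc_self hs1
      have hs4 : s - y ∈ Icc (0 : ℝ) 1 := ⟨sub_nonneg.2 hs.1.le, by linarith [hs1.2, y.2.1]⟩
      have g3 : sample diagonalVar G (x, y) s = 0 := by
        rw [sample_apply, g2, indicator_of_mem hs1, IccExtend_of_mem _ _ hs2]
        change G (⟨s, hs2⟩, projIcc 0 1 zero_le_one (s - y)) = 0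
        rw [projIcc_of_mem zero_le_one hs4]
        exact hE _ _ (by simpa using y.2.1)
      rw [g3, map_zero]
      rfl
    · rw [g1, indicator_of_notMem hs, map_zero]
      rfl
  have h2 : E = G := (bijective_add_windowOp ρ).1 (by
    change E + windowOp ρ E = G + windowOp ρ G
    rw [h1, add_zero])
  rw [h2]
  exact hE x y hyx

theorem invDefect_eq_zero (ρ : L2Line A) {x y : UnitI} (hyx : (y : ℝ) ≤ x) :
    invDefect ρ (x, y) = 0 :=
  eq_zero_of_add_windowOp ρ (fun _ _ => invDefect_add_windowOp ρ) hyx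

theorem isKreinRow_invRow (ρ : L2Line A) (x : UnitI) :
    IsKreinRow (invPotential ρ) x (invRow ρ x) := by
  set H := invPotential ρ with hH
  have hE : IsEven H := isEven_evenExt _
  rw [IsKreinRow]
  ext1
  have hq := quasiMeasurePreserving_sub_left_of_right_invariant (volume : Measure ℝ) (x : ℝ)
  filter_upwards [Lp.coeFn_add (invRow ρ x)
      (cut 0 x (embLine (convMap (mulRightB A) H (invRow ρ x)))),
    Lp.coeFn_neg (cut 0 x (shift x H)), coeFn_cut 0 (x : ℝ) (shift x H), coeFn_shift (x : ℝ) H,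
    hE.shift_eq (x : ℝ),
    coeFn_cut_embLine (a := 0) le_rfl x.2.2 (convMap (mulRightB A) H (invRow ρ x)),
    coeFn_invRow ρ x, hq.ae (evenExt_ae (ρ + embLine (invH ρ))),
    hq.ae (Lp.coeFn_add ρ (embLine (invH ρ))), hq.ae (coeFn_embLine (invH ρ)),
    (Ioo_ae_eq_Ioc (μ := volume) (a := (0 : ℝ)) (b := x)).mem_iff]
    with t g1 g2 g3 g4 g5 g6 g7 g8 g9 g10 g11
  rw [g1, g2, Pi.add_apply, Pi.neg_apply, g3, g6, g7]
  by_cases ht : t ∈ Ioc (0 : ℝ) x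
  · have ht1 : t ∈ Icc (0 : ℝ) 1 := ⟨ht.1.le, ht.2.trans x.2.2⟩
    have ht2 : (x : ℝ) - t ∈ Ioc (0 : ℝ) 1 :=
      ⟨sub_pos.2 (g11.2 ht).2, by linarith [ht.1, x.2.2]⟩
    have ht3 : (x : ℝ) - t ∈ Icc (0 : ℝ) 1 := Ioc_subset_Icc_self ht2
    have h1 : H (x - t) = ρ (x - t) + invH ρ ⟨x - t, ht3⟩ := by
      rw [hH, invPotential, g8 ht2, g9, Pi.add_apply, g10, indicator_of_mem ht2,
        IccExtend_of_mem _ _ ht3]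
    have h2 := invDefect_apply ρ (x := x) (y := ⟨x - t, ht3⟩) (t := ⟨t, ht1⟩) (by simp)
    rw [invDefect_eq_zero ρ (by simpa using ht.1.le)] at h2
    rw [indicator_of_mem ht, indicator_of_mem ht, indicator_of_mem ht, g4, g5, h1,
      IccExtend_of_mem _ _ ht1, invKernel, projIcc_of_mem zero_le_one ht3, projIcc_val,
      ← sub_eq_zero, h2]
    abel
  · rw [indicator_of_notMem ht, indicator_of_notMem ht, indicator_of_notMem ht, add_zero, neg_zero]

end InverseKrein

/-! ### The constructed potential is an accelerant -/

section InverseAccelerant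

variable {A : Type*} [NormedRing A] [NormedAlgebra ℂ A] [CompleteSpace A]

/-- A Volterra equation `F(x) = ∫_x^a k(x, t) F(t) dt` has only the trivial solution. -/
theorem cut_embLine_eq_zero_of_norm_le {a N : ℝ} (ha : a ∈ Icc (0 : ℝ) 1) {F : C(UnitI, A)}
    (h : ∀ x : UnitI, (x : ℝ) ≤ a → ‖F x‖ ≤ N * ‖cut x a (embLine F)‖) :
    cut 0 a (embLine F) = 0 := by
  -- Grönwall runs backwards from a, in the variable τ = a - x.
  set u : ℝ → ℝ := fun τ => ‖cut (a - τ) a (embLine F)‖ ^ 2 with hu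
  have huc : Continuous u := by
    refine Continuous.pow (Continuous.norm ?_) 2
    exact continuous_cut.comp (f := fun τ : ℝ => (embLine F, (a - τ, a))) (by fun_prop)
  have hle : ∀ τ ∈ Icc (0 : ℝ) a, u τ ≤ N ^ 2 * ∫ t in (0 : ℝ)..τ, u t := by
    intro τ hτ
    set G : ℝ → A := IccExtend zero_le_one F with hG
    have hGc : Continuous G := F.continuous.Icc_extend'
    have h1 : u τ = ∫ t in (0 : ℝ)..τ, ‖G (a - t)‖ ^ 2 := by
      rw [intervalIntegral.integral_comp_sub_left (fun t => ‖G t‖ ^ 2) a, sub_zero, hu]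
      simp only
      rw [norm_cut_sq (by linarith [hτ.1])]
      refine intervalIntegral.integral_congr_ae ?_
      filter_upwards [coeFn_embLine F] with t h2 h3
      rw [uIoc_of_le (by linarith [hτ.1])] at h3
      have h4 : t ∈ Ioc (0 : ℝ) 1 := ⟨by linarith [h3.1, hτ.2], h3.2.trans ha.2⟩
      rw [h2, indicator_of_mem h4]
    rw [h1, ← intervalIntegral.integral_const_mul]
    refine intervalIntegral.integral_mono_on hτ.1 (Continuous.intervalIntegrable (by fun_prop) _ _)
      (Continuous.intervalIntegrable (by fun_prop) _ _) fun t ht => ?_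
    have h2 : a - t ∈ Icc (0 : ℝ) 1 := ⟨by linarith [ht.2, hτ.2], by linarith [ht.1, ha.2]⟩
    rw [← mul_pow, hG, IccExtend_of_mem _ _ h2]
    exact pow_le_pow_left₀ (norm_nonneg _) (h ⟨a - t, h2⟩ (by simpa using ht.1)) 2
  have h1 := eq_zero_of_le_mul_integral (sq_nonneg N) huc.continuousOn
    (fun x _ => sq_nonneg _) hle a ⟨ha.1, le_rfl⟩
  simp only [hu, sub_self] at h1
  exact norm_eq_zero.1 (pow_eq_zero_iff two_ne_zero |>.1 h1)

/-- If every row of the Krein equation has a solution, continuous in `x`, then `1 + 𝓗_a` is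
injective for all `a ∈ [0, 1]`. -/
theorem convInjective_of_isKreinRow {H : L2Line A} (hE : IsEven H) {R : C(UnitI, L2Line A)}
    (hR : ∀ x : UnitI, IsKreinRow H x (R x)) (hcut : ∀ x : UnitI, cut 0 x (R x) = R x) :
    ConvInjective (norm_mulLeftB_le (A := A)) H := by
  intro a ha F hF
  set g := cut 0 a (embLine F) with hg
  rw [convOp_apply, ← hg] at hF
  have hFc : F = -convMap (mulLeftB A) H g := eq_neg_of_add_eq_zero_left hF
  obtain ⟨C, hC⟩ := isCompact_univ.exists_bound_of_continuousOn R.continuous.continuousOn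
  have hzero : g = 0 := by
    -- `C` bounds the rows; thus ‖H‖ * C bounds c below and ‖H‖ bounds the translate of H, the two
    -- parts of the Volterra kernel.
    refine cut_embLine_eq_zero_of_norm_le (N := ‖H‖ * C + ‖H‖) ha fun x hxa => ?_
    set c := embLine (convMap (mulRightB A) H (R x)) with hc
    have h01 : ∀ f : L2Line A, cut 0 1 (cut 0 x f) = cut 0 x f := fun f => by
      rw [cut_cut, max_self, min_eq_right x.2.2]
    have hg1 : cut 0 1 g = g := by rw [hg, cut_cut, max_self, min_eq_right ha.2]
    have hgx : cut x a g = cut x a (embLine F) := by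
      rw [hg, cut_cut, max_eq_left x.2.1, min_self]
    have hsplit : ∀ f : L2Line A, pairing (mulLeftB A) f g =
        pairing (mulLeftB A) (cut 0 x f) g + pairing (mulLeftB A) f (cut x a g) := fun f => by
      have h1 : pairing (mulLeftB A) f g = pairing (mulLeftB A) f (cut 0 a g) := by
        rw [hg, cut_cut, max_self, min_self]
      rw [h1, pairing_cut_comm, pairing_cut_right _ ha.1, pairing_cut_right _ x.2.1,
        pairing_cut_right _ hxa]
      exact (intervalIntegral.integral_add_adjacent_intervals
        (integrable_bilin_L2 _ _ _).intervalIntegrable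
        (integrable_bilin_L2 _ _ _).intervalIntegrable).symm
    -- Pairing F = -𝓗g with the row and transposing moves the convolution onto the row, over all of
    -- (0,a].
    have h1 : pairing (mulLeftB A) (R x) (embLine F) =
        -pairing (mulLeftB A) c g := by
      have h2 := pairing_convMap_comm hE (R x) g
      rw [← hcut x, h01, hcut x, hg1] at h2
      rw [hFc, map_neg, pairing_neg_right, h2]
    have h3 : pairing (mulLeftB A) (R x) (embLine F) = pairing (mulLeftB A) (R x) g := by
      rw [← hcut x, pairing_cut_comm, pairing_cut_comm, hg, cut_cut, max_self, min_eq_left hxa]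
    have hRx : R x + cut 0 x c = -cut 0 x (shift x H) := hR x
    -- On (0,x] the row equation replaces H(· - x) by -(R + c). The contributions over (0,x] then
    -- cancel, leaving an integral over (x,a].
    have h4 : F x = -pairing (mulLeftB A) (shift x H + c) (cut x a (embLine F)) := by
      have h5 : F x = -pairing (mulLeftB A) (shift x H) g := DFunLike.congr_fun hFc x
      have h6 := hsplit c
      have h7 : pairing (mulLeftB A) (cut 0 x (shift x H)) g =
          -(pairing (mulLeftB A) (R x) g + pairing (mulLeftB A) (cut 0 x c) g) := by
        rw [← neg_neg (cut 0 x (shift x H)), ← hRx, pairing_neg_left, pairing_add_left]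
      rw [h5, hsplit, h7, ← h3, h1, h6, pairing_add_left, hgx]
      abel
    rw [h4, norm_neg]
    refine (norm_pairing_le norm_mulLeftB_le _ _).trans ?_
    refine mul_le_mul_of_nonneg_right ?_ (norm_nonneg _)
    rw [add_comm]
    refine (norm_add_le _ _).trans (add_le_add ?_ (LinearIsometry.norm_map _ _).le)
    refine (norm_embLine_le _).trans ((norm_convMap_le norm_mulRightB_le _ _).trans ?_)
    exact mul_le_mul_of_nonneg_left (hC x (mem_univ _)) (norm_nonneg _)
  rw [hFc, hzero, convMap_zero_right, neg_zero]

theorem convInjective_invPotential (ρ : L2Line A) :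
    ConvInjective (norm_mulLeftB_le (A := A)) (invPotential ρ) :=
  convInjective_of_isKreinRow (R := invRowMap ρ) (isEven_evenExt _) (isKreinRow_invRow ρ)
    (cut_invRow ρ)

/-- By uniqueness of rows the constructed kernel is the Krein kernel, so Θ of the potential is (ρ +
h) - h = ρ. -/
theorem kreinSection_invPotential [FiniteDimensional ℂ A] (ρ : L2Line A)
    (h : ConvInjective (norm_mulRightB_le (A := A)) (invPotential ρ)) :
    kreinSection h 0 = invH ρ := ContinuousMap.ext fun x => by
  have h1 : kreinRow (invPotential ρ) x = invRow ρ x :=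
    (isKreinRow_kreinRow h x.2).unique h x.2 (isKreinRow_invRow ρ x)
  change kreinC (invPotential ρ) x 0 = invH ρ x
  rw [kreinC_eq h x.2, h1, ContinuousMap.neg_apply, convMap_invRow_zero, neg_neg]

end InverseAccelerant

/-! ### The inverse of Θ and the homeomorphism -/

section ThetaInverse

variable {r : ℕ}

/-- Restriction to `(-1, 1)`. -/
noncomputable def restrictSym : L2Line (Mr r) →L[ℂ] L2Sym r :=
  LpToLpRestrictCLM ℝ (Mr r) ℂ volume 2 (Ioo (-1 : ℝ) 1)

/-- The even extension is supported in [-1,1], so only the null set of endpoints is lost. -/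
theorem symExt_restrictSym_evenExt (f : L2Line (Mr r)) :
    symExt (restrictSym (evenExt f)) = evenExt f := by
  ext1
  have h0 := (ae_restrict_iff' measurableSet_Ioo).1
    (LpToLpRestrictCLM_coeFn ℂ (Ioo (-1 : ℝ) 1) (evenExt f))
  have hne : ∀ᵐ x : ℝ, x ≠ 1 ∧ x ≠ -1 := by
    rw [eventually_and]
    constructor <;> simp [ae_iff]
  filter_upwards [coeFn_extendZero (Ioo (-1 : ℝ) 1) measurableSet_Ioo (restrictSym (evenExt f)),
    h0, coeFn_evenExt f, hne] with x h1 h2 h3 h4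
  refine h1.trans ?_
  by_cases hx : x ∈ Ioo (-1 : ℝ) 1
  · rw [indicator_of_mem hx]
    exact h2 hx
  · have h5 : x ∉ Ioc (0 : ℝ) 1 := fun h =>
      hx ⟨by linarith [h.1], lt_of_le_of_ne h.2 h4.1⟩
    have h6 : -x ∉ Ioc (0 : ℝ) 1 := fun h =>
      hx ⟨lt_of_le_of_ne (by linarith [h.2]) h4.2.symm, by linarith [h.1]⟩
    rw [indicator_of_notMem hx, h3, indicator_of_notMem h5, indicator_of_notMem h6, add_zero]

/-- The inverse of `Θ`. -/
noncomputable def thetaInv (ρ : L2Unit r) : accelerants r :=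
  ⟨restrictSym (invPotential (unitExt ρ)), mem_accelerants_of_convInjective
    (by
      rw [invPotential, symExt_restrictSym_evenExt]
      exact isEven_evenExt _)
    (by
      rw [invPotential, symExt_restrictSym_evenExt]
      exact convInjective_invPotential _)⟩

theorem continuous_thetaInv : Continuous (thetaInv (r := r)) :=
  (restrictSym.continuous.comp (continuous_invPotential.comp unitExt.continuous)).subtype_mk _

theorem Theta_thetaInv (ρ : L2Unit r) : Theta r (thetaInv ρ) = ρ := by
  have hR := convInjective_right_of_mem_accelerants (thetaInv ρ).2
  have h1 : symExt (thetaInv ρ).1 = invPotential (unitExt ρ) := symExt_restrictSym_evenExt _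
  have hR' : ConvInjective (norm_mulRightB_le (A := Mr r)) (invPotential (unitExt ρ)) := by
    rwa [← h1]
  have h2 : kreinSection hR 0 = invH (unitExt ρ) := by
    rw [← kreinSection_invPotential _ hR']
    congr 1
  rw [Theta_eq, h2, h1]
  ext1
  set f := invPotential (unitExt ρ)
  filter_upwards [coeFn_restrictUnit (f - embLine (invH (unitExt ρ))),
    ae_restrict_of_ae (Lp.coeFn_sub f (embLine (invH (unitExt ρ)))),
    ae_restrict_of_ae (evenExt_ae (unitExt ρ + embLine (invH (unitExt ρ)))),
    ae_restrict_of_ae (Lp.coeFn_add (unitExt ρ) (embLine (invH (unitExt ρ)))),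
    ae_restrict_of_ae (coeFn_extendZero (Ioo (0 : ℝ) 1) measurableSet_Ioo ρ),
    ae_restrict_mem measurableSet_Ioo] with x g1 g2 g3 g4 g5 hx
  rw [indicator_of_mem hx] at g5
  rw [g1, g2, Pi.sub_apply, ← g5]
  change invPotential (unitExt ρ) x - _ = unitExt ρ x
  rw [invPotential, g3 (Ioo_subset_Ioc_self hx), g4, Pi.add_apply, add_sub_cancel_right]

/-- Injectivity of Θ upgrades the continuous right inverse to a two-sided one. -/
theorem isHomeomorph_Theta : IsHomeomorph (Theta r) := by
  refine isHomeomorph_iff_exists_inverse.2 ⟨continuous_Theta, thetaInv, fun H => ?_,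
    Theta_thetaInv, continuous_thetaInv⟩
  exact Theta_injective (Theta_thetaInv _)

end ThetaInverse

end KreinAccelerants

theorem theorem1p7 (r : ℕ) :
    (∀ H : accelerants r,
      (∃! R : L2Tri r, IsKreinSolution H.1 R) ∧
        IsSectionAtZero (kreinSolution H.1) (-Theta r H)) ∧
    IsHomeomorph (Theta r) ∧
    ∀ H : accelerants r,
      ∃ hstar : star H.1 ∈ accelerants r, Theta r ⟨star H.1, hstar⟩ = star (Theta r H) := by
  exact ⟨fun H => ⟨existsUnique_kreinSolution H.2, isSectionAtZero_kreinSolution H⟩,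
    isHomeomorph_Theta, fun H => ⟨star_mem_accelerants H.2, Theta_star H⟩⟩
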